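/- Let $\{x_k\}_{k\ge1}\subset[1,\infty)$ be strictly increasing, let $p\in(0,1)$, and let $a,\theta\in C^1([0,\infty))$ take values in $[0,1]$ with $a(0)=0$, $a(x)>0$ for $x>0$, $a(x)=1$ for $x\ge1$, $\theta(x)=0$ for $x\ge1$ and $\theta(x)=1$ for $x\le\frac12$. Let $X$ be the piecewise-deterministic Markov process on $[0,\infty)$ which moves along $dx=-a(x)\,dt$ between its jumps and, when at $x$, jumps to $x_k$ with intensity $\theta(x)(1-p)p^{k-1}$, $k\ge1$; that is, the process with extended generator $$\mathcal A f(x)=-a(x)f'(x)+\theta(x)\sum_{k\ge1}(1-p)p^{k-1}\,[f(x_k)-f(x)].$$ Let $P_t(x,dy)$ be its transition function and $T_tf(x)=\int f(y)\,P_t(x,dy)$. Definitions. A $(\mu,\nu)$-coupling for $X$ is a pair of càdlàg processes $(Z^1,Z^2)$ on one probability space such that $Z^1$ and $Z^2$ have the distributions of $X$ started from $\mu$ and from $\nu$. For $\phi\ge1$, $X$ admits an exponential $\phi$-coupling if there are an invariant probability measure $\pi$ and constants $C,\beta>0$ such that for every $x$ there is a $(\delta_x,\pi)$-coupling with $$E\big[(\phi(Z^1_t)+\phi(Z^2_t))1_{Z^1_t\ne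 Z^2_t}\big]\le Ce^{-\beta t}\phi(x),\qquad t\ge0.$$ For an invariant probability measure $\pi$ and $r\in(1,\infty)$ let $L_r^0$ be the space of complex $f\in L_r(\pi)$ with $\int f\,d\pi=0$. For $\gamma>0$, $X$ has property $SG_r(\gamma)$ if every $\lambda\in\mathbb C$ with $\mathrm{Re}\,\lambda>-\gamma$ is in the resolvent set of the generator of $\{T_t\}$ on $L_r^0$; property $GB_r(\gamma)$ if, for some $C$, $\|T_tf\|_r\le Ce^{-\gamma t}\|f\|_r$ for all $t\ge0$, $f\in L^0_r$; property $PI(\gamma)$ if $\|T_tf\|_2\le e^{-\gamma t}\|f\|_2$ for all $t\ge0$, $f\in L_2^0$. The Poincaré inequality is $PI(\gamma)$ for some $\gamma>0$, or, in terms of the Dirichlet form, $\int|f|^2d\pi-\left|\int f\,d\pi\right|^2\le c\,\mathcal E(f,f)$ with some $c$, where $\mathcal E(f,f)=-\mathrm{Re}(Af,f)_{L_2}$ for $f$ in the domain of the $L_2(\pi)$-generator $A$. Then: (1) For every $\alpha>0$ with $\sum_{k\ge1}p^ke^{\alpha x_k}<\infty$, $X$ admits an exponential $\phi$-coupling with $\phi(x)=e^{\alpha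 x}$. (2) Necessity: if, for some invariant probability measure $\pi$, $X$ satisfies $SG_r(\gamma)$ with some $r\in(1,\infty)$ and $\gamma>0$, then $\sup_k(x_{k+1}-x_k)<\infty$. Sufficiency: if $\sup_k(x_{k+1}-x_k)<\infty$, then $X$ has a unique invariant probability measure, and for every $r\in(1,\infty)$ there is $\gamma'>0$ such that $X$ satisfies $GB_r(\gamma')$. (3) For every such $a,\theta,p,\{x_k\}$ and every invariant probability measure $\pi$, $X$ does not satisfy the Poincaré inequality, in either form. Consequently $GB_2$ does not imply $PI$: there are $a,\theta,p,\{x_k\}$ as above for which $X$ satisfies $GB_2(\gamma)$ with some $\gamma>0$, but $PI(\gamma')$ for no $\gamma'>0$. -/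

import Mathlib

open MeasureTheory ProbabilityTheory Set Filter Topology
open scoped NNReal ENNReal unitInterval

namespace DriftJump

/-! ### Markov processes, exponential couplings -/

/-- `π` is invariant for the transition function `P`. -/
def IsInvariant {S : Type*} [MeasurableSpace S] (P : ℝ≥0 → S → Measure S) (π : Measure S) :
    Prop :=
  ∀ (t : ℝ≥0) (B : Set S), MeasurableSet B → ∫⁻ x, P t x B ∂π = π B

/-- Right-continuous with left limits. -/
def IsCadlag {S : Type*} [TopologicalSpace S] (z : ℝ≥0 → S) : Prop :=
  ∀ t : ℝ≥0, ContinuousWithinAt z (Ici t) t ∧ ∃ l : S, Tendsto z (𝓝[<] t) (𝓝 l)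

/-- `(Z₁, Z₂)`, defined on `(Ω, Q)`, is a `(μ, ν)`-coupling for the process for which
`law μ` is the distribution (on the space of trajectories, with the product σ-algebra) of the
version with initial distribution `μ`. -/
structure IsCoupling {S : Type*} [TopologicalSpace S] [MeasurableSpace S]
    (law : Measure S → Measure (ℝ≥0 → S)) (μ ν : Measure S)
    {Ω : Type*} [MeasurableSpace Ω] (Q : Measure Ω) (Z₁ Z₂ : ℝ≥0 → Ω → S) : Prop where
  isProbabilityMeasure : IsProbabilityMeasure Q
  measurable_fst : ∀ t, Measurable (Z₁ t)
  measurable_snd : ∀ t, Measurable (Z₂ t)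
  cadlag : ∀ᵐ ω ∂Q, IsCadlag (fun t => Z₁ t ω) ∧ IsCadlag (fun t => Z₂ t ω)
  law_fst : Q.map (fun ω t => Z₁ t ω) = law μ
  law_snd : Q.map (fun ω t => Z₂ t ω) = law ν

/-- The process with transition function `P` and path laws `law` admits an exponential
`φ`-coupling. -/
def AdmitsExpCoupling {S : Type*} [TopologicalSpace S] [MeasurableSpace S]
    (P : ℝ≥0 → S → Measure S) (law : Measure S → Measure (ℝ≥0 → S)) (φ : S → ℝ) : Prop :=
  ∃ π : Measure S, IsProbabilityMeasure π ∧ IsInvariant P π ∧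
    ∃ C β : ℝ, 0 < C ∧ 0 < β ∧
      ∀ x : S, ∃ (Ω : Type) (_ : MeasurableSpace Ω) (Q : Measure Ω) (Z₁ Z₂ : ℝ≥0 → Ω → S),
        IsCoupling law (Measure.dirac x) π Q Z₁ Z₂ ∧
        ∀ t : ℝ≥0,
          ∫⁻ ω in {ω | Z₁ t ω ≠ Z₂ t ω}, ENNReal.ofReal (φ (Z₁ t ω) + φ (Z₂ t ω)) ∂Q
            ≤ ENNReal.ofReal (C * Real.exp (-β * t) * φ x)

/-! ### One-parameter semigroups on complex normed spaces -/

section Semigroup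

variable {E : Type*} [NormedAddCommGroup E] [NormedSpace ℂ E]

/-- `f` lies in the domain of the generator `A` of the semigroup `T`, and `A f = g`. -/
def HasGenerator (T : ℝ≥0 → E → E) (f g : E) : Prop :=
  Tendsto (fun t : ℝ≥0 => ((t : ℝ) : ℂ)⁻¹ • (T t f - f)) (𝓝[>] 0) (𝓝 g)

/-- `z` is in the resolvent set of the generator `A` of `T`: the operator `z - A` is a bijection
of the domain of `A` onto `E` with a bounded linear inverse `R`. -/
def IsResolventPoint (T : ℝ≥0 → E → E) (z : ℂ) : Prop :=
  ∃ R : E →L[ℂ] E,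
    (∀ h : E, HasGenerator T (R h) (z • R h - h)) ∧
    (∀ f g : E, HasGenerator T f g → R (z • f - g) = f)

/-- `γ` is a spectral bound for the generator of `T`. -/
def IsSpectralBound (T : ℝ≥0 → E → E) (γ : ℝ) : Prop :=
  ∀ z : ℂ, -γ < z.re → IsResolventPoint T z

/-- `γ` is a growth bound for `T`. -/
def IsGrowthBound (T : ℝ≥0 → E → E) (γ : ℝ) : Prop :=
  ∃ C : ℝ, 0 ≤ C ∧ ∀ (t : ℝ≥0) (f : E), ‖T t f‖ ≤ C * Real.exp (-γ * t) * ‖f‖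

end Semigroup

/-! ### The semigroup of a Markov process in `L_r(π)` -/

section MarkovSemigroup

variable {S : Type*} [MeasurableSpace S]

/-- `T_t f (x) = ∫ f(y) P_t(x, dy)`. -/
noncomputable def markovOp (P : ℝ≥0 → S → Measure S) (t : ℝ≥0) (f : S → ℂ) (x : S) : ℂ :=
  ∫ y, f y ∂(P t x)

/-- The subspace `L_r^0` of the functions in `L_r(π)` (complex-valued) with zero mean. -/
noncomputable def LpZero (π : Measure S) [IsFiniteMeasure π] (r : ℝ≥0∞) [Fact (1 ≤ r)] :
    Submodule ℂ (Lp ℂ r π) where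
  carrier := {f | ∫ x, f x ∂π = 0}
  zero_mem' := by
    have h := integral_congr_ae (Lp.coeFn_zero ℂ r π)
    simpa using h
  add_mem' := by
    intro f g hf hg
    have hf' : Integrable f π := (Lp.memLp f).integrable Fact.out
    have hg' : Integrable g π := (Lp.memLp g).integrable Fact.out
    have h := integral_congr_ae (Lp.coeFn_add f g)
    simp only [mem_ofPred_eq] at hf hg ⊢
    rw [h]
    simp only [Pi.add_apply]
    rw [integral_add hf' hg', hf, hg, add_zero]
  smul_mem' := by
    intro c f hf
    have h := integral_congr_ae (Lp.coeFn_smul c f)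
    simp only [mem_ofPred_eq] at hf ⊢
    rw [h]
    simp only [Pi.smul_apply]
    rw [integral_smul, hf, smul_zero]

/-- The restriction of the semigroup `T_t` to a subspace `V` of `L_r(π)` that it leaves invariant:
`T_t f` is the element of `V` represented by `x ↦ ∫ f(y) P_t(x, dy)`. -/
noncomputable def lpSemigroup (P : ℝ≥0 → S → Measure S) {π : Measure S} {r : ℝ≥0∞}
    [Fact (1 ≤ r)] (V : Submodule ℂ (Lp ℂ r π)) (t : ℝ≥0) (f : V) : V :=
  Classical.epsilon fun g : V =>
    ((g : Lp ℂ r π) : S → ℂ) =ᵐ[π] markovOp P t ((f : Lp ℂ r π) : S → ℂ)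

/-- Property `SG_r(γ)`. -/
def SG (P : ℝ≥0 → S → Measure S) (π : Measure S) [IsFiniteMeasure π] (r : ℝ≥0∞)
    [Fact (1 ≤ r)] (γ : ℝ) : Prop :=
  IsSpectralBound (lpSemigroup P (LpZero π r)) γ

/-- Property `GB_r(γ)`. -/
def GB (P : ℝ≥0 → S → Measure S) (π : Measure S) [IsFiniteMeasure π] (r : ℝ≥0∞)
    [Fact (1 ≤ r)] (γ : ℝ) : Prop :=
  IsGrowthBound (lpSemigroup P (LpZero π r)) γ

/-- Property `PI(γ)`: `‖T_t f‖₂ ≤ e^{-γ t} ‖f‖₂` on `L_2^0`. -/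
def PI (P : ℝ≥0 → S → Measure S) (π : Measure S) [IsFiniteMeasure π] (γ : ℝ) : Prop :=
  ∀ (t : ℝ≥0) (f : LpZero π 2),
    ‖lpSemigroup P (LpZero π 2) t f‖ ≤ Real.exp (-γ * t) * ‖f‖

/-- The Poincaré inequality with constant `c` in terms of the Dirichlet form
`𝓔(f, f) = -Re (A f, f)`, where `A` is the generator of the semigroup in `L_2(π)`. It is stated on
the domain of `A`, which is dense in the domain of the form by the definition of the latter. -/
def PoincareDirichlet (P : ℝ≥0 → S → Measure S) (π : Measure S) (c : ℝ) : Prop :=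
  ∀ f g : (⊤ : Submodule ℂ (Lp ℂ 2 π)), HasGenerator (lpSemigroup P ⊤) f g →
    ‖f‖ ^ 2 - ‖∫ x, (f : Lp ℂ 2 π) x ∂π‖ ^ 2
      ≤ c * -(inner ℂ (g : Lp ℂ 2 π) (f : Lp ℂ 2 π)).re

end MarkovSemigroup

/-! ### The piecewise-deterministic process on `[0, ∞)` -/

/-- The parameters of the process. The point `x_{k+1}` of the sequence `x_1 < x_2 < …` is
`x k`, `k = 0, 1, 2, …`. The functions `a` and `θ` matter on `[0, ∞)` only. -/
structure Model where
  a : ℝ → ℝ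
  θ : ℝ → ℝ
  p : ℝ
  x : ℕ → ℝ≥0
  contDiffOn_a : ContDiffOn ℝ 1 a (Ici 0)
  contDiffOn_θ : ContDiffOn ℝ 1 θ (Ici 0)
  a_mem : ∀ y, 0 ≤ y → a y ∈ Icc (0 : ℝ) 1
  θ_mem : ∀ y, 0 ≤ y → θ y ∈ Icc (0 : ℝ) 1
  a_zero : a 0 = 0
  a_pos : ∀ y, 0 < y → 0 < a y
  a_eq_one : ∀ y, 1 ≤ y → a y = 1
  θ_eq_zero : ∀ y, 1 ≤ y → θ y = 0
  θ_eq_one : ∀ y, 0 ≤ y → y ≤ 1 / 2 → θ y = 1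
  p_pos : 0 < p
  p_lt_one : p < 1
  one_le_x : ∀ k, 1 ≤ x k
  strictMono_x : StrictMono x

namespace Model

variable (M : Model)

/-- `u` is the solution on `[0, ∞)` of the equation `u' = -a(u)` with `u(0) = y`. -/
def IsSolution (y : ℝ≥0) (u : ℝ → ℝ) : Prop :=
  u 0 = y ∧ ∀ t, 0 ≤ t → 0 ≤ u t ∧ HasDerivWithinAt u (-(M.a (u t))) (Ici 0) t

/-- The flow `ψ_t(y)` of the equation `dx = -a(x) dt`. -/
noncomputable def flow (y t : ℝ≥0) : ℝ≥0 :=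
  (Classical.epsilon (M.IsSolution y) (t : ℝ)).toNNReal

/-- The law on `ℕ` with weights `(1 - p) p ^ k`. -/
noncomputable def indexLaw : Measure ℕ :=
  Measure.sum fun k => ENNReal.ofReal ((1 - M.p) * M.p ^ k) • Measure.dirac k

/-- One step of randomness `(e, v, k)`: a holding time `e`, exponential with intensity `1`, a
uniform variable `v` on `[0, 1]`, and an index `k`, independent of each other. -/
noncomputable def stepLaw : Measure (ℝ × I × ℕ) :=
  (expMeasure 1).prod ((volume : Measure I).prod M.indexLaw)

/-- The law of an i.i.d. sequence of steps. -/
noncomputable def seedLaw : Measure (ℕ → ℝ × I × ℕ) :=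
  Measure.infinitePi fun _ => M.stepLaw

/-- The time of the `n`-th ring of a Poisson clock with intensity `1`. -/
noncomputable def ringTime (ω : ℕ → ℝ × I × ℕ) (n : ℕ) : ℝ≥0 :=
  ∑ i ∈ Finset.range n, (ω i).1.toNNReal

/-- The position just after the `n`-th ring. Between the rings the process follows the flow. If it
is at `z` when the clock rings, it jumps with probability `θ(z)`, and then to the point number `k`
with probability `(1 - p) p ^ k`; otherwise it stays at `z`. So the intensity of a jump from `z` to
the point number `k` is `(1 - p) p ^ k θ(z)`. -/
noncomputable def ringState (y : ℝ≥0) (ω : ℕ → ℝ × I × ℕ) : ℕ → ℝ≥0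
  | 0 => y
  | n + 1 =>
    let z := M.flow (ringState y ω n) (ω n).1.toNNReal
    if ((ω n).2.1 : ℝ) < M.θ z then M.x (ω n).2.2 else z

/-- The number of rings up to and including time `t` (almost surely finite). -/
noncomputable def ringCount (ω : ℕ → ℝ × I × ℕ) (t : ℝ≥0) : ℕ :=
  sInf {n | t < ringTime ω (n + 1)}

/-- The trajectory `X_t` started at `y`. -/
noncomputable def path (y : ℝ≥0) (ω : ℕ → ℝ × I × ℕ) (t : ℝ≥0) : ℝ≥0 :=
  M.flow (M.ringState y ω (ringCount ω t)) (t - ringTime ω (ringCount ω t))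

/-- The distribution of the process with initial distribution `μ` on the space of trajectories. -/
noncomputable def pathLaw (μ : Measure ℝ≥0) : Measure (ℝ≥0 → ℝ≥0) :=
  (μ.prod M.seedLaw).map fun z => M.path z.1 z.2

/-- The transition function `P_t(y, ·)`. -/
noncomputable def transition (t y : ℝ≥0) : Measure ℝ≥0 :=
  M.seedLaw.map fun ω => M.path y ω t

/-- `sup_k (x_{k+1} - x_k) < ∞`. -/
def BoundedGaps : Prop :=
  BddAbove (range fun k => (M.x (k + 1) : ℝ) - M.x k)

end Model

end DriftJump

/-! The whole process is a function of a starting point and a seed: a Poisson clock of rate 1 whose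
rings carry a uniform mark and an index. A ring at `z` is a jump when the mark is below `θ(z)`.
Conditioning on the first ring gives a renewal equation (`transOp_first_ring`), which replaces the
generator throughout.

Coupling. Run two copies on the same seed. From below a fixed level both have, with probability
bounded below, flowed to `[0, 1/2]` before the next ring; there `θ = 1`, so both jump, to the same
point, and agree from then on. If `e^{αy} + e^{αz}` is large it shrinks on average over one ring.
Hence the weight `1 + b(e^{αy} + e^{αz})`, put to zero on the diagonal, contracts at each ring, even
after multiplication by `e^{β·(holding time)}` (`exists_pairWeight_contraction`). Summing over the
rings gives decay in real time (`exists_coupling_bound`).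

Stationary law. It is the normalised occupation measure of one excursion between jumps. Its
invariance comes from the chain observed at the rings (`isInvariant_of_ringOp_jump`,
`isInvariant_occ`), and uniqueness comes from the coupling.

Bounded gaps suffice. Bounded gaps make some exponential moment finite. To bound `T_t f` in `L_r`,
split the starting points at `1 + δt`. Below, the mean of `f` is zero, so `T_t f(x)` is the expected
difference of two coupled copies, and Hölder's inequality turns a small probability of disagreement
into decay (`enorm_markovOp_rpow_le_measure_ne`). Above, the process only translates down for a time
`δt`, and the geometric weights make the stationary measure moved down by `s` from `[1+s, ∞)` at
most a constant times `e^{-cs}` times itself (`exists_setLIntegral_transOp_le`).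

Bounded gaps are necessary, and Poincaré fails. Inside a gap of length `L` nothing but unit-speed
translation is seen: for functions supported well inside the gap `T_t φ(y) = φ(y - t)` for small
`t`, and `π` is translation invariant there. Zero-mean test functions at scale `L` satisfy `Aφ =
-φ'` and `‖φ'‖ ≤ (D/L)‖φ‖` (`exists_isTest`). A bounded inverse of `A` therefore bounds `L`.
Moreover `‖T_t φ‖ = ‖φ‖` for small `t`, so the Dirichlet form vanishes at `φ ≠ 0` and no Poincaré
inequality can hold. -/

namespace DriftJump

namespace Model

variable (M : Model)

/-! ### The flow -/

/-- The drift coefficient, extended to the real line by clamping the argument to `[0, 1]`. -/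
noncomputable def drift (y : ℝ) : ℝ := M.a (max 0 (min y 1))

theorem drift_eq {y : ℝ} (hy : 0 ≤ y) : M.drift y = M.a y := by
  unfold drift
  rcases le_total y 1 with h | h
  · rw [min_eq_left h, max_eq_right hy]
  · rw [min_eq_right h, max_eq_right zero_le_one, M.a_eq_one 1 le_rfl, M.a_eq_one y h]

theorem drift_of_nonpos {y : ℝ} (hy : y ≤ 0) : M.drift y = 0 := by
  unfold drift
  rw [min_eq_left (hy.trans zero_le_one), max_eq_left hy, M.a_zero]

theorem drift_mem (y : ℝ) : M.drift y ∈ Icc (0 : ℝ) 1 := M.a_mem _ (le_max_left _ _)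

/-- A C¹ function is Lipschitz on the compact `[0, 1]`, and clamping is 1-Lipschitz. A global
constant is what makes existence, uniqueness and the Grönwall bound hold without localisation. -/
theorem exists_lipschitzWith_drift : ∃ K : ℝ≥0, LipschitzWith K M.drift := by
  have h : ContDiffOn ℝ 1 M.a (Icc 0 1) := M.contDiffOn_a.mono Icc_subset_Ici_self
  obtain ⟨K, hK⟩ := h.exists_lipschitzOnWith one_ne_zero (convex_Icc _ _) isCompact_Icc
  refine ⟨K, ?_⟩
  have h1 : LipschitzWith 1 (fun y : ℝ => max 0 (min y 1)) :=
    (LipschitzWith.id.min_const 1).const_max 0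
  have h2 := hK.comp (s := univ) (h1.lipschitzOnWith) (fun y _ =>
    ⟨le_max_left _ _, max_le zero_le_one (min_le_right _ _)⟩)
  rw [mul_one] at h2
  exact lipschitzOnWith_univ.1 h2

theorem drift_eqOn_unique {u v : ℝ → ℝ} {T : ℝ} (h0 : u 0 = v 0)
    (hu : ∀ t ∈ Icc 0 T, HasDerivWithinAt u (-(M.drift (u t))) (Icc 0 T) t)
    (hv : ∀ t ∈ Icc 0 T, HasDerivWithinAt v (-(M.drift (v t))) (Icc 0 T) t) :
    EqOn u v (Icc 0 T) := by
  obtain ⟨K, hK⟩ := M.exists_lipschitzWith_drift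
  refine ODE_solution_unique (v := fun _ z => -(M.drift z)) (K := K) (fun _ => hK.neg)
    (fun t ht => (hu t ht).continuousWithinAt) (fun t ht => ?_)
    (fun t ht => (hv t ht).continuousWithinAt) (fun t ht => ?_) h0
  · exact ((hu t ⟨ht.1, ht.2.le⟩).mono (Icc_subset_Icc_left ht.1)).mono_of_mem_nhdsWithin
      (Icc_mem_nhdsGE ht.2)
  · exact ((hv t ⟨ht.1, ht.2.le⟩).mono (Icc_subset_Icc_left ht.1)).mono_of_mem_nhdsWithin
      (Icc_mem_nhdsGE ht.2)

theorem exists_drift_solution_Icc (y : ℝ) {T : ℝ} (hT : 0 ≤ T) :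
    ∃ u : ℝ → ℝ, u 0 = y ∧
      ∀ t ∈ Icc 0 T, HasDerivWithinAt u (-(M.drift (u t))) (Icc 0 T) t := by
  obtain ⟨K, hK⟩ := M.exists_lipschitzWith_drift
  -- The speed is at most 1, so a ball of radius `T` contains the solution up to time `T`.
  have h : IsPicardLindelof (fun _ z => -(M.drift z)) (⟨0, le_rfl, hT⟩ : Icc (0 : ℝ) T) y
      T.toNNReal 0 1 K :=
    { lipschitzOnWith := fun t _ => hK.neg.lipschitzOnWith
      continuousOn := fun x _ => continuousOn_const
      norm_le := fun t _ x _ => by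
        have := M.drift_mem x
        rw [Real.norm_eq_abs, abs_neg, abs_of_nonneg this.1]
        exact this.2
      mul_max_le := by simp [hT] }
  obtain ⟨u, hu0, hu⟩ := h.exists_eq_forall_mem_Icc_hasDerivWithinAt₀
  exact ⟨u, hu0, hu⟩

theorem exists_isSolution (y : ℝ≥0) : ∃ u, M.IsSolution y u := by
  have hex : ∀ n : ℕ, ∃ u : ℝ → ℝ, u 0 = y ∧ ∀ t ∈ Icc (0 : ℝ) (n + 1),
      HasDerivWithinAt u (-(M.drift (u t))) (Icc (0 : ℝ) (n + 1)) t :=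
    fun n => M.exists_drift_solution_Icc y (by positivity)
  choose α hα0 hα using hex
  have agree : ∀ m n : ℕ, ∀ t : ℝ, 0 ≤ t → t ≤ m + 1 → t ≤ n + 1 → α m t = α n t := by
    have key : ∀ m n : ℕ, m ≤ n → ∀ t : ℝ, 0 ≤ t → t ≤ m + 1 → α m t = α n t := by
      intro m n hmn t h0 h1
      have hsub : Icc (0 : ℝ) (m + 1) ⊆ Icc (0 : ℝ) (n + 1) :=
        Icc_subset_Icc_right (by exact_mod_cast Nat.succ_le_succ hmn)
      exact M.drift_eqOn_unique (by rw [hα0, hα0]) (hα m)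
        (fun s hs => (hα n s (hsub hs)).mono hsub) ⟨h0, h1⟩
    intro m n t h0 hm hn
    rcases le_total m n with h | h
    · exact key m n h t h0 hm
    · exact (key n m h t h0 hn).symm
  -- The `n`-th solution lives up to time `n + 1`, so the solution of index `⌈t⌉₊` extends strictly
  -- beyond `t`; this room gives the derivative of the glued function at `t`.
  let u : ℝ → ℝ := fun t => α ⌈t⌉₊ t
  have hu0 : u 0 = y := hα0 _
  have hder : ∀ t, 0 ≤ t → HasDerivWithinAt u (-(M.drift (u t))) (Ici 0) t := by
    intro t ht
    have hlt : t < (⌈t⌉₊ : ℝ) + 1 := (Nat.le_ceil t).trans_lt (lt_add_one _)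
    have h1 := hα ⌈t⌉₊ t ⟨ht, hlt.le⟩
    have hmem : Icc (0 : ℝ) ((⌈t⌉₊ : ℝ) + 1) ∈ 𝓝[Ici 0] t := by
      rw [← Ici_inter_Iic]
      exact inter_mem self_mem_nhdsWithin (mem_nhdsWithin_of_mem_nhds (Iic_mem_nhds hlt))
    refine (h1.mono_of_mem_nhdsWithin hmem).congr_of_eventuallyEq ?_ rfl
    filter_upwards [hmem] with s hs
    exact agree _ _ s hs.1 ((Nat.le_ceil s).trans (lt_add_one _).le) hs.2
  have hnonneg : ∀ t, 0 ≤ t → 0 ≤ u t := by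
    intro t ht
    by_contra! hneg
    obtain ⟨K, hK⟩ := M.exists_lipschitzWith_drift
    -- The extended drift vanishes on the negative axis, so the constant `u t < 0` is also a
    -- solution. Uniqueness backwards in time then forces `u 0 = u t`, against `0 ≤ y`.
    have h := ODE_solution_unique_of_mem_Icc_left (v := fun _ z => -(M.drift z)) (K := K)
      (s := fun _ => univ) (f := u) (g := fun _ => u t) (a := 0) (b := t)
      (fun _ _ => hK.neg.lipschitzOnWith)
      (fun s hs => ((hder s hs.1).mono Icc_subset_Ici_self).continuousWithinAt)
      (fun s hs => ((hder s hs.1.le).hasDerivAt (Ici_mem_nhds hs.1)).hasDerivWithinAt)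
      (fun _ _ => trivial) continuousOn_const
      (fun s _ => by
        simp only [M.drift_of_nonpos hneg.le, neg_zero]
        exact hasDerivWithinAt_const _ _ _)
      (fun _ _ => trivial) rfl
    have h0 : u 0 = u t := h ⟨le_rfl, ht⟩
    rw [hu0] at h0
    exact absurd y.2 (by rw [← NNReal.val_eq_coe] at h0; rw [h0]; exact not_le.2 hneg)
  refine ⟨u, hu0, fun t ht => ⟨hnonneg t ht, ?_⟩⟩
  rw [← M.drift_eq (hnonneg t ht)]
  exact hder t ht

variable {M} in
theorem IsSolution.hasDerivWithinAt_drift {y : ℝ≥0} {u : ℝ → ℝ} (hu : M.IsSolution y u) {t : ℝ}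
    (ht : 0 ≤ t) : HasDerivWithinAt u (-(M.drift (u t))) (Ici 0) t := by
  rw [M.drift_eq (hu.2 t ht).1]
  exact (hu.2 t ht).2

/-- The solution of the equation of motion that defines the flow. -/
noncomputable def sol (y : ℝ≥0) : ℝ → ℝ := Classical.epsilon (M.IsSolution y)

theorem isSolution_sol (y : ℝ≥0) : M.IsSolution y (M.sol y) :=
  Classical.epsilon_spec (M.exists_isSolution y)

theorem coe_flow (y t : ℝ≥0) : (M.flow y t : ℝ) = M.sol y t :=
  Real.coe_toNNReal _ ((M.isSolution_sol y).2 t t.2).1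

theorem dist_sol_le {K : ℝ≥0} (hK : LipschitzWith K M.drift) {y z : ℝ≥0} {u v : ℝ → ℝ}
    (hu : M.IsSolution y u) (hv : M.IsSolution z v) {t : ℝ} (ht : 0 ≤ t) :
    dist (u t) (v t) ≤ dist y z * Real.exp (K * t) := by
  have h := dist_le_of_trajectories_ODE (v := fun _ z => -(M.drift z)) (K := K) (f := u) (g := v)
    (a := 0) (b := t) (δ := dist y z) (fun _ => hK.neg)
    (fun s hs => ((hu.hasDerivWithinAt_drift hs.1).mono Icc_subset_Ici_self).continuousWithinAt)
    (fun s hs => (hu.hasDerivWithinAt_drift hs.1).mono (Ici_subset_Ici.2 hs.1))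
    (fun s hs => ((hv.hasDerivWithinAt_drift hs.1).mono Icc_subset_Ici_self).continuousWithinAt)
    (fun s hs => (hv.hasDerivWithinAt_drift hs.1).mono (Ici_subset_Ici.2 hs.1))
    (by rw [hu.1, hv.1]; exact le_rfl) t ⟨ht, le_rfl⟩
  simpa using h

variable {M} in
theorem IsSolution.eq_flow {y : ℝ≥0} {u : ℝ → ℝ} (hu : M.IsSolution y u) (t : ℝ≥0) :
    u t = M.flow y t := by
  obtain ⟨K, hK⟩ := M.exists_lipschitzWith_drift
  have h := M.dist_sol_le hK hu (M.isSolution_sol y) t.2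
  rw [dist_self, zero_mul] at h
  rw [coe_flow]
  exact dist_le_zero.1 h

theorem flow_zero (y : ℝ≥0) : M.flow y 0 = y := by
  apply NNReal.coe_injective
  rw [coe_flow, NNReal.coe_zero, (M.isSolution_sol y).1]

theorem flow_flow (y s t : ℝ≥0) : M.flow (M.flow y s) t = M.flow y (s + t) := by
  have h : M.IsSolution (M.flow y s) (fun r => M.sol y (s + r)) := by
    refine ⟨by simp [coe_flow], fun r hr => ?_⟩
    have hsr : (0 : ℝ) ≤ s + r := add_nonneg s.2 hr
    refine ⟨((M.isSolution_sol y).2 _ hsr).1, ?_⟩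
    have h1 := ((M.isSolution_sol y).2 _ hsr).2
    have h2 : HasDerivWithinAt (fun r : ℝ => (s : ℝ) + r) 1 (Ici 0) r :=
      (hasDerivWithinAt_id r _).const_add _
    have h3 := h1.scomp (h := fun r : ℝ => (s : ℝ) + r) r h2
      (fun q hq => add_nonneg s.2 (mem_Ici.1 hq))
    simpa [Function.comp_def] using h3
  apply NNReal.coe_injective
  rw [← h.eq_flow t, coe_flow, NNReal.coe_add]

theorem continuousOn_sol (y : ℝ≥0) : ContinuousOn (M.sol y) (Ici 0) :=
  fun t ht => ((M.isSolution_sol y).2 t ht).2.continuousWithinAt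

theorem antitoneOn_sol (y : ℝ≥0) : AntitoneOn (M.sol y) (Ici 0) := by
  refine antitoneOn_of_hasDerivWithinAt_nonpos (convex_Ici 0) (M.continuousOn_sol y)
    (f' := fun t => -(M.a (M.sol y t))) ?_ ?_
  · intro t ht
    exact ((M.isSolution_sol y).2 t (interior_subset ht)).2.mono interior_subset
  · intro t ht
    exact neg_nonpos.2 (M.a_mem _ ((M.isSolution_sol y).2 t (interior_subset ht)).1).1

theorem monotoneOn_sol_add (y : ℝ≥0) : MonotoneOn (fun t => M.sol y t + t) (Ici 0) := by
  refine monotoneOn_of_hasDerivWithinAt_nonneg (convex_Ici 0)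
    ((M.continuousOn_sol y).add continuousOn_id) (f' := fun t => -(M.a (M.sol y t)) + 1) ?_ ?_
  · intro t ht
    exact (((M.isSolution_sol y).2 t (interior_subset ht)).2.mono interior_subset).add
      (hasDerivWithinAt_id _ _)
  · intro t ht
    have := (M.a_mem _ ((M.isSolution_sol y).2 t (interior_subset ht)).1).2
    linarith

theorem flow_antitone (y : ℝ≥0) : Antitone (M.flow y) := by
  intro s t hst
  have := M.antitoneOn_sol y (mem_Ici.2 s.2) (mem_Ici.2 t.2) hst
  rw [← NNReal.coe_le_coe, coe_flow, coe_flow]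
  exact this

theorem flow_le (y t : ℝ≥0) : M.flow y t ≤ y := by
  conv_rhs => rw [← M.flow_zero y]
  exact M.flow_antitone y t.2

theorem sub_le_flow (y t : ℝ≥0) : (y : ℝ) - t ≤ M.flow y t := by
  have h := M.monotoneOn_sol_add y (mem_Ici.2 le_rfl) (mem_Ici.2 t.2) t.2
  simp only [(M.isSolution_sol y).1] at h
  rw [coe_flow]
  change (y : ℝ) + 0 ≤ M.sol y t + t at h
  linarith

theorem flow_le_sub_mul {y t : ℝ≥0} {m : ℝ}
    (h : ∀ z : ℝ, (M.flow y t : ℝ) ≤ z → z ≤ y → m ≤ M.a z) :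
    (M.flow y t : ℝ) ≤ y - m * t := by
  have hanti : AntitoneOn (fun s => M.sol y s + m * s) (Icc 0 (t : ℝ)) := by
    refine antitoneOn_of_hasDerivWithinAt_nonpos (convex_Icc _ _)
      (((M.continuousOn_sol y).mono Icc_subset_Ici_self).add (continuousOn_const.mul continuousOn_id))
      (f' := fun t => -(M.a (M.sol y t)) + m * 1) ?_ ?_
    · intro s hs
      have hs' : s ∈ Icc 0 (t : ℝ) := interior_subset hs
      exact (((M.isSolution_sol y).2 s hs'.1).2.mono
        (interior_subset.trans Icc_subset_Ici_self)).add ((hasDerivWithinAt_id _ _).const_mul m)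
    · intro s hs
      have hs' : s ∈ Icc 0 (t : ℝ) := interior_subset hs
      have h1 : (M.flow y t : ℝ) ≤ M.sol y s := by
        rw [coe_flow]
        exact M.antitoneOn_sol y (mem_Ici.2 hs'.1) (mem_Ici.2 t.2) hs'.2
      have h2 : M.sol y s ≤ y := by
        rw [← (M.isSolution_sol y).1]
        exact M.antitoneOn_sol y (mem_Ici.2 le_rfl) (mem_Ici.2 hs'.1) hs'.1
      have := h _ h1 h2
      simp only [mul_one]
      linarith
  have h1 := hanti ⟨le_rfl, t.2⟩ ⟨t.2, le_rfl⟩ t.2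
  simp only [(M.isSolution_sol y).1, NNReal.val_eq_coe] at h1
  rw [coe_flow]
  linarith

theorem flow_eq_sub_of_one_le_flow {y t : ℝ≥0} (h : 1 ≤ M.flow y t) :
    (M.flow y t : ℝ) = y - t := by
  refine le_antisymm ?_ (M.sub_le_flow y t)
  have := M.flow_le_sub_mul (y := y) (t := t) (m := 1) fun z hz _ =>
    (M.a_eq_one z ((NNReal.coe_le_coe.2 h).trans hz)).ge
  simpa using this

theorem flow_eq_sub {y t : ℝ≥0} (h : 1 + t ≤ y) : M.flow y t = y - t := by
  have h0 : (1 : ℝ) + t ≤ y := by exact_mod_cast h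
  have h1 : 1 ≤ M.flow y t := by
    rw [← NNReal.coe_le_coe]
    have := M.sub_le_flow y t
    push_cast
    linarith
  apply NNReal.coe_injective
  rw [M.flow_eq_sub_of_one_le_flow h1, NNReal.coe_sub (le_trans (by simp) h)]

theorem flow_le_max (y t : ℝ≥0) : (M.flow y t : ℝ) ≤ max ((y : ℝ) - t) 1 := by
  rcases le_total 1 (M.flow y t) with h | h
  · rw [M.flow_eq_sub_of_one_le_flow h]
    exact le_max_left ((y : ℝ) - t) 1
  · have h' : (M.flow y t : ℝ) ≤ 1 := by exact_mod_cast h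
    exact h'.trans (le_max_right _ _)

/-- By compactness `a` has a positive minimum on the segment from `1/2` to `N`, so a trajectory from
below `N` leaves it within the time `N / min a`. Below `1/2` every ring is a jump, which is what
merges coupled copies. -/
theorem exists_flow_le_half (N : ℝ≥0) :
    ∃ T : ℝ≥0, ∀ y ≤ N, ∀ t, T ≤ t → (M.flow y t : ℝ) ≤ 1 / 2 := by
  have hc : ContinuousOn M.a (Icc (1 / 2) (max (1 / 2) (N : ℝ))) :=
    M.contDiffOn_a.continuousOn.mono fun z hz => le_trans (by norm_num : (0:ℝ) ≤ 1 / 2) hz.1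
  obtain ⟨z₀, hz₀, hmin⟩ := isCompact_Icc.exists_isMinOn
    (nonempty_Icc.2 (le_max_left (1 / 2) (N : ℝ))) hc
  have hm : 0 < M.a z₀ := M.a_pos _ (lt_of_lt_of_le (by norm_num) hz₀.1)
  refine ⟨(N / M.a z₀).toNNReal, fun y hy t ht => ?_⟩
  by_contra! hlt
  have h := M.flow_le_sub_mul (y := y) (t := t) (m := M.a z₀) fun z hz hzy =>
    hmin ⟨hlt.le.trans hz, hzy.trans ((NNReal.coe_le_coe.2 hy).trans (le_max_right _ _))⟩
  have h1 : (N : ℝ) / M.a z₀ ≤ t := by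
    have := Real.le_coe_toNNReal (N / M.a z₀)
    exact this.trans (by exact_mod_cast ht)
  rw [div_le_iff₀ hm] at h1
  have h2 : (y : ℝ) ≤ N := by exact_mod_cast hy
  nlinarith

theorem continuous_flow_right (y : ℝ≥0) : Continuous (M.flow y) := by
  have : Continuous fun t : ℝ≥0 => M.sol y t :=
    (M.continuousOn_sol y).comp_continuous NNReal.continuous_coe fun t => t.2
  exact continuous_real_toNNReal.comp this

theorem continuous_flow_left (t : ℝ≥0) : Continuous fun y => M.flow y t := by
  obtain ⟨K, hK⟩ := M.exists_lipschitzWith_drift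
  refine (LipschitzWith.of_dist_le_mul (K := (Real.exp (K * t)).toNNReal) fun y z => ?_).continuous
  rw [NNReal.dist_eq, coe_flow, coe_flow, ← Real.dist_eq, Real.coe_toNNReal _ (Real.exp_pos _).le,
    mul_comm]
  exact M.dist_sol_le hK (M.isSolution_sol y) (M.isSolution_sol z) t.2

theorem measurable_flow_uncurry : Measurable (Function.uncurry M.flow) := by
  have h : Measurable (Function.uncurry fun t y => M.flow y t) :=
    measurable_uncurry_of_continuous_of_measurable (u := fun t y => M.flow y t)
      (fun y => M.continuous_flow_right y) (fun t => (M.continuous_flow_left t).measurable)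
  exact h.comp measurable_swap

@[fun_prop]
theorem measurable_flow {Ω : Type*} [MeasurableSpace Ω] {f g : Ω → ℝ≥0} (hf : Measurable f)
    (hg : Measurable g) : Measurable fun ω => M.flow (f ω) (g ω) :=
  M.measurable_flow_uncurry.comp (hf.prodMk hg)

/-- The jump intensity as a function on `[0, ∞)`. -/
noncomputable def rate (y : ℝ≥0) : ℝ := M.θ y

theorem continuous_rate : Continuous M.rate :=
  M.contDiffOn_θ.continuousOn.comp_continuous NNReal.continuous_coe fun y => y.2

@[fun_prop]
theorem measurable_rate : Measurable M.rate := M.continuous_rate.measurable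

theorem rate_nonneg (y : ℝ≥0) : 0 ≤ M.rate y := (M.θ_mem y y.2).1

theorem rate_le_one (y : ℝ≥0) : M.rate y ≤ 1 := (M.θ_mem y y.2).2

theorem rate_eq_zero {y : ℝ≥0} (hy : 1 ≤ y) : M.rate y = 0 := M.θ_eq_zero y (by exact_mod_cast hy)

theorem rate_eq_one {y : ℝ≥0} (hy : (y : ℝ) ≤ 1 / 2) : M.rate y = 1 := M.θ_eq_one y y.2 hy

end Model
/-! ### Independent sequences: splitting off the first term -/

/-- The sequence with first term `x` followed by the terms of `ω`. -/
def consSeq {X : Type*} (x : X) (ω : ℕ → X) : ℕ → X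
  | 0 => x
  | n + 1 => ω n

theorem measurable_consSeq {X : Type*} [MeasurableSpace X] :
    Measurable fun z : X × (ℕ → X) => consSeq z.1 z.2 := by
  refine measurable_pi_lambda _ fun n => ?_
  cases n with
  | zero => exact measurable_fst
  | succ n => exact (measurable_pi_apply n).comp measurable_snd

/-- The product measure is determined by finite boxes. A box over `s` pulls back to a condition on
the first term (void if `0 ∉ s`) times a box over the shifted index set `s'`. -/
theorem map_consSeq_infinitePi {X : Type*} [MeasurableSpace X] (μ : Measure X)
    [IsProbabilityMeasure μ] :
    (μ.prod (Measure.infinitePi fun _ : ℕ => μ)).map (fun z => consSeq z.1 z.2) =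
      Measure.infinitePi fun _ : ℕ => μ := by
  refine Measure.eq_infinitePi _ fun s t ht => ?_
  rw [Measure.map_apply measurable_consSeq (MeasurableSet.pi s.countable_toSet fun i _ => ht i)]
  classical
  let s' : Finset ℕ := (s.erase 0).image Nat.pred
  have hs' : ∀ n, n ∈ s' ↔ n + 1 ∈ s := by
    intro n
    simp only [s', Finset.mem_image, Finset.mem_erase]
    constructor
    · rintro ⟨m, ⟨hm0, hm⟩, rfl⟩
      obtain ⟨k, rfl⟩ := Nat.exists_eq_succ_of_ne_zero hm0
      exact hm
    · exact fun h => ⟨n + 1, ⟨by simp, h⟩, rfl⟩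
  let A : Set X := if 0 ∈ s then t 0 else univ
  have hpre : (fun z : X × (ℕ → X) => consSeq z.1 z.2) ⁻¹' (s : Set ℕ).pi t =
      A ×ˢ (s' : Set ℕ).pi fun n => t (n + 1) := by
    ext ⟨x, ω⟩
    simp only [mem_preimage, Set.mem_pi, Finset.mem_coe, mem_prod]
    constructor
    · intro h
      refine ⟨?_, fun n hn => h (n + 1) ((hs' n).1 hn)⟩
      by_cases h0 : 0 ∈ s
      · simpa [A, h0, consSeq] using h 0 h0
      · simp [A, h0]
    · rintro ⟨h0, h⟩ n hn
      cases n with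
      | zero => simpa [A, hn, consSeq] using h0
      | succ n => exact h n ((hs' n).2 hn)
  rw [hpre, Measure.prod_prod, Measure.infinitePi_pi _ fun i _ => ht (i + 1)]
  have hprod : ∏ i ∈ s', μ (t (i + 1)) = ∏ i ∈ s.erase 0, μ (t i) := by
    refine Finset.prod_bij (fun i _ => i + 1) (fun i hi => ?_) (fun i _ j _ h => by simpa using h)
      (fun j hj => ?_) (fun i _ => rfl)
    · exact Finset.mem_erase.2 ⟨by simp, (hs' i).1 hi⟩
    · obtain ⟨hj0, hj⟩ := Finset.mem_erase.1 hj
      obtain ⟨k, rfl⟩ := Nat.exists_eq_succ_of_ne_zero hj0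
      exact ⟨k, (hs' k).2 hj, rfl⟩
  rw [hprod]
  by_cases h0 : 0 ∈ s
  · simp only [A, h0, if_true]
    exact Finset.mul_prod_erase s (fun i => μ (t i)) h0
  · simp only [A, h0, if_false, measure_univ, one_mul]
    rw [Finset.erase_eq_of_notMem h0]

/-! ### The exponential law -/

theorem lintegral_expMeasure_one {F : ℝ → ℝ≥0∞} (hF : Measurable F) :
    ∫⁻ e, F e ∂(expMeasure 1) = ∫⁻ u in Ioi 0, ENNReal.ofReal (Real.exp (-u)) * F u := by
  have h : expMeasure 1 = volume.withDensity (exponentialPDF 1) := rfl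
  have hm : Measurable (exponentialPDF 1) := (measurable_exponentialPDFReal 1).ennreal_ofReal
  rw [h, lintegral_withDensity_eq_lintegral_mul _ hm hF, ← lintegral_indicator measurableSet_Ioi]
  refine lintegral_congr_ae ?_
  filter_upwards [Measure.ae_ne volume (0 : ℝ)] with u hu
  rw [Pi.mul_apply, exponentialPDF_eq]
  by_cases h0 : 0 ≤ u
  · rw [if_pos h0, indicator_of_mem (mem_Ioi.2 (lt_of_le_of_ne h0 (Ne.symm hu)))]
    simp
  · rw [if_neg h0, indicator_of_notMem (by simpa using (not_le.1 h0).le)]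
    simp

theorem setLIntegral_exp_neg_mul {c : ℝ} (hc : 0 < c) (T : ℝ) :
    ∫⁻ u in Ioi T, ENNReal.ofReal (Real.exp (-(c * u))) =
      ENNReal.ofReal (Real.exp (-(c * T)) / c) := by
  rw [← ofReal_integral_eq_lintegral_ofReal]
  · congr 1
    have := integral_exp_mul_Ioi (a := -c) (by linarith) T
    simp only [neg_mul] at this
    rw [this, neg_div_neg_eq]
  · have := (integrableOn_exp_mul_Ioi (a := -c) (by linarith) T)
    simp only [neg_mul] at this
    exact this
  · exact ae_of_all _ fun u => (Real.exp_pos _).le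

theorem lintegral_exp_mul_expMeasure {β : ℝ} (hβ : β < 1) :
    ∫⁻ e, ENNReal.ofReal (Real.exp (β * e)) ∂(expMeasure 1) = ENNReal.ofReal (1 / (1 - β)) := by
  rw [lintegral_expMeasure_one (by fun_prop)]
  have := setLIntegral_exp_neg_mul (c := 1 - β) (by linarith) 0
  simp only [mul_zero, neg_zero, Real.exp_zero] at this
  rw [← this]
  refine lintegral_congr fun u => ?_
  rw [← ENNReal.ofReal_mul (Real.exp_pos _).le, ← Real.exp_add]
  congr 2
  ring

theorem ae_expMeasure_pos : ∀ᵐ e ∂(expMeasure 1), 0 < e := by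
  rw [ae_iff]
  have h : expMeasure 1 {e : ℝ | ¬ 0 < e} = ∫⁻ e, {e : ℝ | ¬ 0 < e}.indicator 1 e ∂(expMeasure 1) := by
    rw [lintegral_indicator_one]
    simp only [not_lt]
    exact measurableSet_Iic
  rw [h, lintegral_expMeasure_one (measurable_one.indicator (by
    simp only [not_lt]; exact measurableSet_Iic))]
  rw [setLIntegral_congr_fun (g := fun _ => 0) measurableSet_Ioi, lintegral_zero]
  intro u hu
  simp [mem_Ioi.1 hu]

instance : IsProbabilityMeasure (expMeasure 1) := isProbabilityMeasure_expMeasure one_pos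

namespace Model

variable (M : Model)

/-! ### The law of the seeds -/

/-- The weight of the index `k`. -/
noncomputable def weight (k : ℕ) : ℝ≥0∞ := ENNReal.ofReal ((1 - M.p) * M.p ^ k)

theorem lintegral_indexLaw (F : ℕ → ℝ≥0∞) : ∫⁻ k, F k ∂M.indexLaw = ∑' k, M.weight k * F k := by
  rw [indexLaw, lintegral_sum_measure]
  refine tsum_congr fun k => ?_
  rw [lintegral_smul_measure, lintegral_dirac]
  rfl

theorem tsum_weight : ∑' k, M.weight k = 1 := by
  unfold weight
  rw [← ENNReal.ofReal_tsum_of_nonneg]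
  · rw [tsum_mul_left, tsum_geometric_of_lt_one M.p_pos.le M.p_lt_one,
      mul_inv_cancel₀ (by linarith [M.p_lt_one]), ENNReal.ofReal_one]
  · exact fun k => mul_nonneg (by linarith [M.p_lt_one]) (pow_nonneg M.p_pos.le k)
  · exact (summable_geometric_of_lt_one M.p_pos.le M.p_lt_one).mul_left _

theorem weight_pos (k : ℕ) : 0 < M.weight k :=
  ENNReal.ofReal_pos.2 (mul_pos (by linarith [M.p_lt_one]) (pow_pos M.p_pos k))

instance : IsProbabilityMeasure M.indexLaw := by
  constructor
  rw [← lintegral_one, lintegral_indexLaw]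
  simpa using M.tsum_weight

instance : IsProbabilityMeasure M.stepLaw := by
  unfold stepLaw
  infer_instance

instance : IsProbabilityMeasure M.seedLaw := by
  unfold seedLaw
  infer_instance

theorem map_consSeq_seedLaw :
    (M.stepLaw.prod M.seedLaw).map (fun z => consSeq z.1 z.2) = M.seedLaw :=
  map_consSeq_infinitePi _

theorem lintegral_seedLaw {F : (ℕ → ℝ × I × ℕ) → ℝ≥0∞} (hF : Measurable F) :
    ∫⁻ ω, F ω ∂M.seedLaw = ∫⁻ s, ∫⁻ ω, F (consSeq s ω) ∂M.seedLaw ∂M.stepLaw := by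
  conv_lhs => rw [← M.map_consSeq_seedLaw]
  rw [lintegral_map hF measurable_consSeq,
    lintegral_prod (fun z => F (consSeq z.1 z.2)) (hF.comp measurable_consSeq).aemeasurable]

theorem lintegral_stepLaw {F : ℝ × I × ℕ → ℝ≥0∞} (hF : Measurable F) :
    ∫⁻ s, F s ∂M.stepLaw =
      ∫⁻ u in Ioi 0, ENNReal.ofReal (Real.exp (-u)) *
        ∫⁻ v : I, ∑' k, M.weight k * F (u, v, k) := by
  have h1 : ∫⁻ s, F s ∂M.stepLaw =
      ∫⁻ u, (∫⁻ v : I, ∑' k, M.weight k * F (u, v, k)) ∂(expMeasure 1) := by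
    rw [stepLaw, lintegral_prod _ hF.aemeasurable]
    refine lintegral_congr fun u => ?_
    rw [lintegral_prod (fun q => F (u, q)) (hF.comp measurable_prodMk_left).aemeasurable]
    exact lintegral_congr fun v => M.lintegral_indexLaw _
  rw [h1]
  refine lintegral_expMeasure_one ?_
  refine Measurable.lintegral_prod_right' (f := fun z : ℝ × I => ∑' k, M.weight k * F (z.1, z.2, k)) ?_
  exact Measurable.tsum fun k => by fun_prop

theorem lintegral_stepLaw_fst {F : ℝ → ℝ≥0∞} (hF : Measurable F) :
    ∫⁻ s, F s.1 ∂M.stepLaw = ∫⁻ e, F e ∂(expMeasure 1) := by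
  rw [stepLaw, lintegral_prod (fun z => F z.1) (hF.comp measurable_fst).aemeasurable]
  simp

theorem ae_stepLaw_pos : ∀ᵐ s ∂M.stepLaw, 0 < s.1 :=
  Measure.quasiMeasurePreserving_fst.ae ae_expMeasure_pos

theorem measurable_seed_fst (n : ℕ) : Measurable fun ω : ℕ → ℝ × I × ℕ => (ω n).1 :=
  measurable_fst.comp (measurable_pi_apply n)

/-! ### Ring times -/

theorem ringTime_consSeq (s : ℝ × I × ℕ) (ω : ℕ → ℝ × I × ℕ) (n : ℕ) :
    ringTime (consSeq s ω) (n + 1) = s.1.toNNReal + ringTime ω n := by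
  rw [ringTime, Finset.sum_range_succ', add_comm]
  rfl

theorem ringTime_zero (ω : ℕ → ℝ × I × ℕ) : ringTime ω 0 = 0 := by simp [ringTime]

theorem ringTime_succ (ω : ℕ → ℝ × I × ℕ) (n : ℕ) :
    ringTime ω (n + 1) = ringTime ω n + (ω n).1.toNNReal := Finset.sum_range_succ _ _

theorem ringTime_monotone (ω : ℕ → ℝ × I × ℕ) : Monotone (ringTime ω) :=
  monotone_nat_of_le_succ fun n => by rw [ringTime_succ]; exact le_self_add

@[fun_prop]
theorem measurable_ringTime (n : ℕ) : Measurable fun ω => ringTime ω n :=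
  Finset.measurable_sum _ fun i _ => (measurable_seed_fst i).real_toNNReal

/-- Each holding time contributes the Laplace transform `1/(1+1)` of the exponential law. -/
theorem lintegral_exp_neg_ringTime (n : ℕ) :
    ∫⁻ ω, ENNReal.ofReal (Real.exp (-(ringTime ω n : ℝ))) ∂M.seedLaw = (1 / 2) ^ n := by
  induction n with
  | zero => simp [ringTime_zero]
  | succ n ih =>
    rw [M.lintegral_seedLaw (by fun_prop)]
    have h : ∀ᵐ s ∂M.stepLaw, ∫⁻ ω, ENNReal.ofReal (Real.exp (-(ringTime (consSeq s ω) (n + 1) : ℝ)))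
        ∂M.seedLaw = ENNReal.ofReal (Real.exp ((-1) * s.1)) * (1 / 2) ^ n := by
      filter_upwards [M.ae_stepLaw_pos] with s hs
      rw [← ih, ← lintegral_const_mul _ (by fun_prop)]
      refine lintegral_congr fun ω => ?_
      rw [ringTime_consSeq, ← ENNReal.ofReal_mul (Real.exp_pos _).le, ← Real.exp_add]
      congr 2
      push_cast
      rw [Real.coe_toNNReal _ hs.le]
      ring
    rw [lintegral_congr_ae h, lintegral_mul_const _ (by fun_prop),
      M.lintegral_stepLaw_fst (F := fun e => ENNReal.ofReal (Real.exp ((-1) * e))) (by fun_prop),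
      lintegral_exp_mul_expMeasure (by norm_num), pow_succ, mul_comm]
    congr 1
    norm_num
    rw [ENNReal.ofReal_div_of_pos (by norm_num)]
    simp

/-- The expectations of `e^{-ringTime}` form a convergent geometric series, so almost surely these
exponentials are summable and tend to zero. -/
theorem ae_tendsto_ringTime :
    ∀ᵐ ω ∂M.seedLaw, Tendsto (fun n => (ringTime ω n : ℝ)) atTop atTop := by
  have h : ∫⁻ ω, ∑' n, ENNReal.ofReal (Real.exp (-(ringTime ω n : ℝ))) ∂M.seedLaw ≠ ∞ := by
    rw [lintegral_tsum fun n => by fun_prop]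
    simp only [lintegral_exp_neg_ringTime]
    rw [ENNReal.tsum_geometric]
    simp
  filter_upwards [ae_lt_top (Measurable.tsum fun n => by fun_prop) h] with ω hω
  have h1 := ENNReal.tendsto_atTop_zero_of_tsum_ne_top hω.ne
  have h2 : Tendsto (fun n => Real.exp (-(ringTime ω n : ℝ))) atTop (𝓝 0) := by
    have := (ENNReal.tendsto_toReal ENNReal.zero_ne_top).comp h1
    simpa [Function.comp_def, ENNReal.toReal_ofReal (Real.exp_pos _).le] using this
  have h3 := Real.tendsto_exp_comp_nhds_zero.1 h2
  exact tendsto_neg_atBot_iff.1 h3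

/-- The rings do not accumulate. -/
def NonExplosive (ω : ℕ → ℝ × I × ℕ) : Prop := ∀ t : ℝ≥0, ∃ n, t < ringTime ω (n + 1)

theorem ae_nonExplosive : ∀ᵐ ω ∂M.seedLaw, NonExplosive ω := by
  filter_upwards [M.ae_tendsto_ringTime] with ω hω t
  obtain ⟨n, hn⟩ := (((tendsto_add_atTop_iff_nat 1).2 hω).eventually_gt_atTop (t : ℝ)).exists
  exact ⟨n, by exact_mod_cast hn⟩

theorem lt_ringTime_ringCount {ω : ℕ → ℝ × I × ℕ} (hω : NonExplosive ω) (t : ℝ≥0) :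
    t < ringTime ω (ringCount ω t + 1) := Nat.sInf_mem (hω t)

theorem ringTime_ringCount_le (ω : ℕ → ℝ × I × ℕ) (t : ℝ≥0) :
    ringTime ω (ringCount ω t) ≤ t := by
  rcases Nat.eq_zero_or_pos (ringCount ω t) with h | h
  · rw [h, ringTime_zero]
    exact t.2
  · obtain ⟨k, hk⟩ := Nat.exists_eq_succ_of_ne_zero h.ne'
    have : k ∉ {n | t < ringTime ω (n + 1)} := Nat.notMem_of_lt_sInf (by
      change k < ringCount ω t
      omega)
    rw [hk]
    exact not_lt.1 this

theorem ringCount_eq_iff {ω : ℕ → ℝ × I × ℕ} (hω : NonExplosive ω) {t : ℝ≥0} {n : ℕ} :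
    ringCount ω t = n ↔ ringTime ω n ≤ t ∧ t < ringTime ω (n + 1) := by
  constructor
  · rintro rfl
    exact ⟨ringTime_ringCount_le ω t, lt_ringTime_ringCount hω t⟩
  · rintro ⟨h1, h2⟩
    refine le_antisymm (Nat.sInf_le h2) ?_
    by_contra! hlt
    have := ringTime_monotone ω (Nat.succ_le_of_lt hlt)
    exact absurd ((lt_ringTime_ringCount hω t).trans_le this) (not_lt.2 h1)

theorem measurable_ringCount :
    Measurable fun z : (ℕ → ℝ × I × ℕ) × ℝ≥0 => ringCount z.1 z.2 := by
  classical
  have hset : ∀ n, MeasurableSet {z : (ℕ → ℝ × I × ℕ) × ℝ≥0 | z.2 < ringTime z.1 (n + 1)} :=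
    fun n => measurableSet_lt measurable_snd ((measurable_ringTime _).comp measurable_fst)
  refine measurable_to_countable' fun n => ?_
  -- The second piece of the union treats seeds whose rings never pass `t`: there the infimum of the
  -- empty set is `0`.
  have : (fun z : (ℕ → ℝ × I × ℕ) × ℝ≥0 => ringCount z.1 z.2) ⁻¹' {n} =
      ({z | z.2 < ringTime z.1 (n + 1)} ∩ ⋂ m ∈ Finset.range n, {z | z.2 < ringTime z.1 (m + 1)}ᶜ) ∪
      ({z | n = 0} ∩ ⋂ m : ℕ, {z | z.2 < ringTime z.1 (m + 1)}ᶜ) := by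
    ext ⟨ω, t⟩
    simp only [mem_preimage, mem_singleton_iff, mem_union, mem_inter_iff, mem_iInter,
      Finset.mem_range, mem_compl_iff, mem_ofPred_eq]
    by_cases hex : ∃ m, t < ringTime ω (m + 1)
    · have h2 : ¬ ∀ m, ¬ t < ringTime ω (m + 1) := fun h => hex.elim h
      simp only [h2, and_false, or_false]
      rw [ringCount, Nat.sInf_def (s := {n | t < ringTime ω (n + 1)}) hex, Nat.find_eq_iff]
      simp
    · have h2 : ∀ m, ¬ t < ringTime ω (m + 1) := by simpa using hex
      have h3 : {n | t < ringTime ω (n + 1)} = ∅ := by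
        ext m
        simpa using h2 m
      rw [ringCount, h3, Nat.sInf_empty]
      simp [h2, eq_comm]
  rw [this]
  refine MeasurableSet.union ((hset n).inter ?_) ((MeasurableSet.const _).inter ?_)
  · exact Finset.measurableSet_biInter _ fun m _ => (hset m).compl
  · exact MeasurableSet.iInter fun m => (hset m).compl

end Model
namespace Model

variable (M : Model)

/-! ### Trajectories and the decomposition at the first ring -/

/-- The state after one ring, as a function of the starting point and one step of randomness. -/
noncomputable def ringStep (y : ℝ≥0) (s : ℝ × I × ℕ) : ℝ≥0 :=
  if (s.2.1 : ℝ) < M.rate (M.flow y s.1.toNNReal) then M.x s.2.2 else M.flow y s.1.toNNReal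

theorem ringState_succ (y : ℝ≥0) (ω : ℕ → ℝ × I × ℕ) (n : ℕ) :
    M.ringState y ω (n + 1) = M.ringStep (M.ringState y ω n) (ω n) := rfl

theorem ringState_consSeq (y : ℝ≥0) (s : ℝ × I × ℕ) (ω : ℕ → ℝ × I × ℕ) (n : ℕ) :
    M.ringState y (consSeq s ω) (n + 1) = M.ringState (M.ringStep y s) ω n := by
  induction n with
  | zero => rfl
  | succ n ih => rw [ringState_succ, ih, ringState_succ]; rfl

@[fun_prop]
theorem measurable_ringStep {Ω : Type*} [MeasurableSpace Ω] {f : Ω → ℝ≥0} {g : Ω → ℝ × I × ℕ}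
    (hf : Measurable f) (hg : Measurable g) : Measurable fun ω => M.ringStep (f ω) (g ω) := by
  have hz : Measurable fun ω => M.flow (f ω) (g ω).1.toNNReal := by fun_prop
  have hx : Measurable M.x := measurable_of_countable _
  unfold ringStep
  refine Measurable.ite (measurableSet_lt ?_ (M.measurable_rate.comp hz)) ?_ hz
  · exact measurable_subtype_coe.comp (measurable_fst.comp (measurable_snd.comp hg))
  · exact hx.comp (measurable_snd.comp (measurable_snd.comp hg))

@[fun_prop]
theorem measurable_ringState {Ω : Type*} [MeasurableSpace Ω] {f : Ω → ℝ≥0}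
    {g : Ω → ℕ → ℝ × I × ℕ} (hf : Measurable f) (hg : Measurable g) (n : ℕ) :
    Measurable fun ω => M.ringState (f ω) (g ω) n := by
  induction n with
  | zero => exact hf
  | succ n ih =>
    simp only [ringState_succ]
    exact M.measurable_ringStep ih ((measurable_pi_apply n).comp hg)

@[fun_prop]
theorem measurable_path {Ω : Type*} [MeasurableSpace Ω] {f : Ω → ℝ≥0}
    {g : Ω → ℕ → ℝ × I × ℕ} {τ : Ω → ℝ≥0} (hf : Measurable f) (hg : Measurable g)
    (hτ : Measurable τ) : Measurable fun ω => M.path (f ω) (g ω) (τ ω) := by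
  have h1 : Measurable fun z : ℕ × Ω =>
      M.flow (M.ringState (f z.2) (g z.2) z.1) (τ z.2 - ringTime (g z.2) z.1) :=
    measurable_from_prod_countable_right fun n =>
      M.measurable_flow (M.measurable_ringState hf hg n)
        (hτ.sub ((measurable_ringTime n).comp hg))
  have h2 : Measurable fun ω => ringCount (g ω) (τ ω) :=
    measurable_ringCount.comp (hg.prodMk hτ)
  exact h1.comp (h2.prodMk measurable_id)

theorem NonExplosive.consSeq {ω : ℕ → ℝ × I × ℕ} (hω : NonExplosive ω) (s : ℝ × I × ℕ) :
    NonExplosive (consSeq s ω) := by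
  intro t
  obtain ⟨n, hn⟩ := hω t
  exact ⟨n + 1, by rw [ringTime_consSeq]; exact hn.trans_le le_add_self⟩

theorem path_eq {ω : ℕ → ℝ × I × ℕ} (hω : NonExplosive ω) (y : ℝ≥0) {t : ℝ≥0} {n : ℕ}
    (h1 : ringTime ω n ≤ t) (h2 : t < ringTime ω (n + 1)) :
    M.path y ω t = M.flow (M.ringState y ω n) (t - ringTime ω n) := by
  rw [path, (ringCount_eq_iff hω).2 ⟨h1, h2⟩]

/-- The regeneration at the first ring: from then on the path is driven by the remaining seed,
started at the state just after the ring. At the ring time itself the new state already counts, by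
right continuity. -/
theorem path_consSeq {ω : ℕ → ℝ × I × ℕ} (hω : NonExplosive ω) (s : ℝ × I × ℕ) (y t : ℝ≥0) :
    M.path y (consSeq s ω) t = if t < s.1.toNNReal then M.flow y t else
      M.path (M.ringStep y s) ω (t - s.1.toNNReal) := by
  split_ifs with h
  · rw [M.path_eq (hω.consSeq s) y (n := 0) (by simp [ringTime_zero])
      (by rw [ringTime_consSeq, ringTime_zero, add_zero]; exact h), ringTime_zero, tsub_zero]
    rfl
  · have h := not_lt.1 h
    set n := ringCount ω (t - s.1.toNNReal) with hn
    have h1 : ringTime ω n ≤ t - s.1.toNNReal := ringTime_ringCount_le _ _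
    have h2 : t - s.1.toNNReal < ringTime ω (n + 1) := lt_ringTime_ringCount hω _
    rw [M.path_eq (hω.consSeq s) y (n := n + 1), M.path_eq hω _ h1 h2, ringState_consSeq,
      ringTime_consSeq, tsub_add_eq_tsub_tsub]
    · rw [ringTime_consSeq, add_comm]
      exact (le_tsub_iff_right h).1 h1
    · rw [ringTime_consSeq, add_comm]
      exact (tsub_lt_iff_right h).1 h2

/-- The expectation of `F (X_t)` for a nonnegative function `F`. -/
noncomputable def transOp (F : ℝ≥0 → ℝ≥0∞) (t y : ℝ≥0) : ℝ≥0∞ := ∫⁻ z, F z ∂(M.transition t y)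

theorem transOp_eq {F : ℝ≥0 → ℝ≥0∞} (hF : Measurable F) (t y : ℝ≥0) :
    M.transOp F t y = ∫⁻ ω, F (M.path y ω t) ∂M.seedLaw :=
  lintegral_map hF (by fun_prop)

instance (t y : ℝ≥0) : IsProbabilityMeasure (M.transition t y) :=
  Measure.isProbabilityMeasure_map (by fun_prop)

@[fun_prop]
theorem measurable_transOp {Ω : Type*} [MeasurableSpace Ω] {F : ℝ≥0 → ℝ≥0∞} (hF : Measurable F)
    {f g : Ω → ℝ≥0} (hf : Measurable f) (hg : Measurable g) :
    Measurable fun ω => M.transOp F (f ω) (g ω) := by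
  simp only [M.transOp_eq hF]
  refine Measurable.lintegral_prod_right'
    (f := fun z : Ω × (ℕ → ℝ × I × ℕ) => F (M.path (g z.1) z.2 (f z.1))) ?_
  exact hF.comp (M.measurable_path (hg.comp measurable_fst) measurable_snd (hf.comp measurable_fst))

theorem transOp_indicator_one {B : Set ℝ≥0} (hB : MeasurableSet B) (t y : ℝ≥0) :
    M.transOp (B.indicator 1) t y = M.transition t y B := lintegral_indicator_one hB

/-- The transition function as a kernel. -/
noncomputable def transKernel (t : ℝ≥0) : Kernel ℝ≥0 ℝ≥0 where
  toFun := M.transition t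
  measurable' := by
    refine Measure.measurable_of_measurable_coe _ fun B hB => ?_
    simp only [← M.transOp_indicator_one hB]
    exact M.measurable_transOp (measurable_one.indicator hB) measurable_const measurable_id

theorem transOp_eq_lintegral_stepLaw {F : ℝ≥0 → ℝ≥0∞} (hF : Measurable F) (t y : ℝ≥0) :
    M.transOp F t y = ∫⁻ s, (if t < s.1.toNNReal then F (M.flow y t) else
      M.transOp F (t - s.1.toNNReal) (M.ringStep y s)) ∂M.stepLaw := by
  rw [M.transOp_eq hF, M.lintegral_seedLaw (by fun_prop)]
  refine lintegral_congr fun s => ?_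
  rw [lintegral_congr_ae (g := fun ω => if t < s.1.toNNReal then F (M.flow y t) else
      F (M.path (M.ringStep y s) ω (t - s.1.toNNReal)))]
  · split_ifs with h
    · simp
    · rw [M.transOp_eq hF]
  · filter_upwards [M.ae_nonExplosive] with ω hω
    rw [M.path_consSeq hω]
    split_ifs <;> rfl

/-- The average of `H` over the points `x_k`. -/
noncomputable def jumpMean (H : ℝ≥0 → ℝ≥0∞) : ℝ≥0∞ := ∑' k, M.weight k * H (M.x k)

/-- The expectation of `H` at the state just after a ring in the state `z`. -/
noncomputable def jump (H : ℝ≥0 → ℝ≥0∞) (z : ℝ≥0) : ℝ≥0∞ :=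
  ENNReal.ofReal (M.rate z) * M.jumpMean H + ENNReal.ofReal (1 - M.rate z) * H z

@[fun_prop]
theorem measurable_jump {H : ℝ≥0 → ℝ≥0∞} (hH : Measurable H) : Measurable (M.jump H) := by
  unfold jump
  fun_prop

theorem volume_unitInterval_lt {c : ℝ} (h0 : 0 ≤ c) (h1 : c ≤ 1) :
    volume {v : I | (v : ℝ) < c} = ENNReal.ofReal c := by
  exact unitInterval.volume_Iio ⟨c, h0, h1⟩

theorem lintegral_jump (H : ℝ≥0 → ℝ≥0∞) (z : ℝ≥0) :
    ∫⁻ v : I, ∑' k, M.weight k * H (if (v : ℝ) < M.rate z then M.x k else z) = M.jump H z := by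
  have h : ∀ v : I, ∑' k, M.weight k * H (if (v : ℝ) < M.rate z then M.x k else z) =
      {v : I | (v : ℝ) < M.rate z}.indicator (fun _ => M.jumpMean H) v +
      {v : I | (v : ℝ) < M.rate z}ᶜ.indicator (fun _ => H z) v := by
    intro v
    by_cases hv : (v : ℝ) < M.rate z
    · rw [indicator_of_mem (s := {v : I | (v : ℝ) < M.rate z}) hv,
        indicator_of_notMem (by simpa using hv), add_zero]
      simp [hv, jumpMean]
    · rw [indicator_of_notMem (s := {v : I | (v : ℝ) < M.rate z}) hv, indicator_of_mem (by simpa using hv), zero_add]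
      simp [hv, ENNReal.tsum_mul_right, M.tsum_weight]
  have hms : MeasurableSet {v : I | (v : ℝ) < M.rate z} :=
    measurableSet_lt measurable_subtype_coe measurable_const
  rw [lintegral_congr h, lintegral_add_left (measurable_const.indicator hms),
    lintegral_indicator_const hms, lintegral_indicator_const hms.compl,
    prob_compl_eq_one_sub hms, volume_unitInterval_lt (M.rate_nonneg z) (M.rate_le_one z), jump,
    ENNReal.ofReal_sub _ (M.rate_nonneg z), ENNReal.ofReal_one, mul_comm, mul_comm (H z)]

/-- The renewal equation: either no ring occurs up to `t`, with probability `e^{-t}`, or the first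
one occurs at `u` with density `e^{-u}`. It is the only information about the transition function
used in the proof of invariance and in the analysis of high starting points. -/
theorem transOp_first_ring {F : ℝ≥0 → ℝ≥0∞} (hF : Measurable F) (t y : ℝ≥0) :
    M.transOp F t y = ENNReal.ofReal (Real.exp (-t)) * F (M.flow y t) +
      ∫⁻ u in Ioc 0 (t : ℝ), ENNReal.ofReal (Real.exp (-u)) *
        M.jump (M.transOp F (t - u.toNNReal)) (M.flow y u.toNNReal) := by
  rw [M.transOp_eq_lintegral_stepLaw hF, M.lintegral_stepLaw, ← Ioc_union_Ioi_eq_Ioi t.2,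
    lintegral_union measurableSet_Ioi Ioc_disjoint_Ioi_same, add_comm]
  · congr 1
    · have h1 := setLIntegral_exp_neg_mul one_pos (t : ℝ)
      simp only [one_mul, div_one] at h1
      rw [← h1, ← lintegral_mul_const _ (by fun_prop)]
      refine setLIntegral_congr_fun measurableSet_Ioi fun u hu => ?_
      have : t < u.toNNReal := by rwa [Real.lt_toNNReal_iff_coe_lt]
      simp [this, ENNReal.tsum_mul_right, M.tsum_weight]
    · refine setLIntegral_congr_fun measurableSet_Ioc fun u hu => ?_
      have : ¬ t < u.toNNReal := by
        rw [Real.lt_toNNReal_iff_coe_lt, not_lt]; exact hu.2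
      simp only [this, if_false]
      congr 1
      exact M.lintegral_jump (M.transOp F (t - u.toNNReal)) (M.flow y u.toNNReal)
  · refine Measurable.ite (measurableSet_lt measurable_const (by fun_prop)) measurable_const ?_
    fun_prop

end Model
-- The arithmetic of the contraction. Here `V` is the sum of the two exponential weights, `κV + 2K`
-- its bound after a ring, and `ε` the probability of merging. With `b = ε/(8K)` one has `bK = ε/8`.
-- For `V ≥ R = 4K/(1-κ)` the gain `b(1-κ)V ≥ 4bK` exceeds the total cost `3bK`. With merging, the
-- constant terms add up to `1 - 5ε/8`, whatever `V` is.
theorem exists_contraction_constant {κ K ε : ℝ} (hκ0 : 0 ≤ κ) (hκ : κ < 1) (hK : 0 < K)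
    (hε : 0 < ε) :
    ∃ ρ : ℝ, 0 ≤ ρ ∧ ρ < 1 ∧ ∀ V, 0 ≤ V →
      (4 * K / (1 - κ) ≤ V →
        1 + ε / 8 + ε / (8 * K) * (κ * V + 2 * K) ≤ ρ * (1 + ε / (8 * K) * V)) ∧
      (1 + ε / 8 - ε + ε / (8 * K) * (κ * V + 2 * K) ≤ ρ * (1 + ε / (8 * K) * V)) := by
  set b := ε / (8 * K) with hb
  have hb0 : 0 < b := by positivity
  have hbK : b * K = ε / 8 := by rw [hb]; field_simp
  set R := 4 * K / (1 - κ) with hR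
  have hκ' : 0 < 1 - κ := by linarith
  have hR0 : 0 < R := by positivity
  have hRκ : R * (1 - κ) = 4 * K := by rw [hR]; field_simp
  -- At `V = R` the remaining margin is `bK`; relative to the weight `1 + bR` this is `δ`.
  set δ := b * K / (1 + b * R) with hδ
  have h1R : 0 < 1 + b * R := by positivity
  have hδ0 : 0 < δ := by positivity
  have hδR : δ * (1 + b * R) = b * K := by rw [hδ]; field_simp
  refine ⟨max κ (max (1 - ε / 2) (1 - δ)), le_max_of_le_left hκ0,
    max_lt hκ (max_lt (by linarith) (by linarith)), fun V hV => ⟨fun hRV => ?_, ?_⟩⟩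
  · set ρ := max κ (max (1 - ε / 2) (1 - δ))
    have h1 : κ ≤ ρ := le_max_left _ _
    have h2 : 1 - δ ≤ ρ := (le_max_right _ _).trans (le_max_right _ _)
    have h3 : b * R * (ρ - κ) ≤ b * V * (ρ - κ) := by
      apply mul_le_mul_of_nonneg_right _ (by linarith)
      exact mul_le_mul_of_nonneg_left hRV hb0.le
    have h4 : (1 - ρ) * (1 + b * R) ≤ b * K := by
      rw [← hδR]
      exact mul_le_mul_of_nonneg_right (by linarith) h1R.le
    have h5 : b * (R * (1 - κ)) = 4 * (b * K) := by rw [hRκ]; ring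
    nlinarith
  · set ρ := max κ (max (1 - ε / 2) (1 - δ))
    have h1 : κ ≤ ρ := le_max_left _ _
    have h2 : 1 - ε / 2 ≤ ρ := (le_max_left _ _).trans (le_max_right _ _)
    have h3 : κ * (b * V) ≤ ρ * (b * V) := mul_le_mul_of_nonneg_right h1 (by positivity)
    nlinarith

namespace Model

variable (M : Model)

/-! ### The synchronous coupling -/

/-- The weight function `φ(y) = e^{α y}`. -/
noncomputable def expWeight (α : ℝ) (y : ℝ≥0) : ℝ≥0∞ := ENNReal.ofReal (Real.exp (α * y))

@[fun_prop]
theorem measurable_expWeight (α : ℝ) : Measurable (expWeight α) := by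
  unfold expWeight
  fun_prop

theorem one_le_expWeight {α : ℝ} (hα : 0 ≤ α) (y : ℝ≥0) : 1 ≤ expWeight α y := by
  rw [expWeight, ENNReal.one_le_ofReal]
  exact Real.one_le_exp (mul_nonneg hα y.2)

theorem expWeight_mono {α : ℝ} (hα : 0 ≤ α) : Monotone (expWeight α) := fun y z h =>
  ENNReal.ofReal_le_ofReal (Real.exp_le_exp.2 (mul_le_mul_of_nonneg_left (by exact_mod_cast h) hα))

theorem expWeight_ne_top (α : ℝ) (y : ℝ≥0) : expWeight α y ≠ ∞ := ENNReal.ofReal_ne_top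

theorem expWeight_flow_le {α : ℝ} (hα : 0 ≤ α) (y t : ℝ≥0) :
    expWeight α (M.flow y t) ≤
      expWeight α y * ENNReal.ofReal (Real.exp (-α * t)) + ENNReal.ofReal (Real.exp α) := by
  unfold expWeight
  rw [← ENNReal.ofReal_mul (Real.exp_pos _).le,
    ← ENNReal.ofReal_add (by positivity) (Real.exp_pos _).le, ← Real.exp_add]
  refine ENNReal.ofReal_le_ofReal ?_
  rcases le_max_iff.1 (M.flow_le_max y t) with h | h
  · refine le_trans (Real.exp_le_exp.2 ?_) (le_add_of_nonneg_right (Real.exp_pos _).le)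
    nlinarith
  · refine le_trans (Real.exp_le_exp.2 ?_) (le_add_of_nonneg_left (Real.exp_pos _).le)
    nlinarith

theorem jumpMean_expWeight_ne_top {α : ℝ}
    (h : Summable fun k : ℕ => M.p ^ (k + 1) * Real.exp (α * M.x k)) :
    M.jumpMean (expWeight α) ≠ ∞ := by
  have h1 : Summable fun k : ℕ => (1 - M.p) * M.p ^ k * Real.exp (α * M.x k) := by
    refine (h.mul_left ((1 - M.p) / M.p)).congr fun k => ?_
    have := M.p_pos.ne'
    field_simp
    ring
  have h2 : M.jumpMean (expWeight α) =
      ∑' k, ENNReal.ofReal ((1 - M.p) * M.p ^ k * Real.exp (α * M.x k)) := by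
    refine tsum_congr fun k => ?_
    rw [weight, expWeight, ← ENNReal.ofReal_mul]
    exact mul_nonneg (by linarith [M.p_lt_one]) (pow_nonneg M.p_pos.le k)
  rw [h2]
  exact h1.tsum_ofReal_ne_top

/-- A Foster–Lyapunov estimate. During a holding time `e` the weight loses a factor `e^{-αe}` until
level 1 is reached, and `E e^{(β-α)e} = 1/(1+α-β)`, at most `1/(1+α/2)`. The level 1 and a possible
jump cost additive constants, multiplied by `E e^{βe} = 1/(1-β) ≤ 2`. -/
theorem lintegral_exp_mul_ringStep_le {α β : ℝ} (hα : 0 < α) (hβ : β ≤ α / 2)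
    (hβ2 : β ≤ 1 / 2) (y : ℝ≥0) :
    ∫⁻ s, ENNReal.ofReal (Real.exp (β * s.1)) * expWeight α (M.ringStep y s) ∂M.stepLaw ≤
      ENNReal.ofReal (1 / (1 + α / 2)) * expWeight α y +
        2 * (ENNReal.ofReal (Real.exp α) + M.jumpMean (expWeight α)) := by
  have hx : Measurable M.x := measurable_of_countable _
  have h1 : ∀ᵐ s ∂M.stepLaw, ENNReal.ofReal (Real.exp (β * s.1)) * expWeight α (M.ringStep y s) ≤
      ENNReal.ofReal (Real.exp ((β - α) * s.1)) * expWeight α y +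
      (ENNReal.ofReal (Real.exp (β * s.1)) * ENNReal.ofReal (Real.exp α) +
      ENNReal.ofReal (Real.exp (β * s.1)) * expWeight α (M.x s.2.2)) := by
    filter_upwards [M.ae_stepLaw_pos] with s hs
    have h2 : expWeight α (M.ringStep y s) ≤
        expWeight α (M.flow y s.1.toNNReal) + expWeight α (M.x s.2.2) := by
      unfold ringStep
      split_ifs
      · exact le_add_self
      · exact le_self_add
    have h3 := M.expWeight_flow_le hα.le y s.1.toNNReal
    rw [Real.coe_toNNReal _ hs.le] at h3
    calc _ ≤ ENNReal.ofReal (Real.exp (β * s.1)) * ((expWeight α y *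
          ENNReal.ofReal (Real.exp (-α * s.1)) + ENNReal.ofReal (Real.exp α)) +
          expWeight α (M.x s.2.2)) := by gcongr; exact h2.trans (by gcongr)
      _ = _ := by
        have : ENNReal.ofReal (Real.exp ((β - α) * s.1)) =
            ENNReal.ofReal (Real.exp (β * s.1)) * ENNReal.ofReal (Real.exp (-α * s.1)) := by
          rw [← ENNReal.ofReal_mul (Real.exp_pos _).le, ← Real.exp_add]
          congr 2
          ring
        rw [this]
        ring
  refine (lintegral_mono_ae h1).trans ?_
  rw [lintegral_add_left (by fun_prop), lintegral_add_left (by fun_prop),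
    lintegral_mul_const _ (by fun_prop), lintegral_mul_const _ (by fun_prop),
    M.lintegral_stepLaw_fst (F := fun e => ENNReal.ofReal (Real.exp ((β - α) * e))) (by fun_prop),
    M.lintegral_stepLaw_fst (F := fun e => ENNReal.ofReal (Real.exp (β * e))) (by fun_prop),
    lintegral_exp_mul_expMeasure (by linarith), lintegral_exp_mul_expMeasure (by linarith)]
  have h4 : ∫⁻ s, ENNReal.ofReal (Real.exp (β * s.1)) * expWeight α (M.x s.2.2) ∂M.stepLaw =
      ENNReal.ofReal (1 / (1 - β)) * M.jumpMean (expWeight α) := by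
    rw [M.lintegral_stepLaw (by fun_prop), ← lintegral_exp_mul_expMeasure (by linarith),
      lintegral_expMeasure_one (by fun_prop), ← lintegral_mul_const _ (by fun_prop)]
    refine lintegral_congr fun u => ?_
    change ENNReal.ofReal (Real.exp (-u)) * (∫⁻ _ : I, ∑' k, M.weight k *
      (ENNReal.ofReal (Real.exp (β * u)) * expWeight α (M.x k))) = _
    rw [lintegral_const, measure_univ, mul_one, mul_assoc]
    congr 1
    rw [jumpMean, ← ENNReal.tsum_mul_left]
    exact tsum_congr fun k => by ring
  have h5 : ENNReal.ofReal (1 / (1 - β)) ≤ 2 := by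
    rw [← ENNReal.ofReal_ofNat 2]
    refine ENNReal.ofReal_le_ofReal ?_
    rw [div_le_iff₀ (by linarith)]
    linarith
  rw [h4, ← mul_add]
  gcongr
  linarith

theorem ae_stepLaw_snd_lt_one : ∀ᵐ s ∂M.stepLaw, (s.2.1 : ℝ) < 1 := by
  have h : ∀ᵐ v : I, (v : ℝ) < 1 := by
    filter_upwards [Measure.ae_ne volume (1 : I)] with v hv
    exact lt_of_le_of_ne v.2.2 fun h => hv (Subtype.ext h)
  exact (Measure.quasiMeasurePreserving_fst.comp Measure.quasiMeasurePreserving_snd).ae h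

/-- Merging: after a holding time longer than `T` both copies are at most `1/2`, the intensity there
is 1, so any mark below 1 makes both jump to the point with the common index. -/
theorem exists_ringStep_eq (N : ℝ≥0) : ∃ T : ℝ≥0, ∀ y ≤ N, ∀ z ≤ N, ∀ s : ℝ × I × ℕ,
    (s.2.1 : ℝ) < 1 → (T : ℝ) < s.1 → M.ringStep y s = M.ringStep z s := by
  obtain ⟨T, hT⟩ := M.exists_flow_le_half N
  refine ⟨T, fun y hy z hz s hs1 hsT => ?_⟩
  have h : T ≤ s.1.toNNReal := NNReal.coe_le_coe.1 (hsT.le.trans (Real.le_coe_toNNReal _))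
  unfold ringStep
  rw [if_pos, if_pos]
  · rwa [M.rate_eq_one (hT z hz _ h)]
  · rwa [M.rate_eq_one (hT y hy _ h)]

/-- A weight on pairs of states that vanishes when the states coincide. -/
noncomputable def pairWeight (α b : ℝ) (y z : ℝ≥0) : ℝ≥0∞ :=
  {q : ℝ≥0 × ℝ≥0 | q.1 ≠ q.2}.indicator
    (fun q => 1 + ENNReal.ofReal b * (expWeight α q.1 + expWeight α q.2)) (y, z)

theorem measurableSet_ne : MeasurableSet {q : ℝ≥0 × ℝ≥0 | q.1 ≠ q.2} :=
  (measurableSet_eq_fun measurable_fst measurable_snd).compl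

@[fun_prop]
theorem measurable_pairWeight {Ω : Type*} [MeasurableSpace Ω] {f g : Ω → ℝ≥0} (α b : ℝ)
    (hf : Measurable f) (hg : Measurable g) : Measurable fun ω => pairWeight α b (f ω) (g ω) := by
  refine Measurable.comp (g := {q : ℝ≥0 × ℝ≥0 | q.1 ≠ q.2}.indicator
    (fun q => 1 + ENNReal.ofReal b * (expWeight α q.1 + expWeight α q.2))) ?_ (hf.prodMk hg)
  exact Measurable.indicator (by fun_prop) measurableSet_ne

theorem pairWeight_self (α b : ℝ) (y : ℝ≥0) : pairWeight α b y y = 0 :=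
  indicator_of_notMem (by simp) _

theorem pairWeight_of_ne (α b : ℝ) {y z : ℝ≥0} (h : y ≠ z) :
    pairWeight α b y z = 1 + ENNReal.ofReal b * (expWeight α y + expWeight α z) :=
  indicator_of_mem (s := {q : ℝ≥0 × ℝ≥0 | q.1 ≠ q.2}) (a := (y, z)) h _

theorem pairWeight_flow_le {α : ℝ} (hα : 0 ≤ α) (b : ℝ) (y z t : ℝ≥0) :
    pairWeight α b (M.flow y t) (M.flow z t) ≤ pairWeight α b y z := by
  by_cases h : y = z
  · rw [h, pairWeight_self]
    exact zero_le
  by_cases h' : M.flow y t = M.flow z t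
  · rw [h', pairWeight_self]
    exact zero_le
  rw [pairWeight_of_ne _ _ h, pairWeight_of_ne _ _ h']
  gcongr
  · exact expWeight_mono hα (M.flow_le _ _)
  · exact expWeight_mono hα (M.flow_le _ _)

/-- A Harris-type argument for one ring of the synchronous coupling: the weights drift down when
they are large, and when they are small the copies merge with probability at least `ε`. The factor
`e^{βe}` is carried along so that contraction per ring becomes decay in time. -/
theorem exists_pairWeight_contraction {α : ℝ} (hα : 0 < α)
    (h : Summable fun k : ℕ => M.p ^ (k + 1) * Real.exp (α * M.x k)) :
    ∃ b β ρ : ℝ, 0 < b ∧ 0 < β ∧ β < 1 ∧ 0 ≤ ρ ∧ ρ < 1 ∧ ∀ y z : ℝ≥0,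
      ∫⁻ s, ENNReal.ofReal (Real.exp (β * s.1)) *
        pairWeight α b (M.ringStep y s) (M.ringStep z s) ∂M.stepLaw ≤
        ENNReal.ofReal ρ * pairWeight α b y z := by
  set m := (M.jumpMean (expWeight α)).toReal with hm
  have hmm : M.jumpMean (expWeight α) = ENNReal.ofReal m :=
    (ENNReal.ofReal_toReal (M.jumpMean_expWeight_ne_top h)).symm
  have hm0 : 0 ≤ m := ENNReal.toReal_nonneg
  set κ := 1 / (1 + α / 2) with hκ
  have hκ0 : 0 ≤ κ := by positivity
  have hκ1 : κ < 1 := by rw [hκ, div_lt_one (by positivity)]; linarith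
  set K := 2 * (Real.exp α + m) with hK
  have hK0 : 0 < K := by positivity
  set R := 4 * K / (1 - κ) with hR
  -- If the sum of the weights is below `R`, then `αw + 1 ≤ e^{αw}` puts both points below `R/α`.
  obtain ⟨T, hT⟩ := M.exists_ringStep_eq (R / α).toNNReal
  set ε := Real.exp (-(T : ℝ)) with hε
  have hε0 : 0 < ε := Real.exp_pos _
  have hε1 : ε ≤ 1 := Real.exp_le_one_iff.2 (neg_nonpos.2 T.2)
  obtain ⟨ρ, hρ0, hρ1, hρ⟩ := exists_contraction_constant hκ0 hκ1 hK0 hε0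
  set b := ε / (8 * K) with hb
  have hb0 : 0 < b := by positivity
  -- The bound `α/2` preserves the drift factor `κ`; the bound `ε/16` gives `1/(1-β) ≤ 1 + ε/8`, so
  -- the time weight does not use up the merging probability.
  set β := min (α / 2) (ε / 16) with hβ
  have hβ0 : 0 < β := lt_min (by positivity) (by positivity)
  have hβα : β ≤ α / 2 := min_le_left _ _
  have hβε : β ≤ ε / 16 := min_le_right _ _
  have hβ2 : β ≤ 1 / 2 := by linarith
  have hβinv : 1 / (1 - β) ≤ 1 + ε / 8 := by
    rw [div_le_iff₀ (by linarith)]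
    nlinarith
  refine ⟨b, β, ρ, hb0, hβ0, by linarith, hρ0, hρ1, fun y z => ?_⟩
  by_cases hyz : y = z
  · simp [hyz, pairWeight_self]
  let D : Set (ℝ × I × ℕ) := {s | M.ringStep y s ≠ M.ringStep z s}
  have hD : MeasurableSet D :=
    (measurableSet_eq_fun (f := fun s => M.ringStep y s) (g := fun s => M.ringStep z s)
      (by fun_prop) (by fun_prop)).compl
  set A := ∫⁻ s, D.indicator (fun s => ENNReal.ofReal (Real.exp (β * s.1))) s ∂M.stepLaw with hA
  have hE : ∫⁻ s, ENNReal.ofReal (Real.exp (β * s.1)) ∂M.stepLaw = ENNReal.ofReal (1 / (1 - β)) := by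
    rw [M.lintegral_stepLaw_fst (F := fun e => ENNReal.ofReal (Real.exp (β * e))) (by fun_prop),
      lintegral_exp_mul_expMeasure (by linarith)]
  have hA1 : A ≤ ENNReal.ofReal (1 + ε / 8) := by
    refine (lintegral_mono fun s => indicator_le_self _ _ s).trans ?_
    rw [hE]
    exact ENNReal.ofReal_le_ofReal hβinv
  set V := Real.exp (α * y) + Real.exp (α * z) with hV
  have hV0 : 0 ≤ V := by positivity
  have hA2 : V < R → A ≤ ENNReal.ofReal (1 + ε / 8 - ε) := by
    intro hVR
    have hle : ∀ w : ℝ≥0, Real.exp (α * w) ≤ V → w ≤ (R / α).toNNReal := by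
      intro w hw
      rw [← NNReal.coe_le_coe]
      refine le_trans ?_ (Real.le_coe_toNNReal _)
      rw [le_div_iff₀ hα]
      have := Real.add_one_le_exp (α * w)
      linarith
    have hy := hle y (by have := Real.exp_pos (α * z); linarith)
    have hz := hle z (by have := Real.exp_pos (α * y); linarith)
    have htail : ∫⁻ s, (Ioi (T : ℝ)).indicator 1 s.1 ∂M.stepLaw = ENNReal.ofReal ε := by
      rw [M.lintegral_stepLaw_fst (F := (Ioi (T : ℝ)).indicator 1)
        (measurable_one.indicator measurableSet_Ioi),
        lintegral_expMeasure_one (measurable_one.indicator measurableSet_Ioi)]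
      have h1 := setLIntegral_exp_neg_mul one_pos (T : ℝ)
      simp only [one_mul, div_one] at h1
      rw [hε, ← h1, ← lintegral_indicator measurableSet_Ioi, ← lintegral_indicator measurableSet_Ioi]
      refine lintegral_congr fun u => ?_
      by_cases hu : (T : ℝ) < u
      · have : 0 < u := lt_of_le_of_lt T.2 hu
        simp [hu, this]
      · simp [hu, indicator]
    -- Holding times longer than `T` merge the copies and have `e^{βe} ≥ 1`, so they take at least
    -- `ε` out of `E e^{βe}`.
    have hsum : A + ENNReal.ofReal ε ≤ ENNReal.ofReal (1 + ε / 8) := by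
      rw [← htail, hA, ← lintegral_add_left (Measurable.indicator (by fun_prop) hD)]
      refine le_trans (lintegral_mono_ae ?_) (hE.trans_le (ENNReal.ofReal_le_ofReal hβinv))
      filter_upwards [M.ae_stepLaw_snd_lt_one] with s hs
      by_cases hsT : (T : ℝ) < s.1
      · have h1 : s ∉ D := fun h => h (hT y hy z hz s hs hsT)
        have h2 : s.1 ∈ Ioi (T : ℝ) := hsT
        rw [indicator_of_notMem h1, indicator_of_mem h2, zero_add, Pi.one_apply,
          ENNReal.one_le_ofReal]
        exact Real.one_le_exp (mul_nonneg hβ0.le (T.2.trans hsT.le))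
      · have h2 : s.1 ∉ Ioi (T : ℝ) := hsT
        rw [indicator_of_notMem h2, add_zero]
        exact indicator_le_self _ _ s
    rw [ENNReal.ofReal_sub _ hε0.le]
    exact ENNReal.le_sub_of_add_le_right ENNReal.ofReal_ne_top hsum
  have hdrift : ∀ w : ℝ≥0, ∫⁻ s, ENNReal.ofReal (Real.exp (β * s.1)) *
      expWeight α (M.ringStep w s) ∂M.stepLaw ≤ ENNReal.ofReal (κ * Real.exp (α * w) + K) := by
    intro w
    refine (M.lintegral_exp_mul_ringStep_le hα hβα hβ2 w).trans (le_of_eq ?_)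
    rw [hmm, ← ENNReal.ofReal_add (Real.exp_pos _).le hm0, ← ENNReal.ofReal_ofNat 2,
      ← ENNReal.ofReal_mul (by norm_num), expWeight, ← ENNReal.ofReal_mul hκ0,
      ← ENNReal.ofReal_add (by positivity) (by positivity)]
  have hmain : ∫⁻ s, ENNReal.ofReal (Real.exp (β * s.1)) *
        pairWeight α b (M.ringStep y s) (M.ringStep z s) ∂M.stepLaw ≤
      A + ENNReal.ofReal (b * (κ * V + 2 * K)) := by
    calc _ ≤ ∫⁻ s, (D.indicator (fun s => ENNReal.ofReal (Real.exp (β * s.1))) s +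
          ENNReal.ofReal b * (ENNReal.ofReal (Real.exp (β * s.1)) * expWeight α (M.ringStep y s) +
            ENNReal.ofReal (Real.exp (β * s.1)) * expWeight α (M.ringStep z s))) ∂M.stepLaw := by
          refine lintegral_mono fun s => ?_
          by_cases hs : M.ringStep y s = M.ringStep z s
          · rw [hs, pairWeight_self, mul_zero]
            exact zero_le
          · rw [pairWeight_of_ne _ _ hs, indicator_of_mem (show s ∈ D from hs)]
            exact le_of_eq (by ring)
      _ = A + ENNReal.ofReal b * (∫⁻ s, ENNReal.ofReal (Real.exp (β * s.1)) *
            expWeight α (M.ringStep y s) ∂M.stepLaw + ∫⁻ s, ENNReal.ofReal (Real.exp (β * s.1)) *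
            expWeight α (M.ringStep z s) ∂M.stepLaw) := by
          rw [lintegral_add_left (Measurable.indicator (by fun_prop) hD),
            lintegral_const_mul _ (by fun_prop), lintegral_add_left (by fun_prop)]
      _ ≤ A + ENNReal.ofReal b * (ENNReal.ofReal (κ * Real.exp (α * y) + K) +
            ENNReal.ofReal (κ * Real.exp (α * z) + K)) := by
          gcongr
          · exact hdrift y
          · exact hdrift z
      _ = A + ENNReal.ofReal (b * (κ * V + 2 * K)) := by
          rw [← ENNReal.ofReal_add (by positivity) (by positivity), ← ENNReal.ofReal_mul hb0.le]
          congr 3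
          rw [hV]
          ring
  have hW : ENNReal.ofReal ρ * pairWeight α b y z = ENNReal.ofReal (ρ * (1 + b * V)) := by
    rw [pairWeight_of_ne _ _ hyz, expWeight, expWeight,
      ← ENNReal.ofReal_add (Real.exp_pos _).le (Real.exp_pos _).le, ← ENNReal.ofReal_mul hb0.le,
      ← ENNReal.ofReal_one, ← ENNReal.ofReal_add zero_le_one (by positivity),
      ← ENNReal.ofReal_mul hρ0]
  rw [hW]
  have hbV : 0 ≤ b * (κ * V + 2 * K) := by positivity
  rcases lt_or_ge V R with hVR | hVR
  · refine hmain.trans (le_trans (add_le_add_left (hA2 hVR) _) ?_)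
    rw [← ENNReal.ofReal_add (by linarith) hbV]
    exact ENNReal.ofReal_le_ofReal (hρ V hV0).2
  · refine hmain.trans (le_trans (add_le_add_left hA1 _) ?_)
    rw [← ENNReal.ofReal_add (by linarith) hbV]
    exact ENNReal.ofReal_le_ofReal ((hρ V hV0).1 hVR)

/-- The contraction iterated over `n` rings. The time is that of ring `n + 1` while the state is
that after ring `n`, because the state `n` is in force up to ring `n + 1`; the extra holding time
costs the factor `1/(1-β)`. -/
theorem lintegral_exp_ringTime_pairWeight_le {α b β ρ : ℝ} (hβ1 : β < 1)
    (hc : ∀ y z : ℝ≥0, ∫⁻ s, ENNReal.ofReal (Real.exp (β * s.1)) *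
        pairWeight α b (M.ringStep y s) (M.ringStep z s) ∂M.stepLaw ≤
        ENNReal.ofReal ρ * pairWeight α b y z) (n : ℕ) (y z : ℝ≥0) :
    ∫⁻ ω, ENNReal.ofReal (Real.exp (β * ringTime ω (n + 1))) *
      pairWeight α b (M.ringState y ω n) (M.ringState z ω n) ∂M.seedLaw ≤
      ENNReal.ofReal (1 / (1 - β)) * ENNReal.ofReal ρ ^ n * pairWeight α b y z := by
  induction n generalizing y z with
  | zero =>
    simp only [ringState, pow_zero, mul_one]
    rw [lintegral_mul_const _ (by fun_prop)]
    gcongr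
    rw [M.lintegral_seedLaw (by fun_prop)]
    refine le_of_eq ?_
    rw [← lintegral_exp_mul_expMeasure hβ1,
      ← M.lintegral_stepLaw_fst (F := fun e => ENNReal.ofReal (Real.exp (β * e))) (by fun_prop)]
    refine lintegral_congr_ae ?_
    filter_upwards [M.ae_stepLaw_pos] with s hs
    simp only [ringTime_consSeq, ringTime_zero, add_zero, lintegral_const, measure_univ, mul_one,
      Real.coe_toNNReal _ hs.le]
  | succ n ih =>
    rw [M.lintegral_seedLaw (by fun_prop)]
    have h1 : ∀ᵐ s ∂M.stepLaw, ∫⁻ ω, ENNReal.ofReal (Real.exp (β *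
        ringTime (consSeq s ω) (n + 1 + 1))) * pairWeight α b (M.ringState y (consSeq s ω) (n + 1))
        (M.ringState z (consSeq s ω) (n + 1)) ∂M.seedLaw ≤
        (ENNReal.ofReal (1 / (1 - β)) * ENNReal.ofReal ρ ^ n) *
        (ENNReal.ofReal (Real.exp (β * s.1)) *
          pairWeight α b (M.ringStep y s) (M.ringStep z s)) := by
      filter_upwards [M.ae_stepLaw_pos] with s hs
      calc _ = ∫⁻ ω, ENNReal.ofReal (Real.exp (β * s.1)) *
            (ENNReal.ofReal (Real.exp (β * ringTime ω (n + 1))) *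
            pairWeight α b (M.ringState (M.ringStep y s) ω n) (M.ringState (M.ringStep z s) ω n))
            ∂M.seedLaw := by
            refine lintegral_congr fun ω => ?_
            rw [ringTime_consSeq, ringState_consSeq, ringState_consSeq, ← mul_assoc,
              ← ENNReal.ofReal_mul (Real.exp_pos _).le, ← Real.exp_add]
            congr 3
            push_cast
            rw [Real.coe_toNNReal _ hs.le]
            ring
        _ ≤ _ := by
            rw [lintegral_const_mul _ (by fun_prop)]
            refine (mul_le_mul_right (ih (M.ringStep y s) (M.ringStep z s)) _).trans (le_of_eq ?_)
            ring
    refine (lintegral_mono_ae h1).trans ?_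
    rw [lintegral_const_mul _ (by fun_prop)]
    refine (mul_le_mul_right (hc y z) _).trans (le_of_eq ?_)
    ring

/-- The random number of rings is removed by bounding its term by the sum over all `n`. The term in
question has `e^{-βt} e^{β·ringTime (n+1)} ≥ 1`, and between rings the flow does not increase the
weight. What is left is a geometric series in `ρ`. -/
theorem lintegral_pairWeight_path_le {α b β ρ : ℝ} (hα : 0 ≤ α) (hβ0 : 0 < β) (hβ1 : β < 1)
    (hc : ∀ y z : ℝ≥0, ∫⁻ s, ENNReal.ofReal (Real.exp (β * s.1)) *
        pairWeight α b (M.ringStep y s) (M.ringStep z s) ∂M.stepLaw ≤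
        ENNReal.ofReal ρ * pairWeight α b y z) (y z t : ℝ≥0) :
    ∫⁻ ω, pairWeight α b (M.path y ω t) (M.path z ω t) ∂M.seedLaw ≤
      ENNReal.ofReal (Real.exp (-β * t)) * (ENNReal.ofReal (1 / (1 - β)) *
        (1 - ENNReal.ofReal ρ)⁻¹ * pairWeight α b y z) := by
  have h1 : ∀ᵐ ω ∂M.seedLaw, pairWeight α b (M.path y ω t) (M.path z ω t) ≤
      ENNReal.ofReal (Real.exp (-β * t)) *
      ∑' n : ℕ, ENNReal.ofReal (Real.exp (β * ringTime ω (n + 1))) *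
        pairWeight α b (M.ringState y ω n) (M.ringState z ω n) := by
    filter_upwards [M.ae_nonExplosive] with ω hω
    set n := ringCount ω t
    have h2 : pairWeight α b (M.path y ω t) (M.path z ω t) ≤
        pairWeight α b (M.ringState y ω n) (M.ringState z ω n) := M.pairWeight_flow_le hα b _ _ _
    have h3 : (1 : ℝ≥0∞) ≤ ENNReal.ofReal (Real.exp (-β * t)) *
        ENNReal.ofReal (Real.exp (β * ringTime ω (n + 1))) := by
      rw [← ENNReal.ofReal_mul (Real.exp_pos _).le, ← Real.exp_add, ENNReal.one_le_ofReal]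
      refine Real.one_le_exp ?_
      have : (t : ℝ) ≤ ringTime ω (n + 1) := by exact_mod_cast (lt_ringTime_ringCount hω t).le
      nlinarith
    calc _ ≤ 1 * pairWeight α b (M.ringState y ω n) (M.ringState z ω n) := by rwa [one_mul]
      _ ≤ (ENNReal.ofReal (Real.exp (-β * t)) *
          ENNReal.ofReal (Real.exp (β * ringTime ω (n + 1)))) *
          pairWeight α b (M.ringState y ω n) (M.ringState z ω n) := by gcongr
      _ ≤ _ := by
          rw [mul_assoc]
          gcongr
          exact ENNReal.le_tsum n
  refine (lintegral_mono_ae h1).trans ?_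
  rw [lintegral_const_mul _ (Measurable.tsum fun n => by fun_prop),
    lintegral_tsum fun n => by fun_prop]
  gcongr
  calc _ ≤ ∑' n : ℕ, ENNReal.ofReal (1 / (1 - β)) * ENNReal.ofReal ρ ^ n * pairWeight α b y z :=
        ENNReal.tsum_le_tsum fun n => M.lintegral_exp_ringTime_pairWeight_le hβ1 hc n y z
    _ = _ := by rw [ENNReal.tsum_mul_right, ENNReal.tsum_mul_left, ENNReal.tsum_geometric]

theorem exists_coupling_bound {α : ℝ} (hα : 0 < α)
    (h : Summable fun k : ℕ => M.p ^ (k + 1) * Real.exp (α * M.x k)) :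
    ∃ C β : ℝ, 0 < C ∧ 0 < β ∧ ∀ y z t : ℝ≥0,
      ∫⁻ ω in {ω | M.path y ω t ≠ M.path z ω t},
        (expWeight α (M.path y ω t) + expWeight α (M.path z ω t)) ∂M.seedLaw ≤
        ENNReal.ofReal (C * Real.exp (-β * t)) * (expWeight α y + expWeight α z) := by
  obtain ⟨b, β, ρ, hb, hβ0, hβ1, hρ0, hρ1, hc⟩ := M.exists_pairWeight_contraction hα h
  have hbtop : ENNReal.ofReal b ≠ 0 := (ENNReal.ofReal_pos.2 hb).ne'
  have h1ρ : (1 - ENNReal.ofReal ρ)⁻¹ = ENNReal.ofReal (1 / (1 - ρ)) := by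
    rw [one_div, ENNReal.ofReal_inv_of_pos (by linarith), ENNReal.ofReal_sub _ hρ0,
      ENNReal.ofReal_one]
  have hβ' : 0 < 1 - β := by linarith
  have hρ' : 0 < 1 - ρ := by linarith
  refine ⟨b⁻¹ * (1 / (1 - β) * (1 / (1 - ρ))) * (1 + b), β, by positivity, hβ0, fun y z t => ?_⟩
  have hms : MeasurableSet {ω | M.path y ω t ≠ M.path z ω t} :=
    (measurableSet_eq_fun (f := fun ω => M.path y ω t) (g := fun ω => M.path z ω t)
      (by fun_prop) (by fun_prop)).compl
  have h1 : ∫⁻ ω in {ω | M.path y ω t ≠ M.path z ω t},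
        (expWeight α (M.path y ω t) + expWeight α (M.path z ω t)) ∂M.seedLaw ≤
      (ENNReal.ofReal b)⁻¹ * ∫⁻ ω, pairWeight α b (M.path y ω t) (M.path z ω t) ∂M.seedLaw := by
    rw [← lintegral_const_mul _ (by fun_prop), ← lintegral_indicator hms]
    refine lintegral_mono fun ω => ?_
    by_cases hω : M.path y ω t = M.path z ω t
    · rw [indicator_of_notMem (by simpa using hω)]
      exact zero_le
    · rw [indicator_of_mem (s := {ω | M.path y ω t ≠ M.path z ω t}) hω, pairWeight_of_ne _ _ hω,
        mul_add, ← mul_assoc, ENNReal.inv_mul_cancel hbtop ENNReal.ofReal_ne_top, one_mul]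
      exact le_add_self
  have h2 : pairWeight α b y z ≤ ENNReal.ofReal (1 + b) * (expWeight α y + expWeight α z) := by
    by_cases hyz : y = z
    · rw [hyz, pairWeight_self]
      exact zero_le
    · rw [pairWeight_of_ne _ _ hyz, ENNReal.ofReal_add zero_le_one hb.le, add_mul,
        ENNReal.ofReal_one, one_mul]
      gcongr
      exact (one_le_expWeight hα.le y).trans le_self_add
  refine h1.trans ((mul_le_mul_right ((M.lintegral_pairWeight_path_le hα.le hβ0 hβ1 hc y z t).trans
    (mul_le_mul_right (mul_le_mul_right h2 _) _)) _).trans (le_of_eq ?_))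
  rw [h1ρ, ← ENNReal.ofReal_inv_of_pos hb]
  simp only [← mul_assoc]
  rw [← ENNReal.ofReal_mul (by positivity), ← ENNReal.ofReal_mul (by positivity),
    ← ENNReal.ofReal_mul (by positivity), ← ENNReal.ofReal_mul (by positivity)]
  congr 2
  ring

end Model
namespace Model

variable (M : Model)

/-! ### Stationary measures from stationary measures of the ring chain -/

/-- The expectation of `F` at the state just before the first ring. -/
noncomputable def ringOp (F : ℝ≥0 → ℝ≥0∞) (z : ℝ≥0) : ℝ≥0∞ :=
  ∫⁻ v in Ioi 0, ENNReal.ofReal (Real.exp (-v)) * F (M.flow z v.toNNReal)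

@[fun_prop]
theorem measurable_ringOp {F : ℝ≥0 → ℝ≥0∞} (hF : Measurable F) : Measurable (M.ringOp F) := by
  refine Measurable.lintegral_prod_right'
    (f := fun q : ℝ≥0 × ℝ => ENNReal.ofReal (Real.exp (-q.2)) * F (M.flow q.1 q.2.toNNReal)) ?_
  fun_prop

theorem toNNReal_sub_of_nonneg (a : ℝ) {b : ℝ} (hb : 0 ≤ b) :
    (a - b).toNNReal = a.toNNReal - b.toNNReal := by
  rcases le_total 0 a with ha | ha
  · rw [NNReal.sub_def, Real.coe_toNNReal _ ha, Real.coe_toNNReal _ hb]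
  · rw [Real.toNNReal_of_nonpos ha, Real.toNNReal_of_nonpos (by linarith), zero_tsub]

theorem setLIntegral_Ioi_add (f : ℝ → ℝ≥0∞) (c : ℝ) :
    ∫⁻ v in Ioi 0, f (v + c) = ∫⁻ v in Ioi c, f v := by
  rw [← lintegral_indicator measurableSet_Ioi, ← lintegral_indicator measurableSet_Ioi,
    ← lintegral_add_right_eq_self ((Ioi c).indicator f) c]
  refine lintegral_congr fun v => ?_
  simp [indicator]

theorem flow_flow_toNNReal (z : ℝ≥0) {u v : ℝ} (hu : 0 ≤ u) (hv : 0 ≤ v) :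
    M.flow (M.flow z u.toNNReal) v.toNNReal = M.flow z (u + v).toNNReal := by
  rw [flow_flow, Real.toNNReal_add hu hv]

theorem jump_le_one {H : ℝ≥0 → ℝ≥0∞} (hH : ∀ z, H z ≤ 1) (z : ℝ≥0) : M.jump H z ≤ 1 := by
  have h1 : M.jumpMean H ≤ 1 := by
    rw [← M.tsum_weight]
    exact ENNReal.tsum_le_tsum fun k => (mul_le_mul_right (hH _) _).trans_eq (mul_one _)
  calc M.jump H z ≤ ENNReal.ofReal (M.rate z) * 1 + ENNReal.ofReal (1 - M.rate z) * 1 := by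
        unfold jump
        gcongr
        exact hH z
    _ = 1 := by
        rw [mul_one, mul_one, ← ENNReal.ofReal_add (M.rate_nonneg z)
          (sub_nonneg.2 (M.rate_le_one z))]
        simp

theorem transOp_le_one {F : ℝ≥0 → ℝ≥0∞} (hF : ∀ z, F z ≤ 1) (t y : ℝ≥0) : M.transOp F t y ≤ 1 :=
  (lintegral_mono hF).trans (by simp)

section

variable {F : ℝ≥0 → ℝ≥0∞} (t : ℝ≥0) (z : ℝ≥0)

/-- Absence of memory of the clock: the two exponential times combine into `e^{-(v+u)}`, the two
flows into one, and the substitution `v + u → v` turns the outer range into `v > u`. -/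
theorem ringOp_transOp (hF : Measurable F) :
    M.ringOp (M.transOp F t) z =
      (∫⁻ v in Ioi (t : ℝ), ENNReal.ofReal (Real.exp (-v)) * F (M.flow z v.toNNReal)) +
      ∫⁻ u in Ioc 0 (t : ℝ), ∫⁻ v in Ioi u, ENNReal.ofReal (Real.exp (-v)) *
        M.jump (M.transOp F (t - u.toNNReal)) (M.flow z v.toNNReal) := by
  have hexp : ∀ u v : ℝ, ENNReal.ofReal (Real.exp (-v)) * ENNReal.ofReal (Real.exp (-u)) =
      ENNReal.ofReal (Real.exp (-(v + u))) := fun u v => by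
    rw [← ENNReal.ofReal_mul (Real.exp_pos _).le, ← Real.exp_add]
    congr 2
    ring
  have hJ : Measurable fun q : ℝ × ℝ≥0 => M.jump (M.transOp F (t - q.1.toNNReal)) q.2 := by
    unfold jump jumpMean
    fun_prop
  have h1 : M.ringOp (M.transOp F t) z = ∫⁻ v in Ioi 0,
      (ENNReal.ofReal (Real.exp (-(v + t))) * F (M.flow z (v + t).toNNReal) +
      ∫⁻ u in Ioc 0 (t : ℝ), ENNReal.ofReal (Real.exp (-(v + u))) *
        M.jump (M.transOp F (t - u.toNNReal)) (M.flow z (v + u).toNNReal)) := by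
    refine setLIntegral_congr_fun measurableSet_Ioi fun v hv => ?_
    have hv : 0 ≤ v := (mem_Ioi.1 hv).le
    rw [M.transOp_first_ring hF, mul_add, ← mul_assoc, hexp, flow_flow,
      Real.toNNReal_add hv (NNReal.coe_nonneg t), Real.toNNReal_coe, ← lintegral_const_mul _ (by
        refine Measurable.mul (by fun_prop) (hJ.comp (f := fun u : ℝ => (u, M.flow (M.flow z v.toNNReal) u.toNNReal)) (by fun_prop)))]
    congr 1
    refine setLIntegral_congr_fun measurableSet_Ioc fun u hu => ?_
    rw [← mul_assoc, hexp, M.flow_flow_toNNReal z hv hu.1.le]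
  rw [h1, lintegral_add_left (by fun_prop), setLIntegral_Ioi_add
    (fun v => ENNReal.ofReal (Real.exp (-v)) * F (M.flow z v.toNNReal)) t]
  congr 1
  rw [lintegral_lintegral_swap]
  · refine lintegral_congr fun u => ?_
    exact setLIntegral_Ioi_add (fun v => ENNReal.ofReal (Real.exp (-v)) *
      M.jump (M.transOp F (t - u.toNNReal)) (M.flow z v.toNNReal)) u
  · refine Measurable.aemeasurable ?_
    refine Measurable.mul (by fun_prop) ?_
    exact hJ.comp (f := fun q : ℝ × ℝ => (q.2, M.flow z (q.1 + q.2).toNNReal)) (by fun_prop)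

/-- The renewal equation integrated over `[0, t]`. The double integral is over the triangle `0 < v ≤
w ≤ t`, and it is rewritten so that its integrand has the same form as in `ringOp_transOp`, with the
complementary range `v ≤ u`. -/
theorem lintegral_transOp_time (hF : Measurable F) :
    ∫⁻ u in Ioc 0 (t : ℝ), M.transOp F (t - u.toNNReal) z =
      (∫⁻ w in Ioc 0 (t : ℝ), ENNReal.ofReal (Real.exp (-w)) * F (M.flow z w.toNNReal)) +
      ∫⁻ u in Ioc 0 (t : ℝ), ∫⁻ v in Ioc 0 u, ENNReal.ofReal (Real.exp (-v)) *
        M.jump (M.transOp F (t - u.toNNReal)) (M.flow z v.toNNReal) := by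
  have hJ : Measurable fun q : ℝ≥0 × ℝ≥0 => M.jump (M.transOp F q.1) q.2 := by
    unfold jump jumpMean
    fun_prop
  have h1 : ∫⁻ u in Ioc 0 (t : ℝ), M.transOp F (t - u.toNNReal) z =
      ∫⁻ w in Ioc 0 (t : ℝ), M.transOp F w.toNNReal z := by
    rw [setLIntegral_congr Ioo_ae_eq_Ioc.symm, setLIntegral_congr Ioo_ae_eq_Ioc.symm,
      ← lintegral_indicator measurableSet_Ioo,
      ← lintegral_indicator measurableSet_Ioo,
      ← lintegral_sub_left_eq_self ((Ioo 0 (t : ℝ)).indicator fun w => M.transOp F w.toNNReal z) t]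
    refine lintegral_congr fun u => ?_
    by_cases hu : u ∈ Ioo 0 (t : ℝ)
    · have hu' : (t : ℝ) - u ∈ Ioo 0 (t : ℝ) := ⟨by linarith [hu.2], by linarith [hu.1]⟩
      rw [indicator_of_mem hu, indicator_of_mem hu']
      congr 1
      rw [toNNReal_sub_of_nonneg _ hu.1.le, Real.toNNReal_coe]
    · have hu' : (t : ℝ) - u ∉ Ioo 0 (t : ℝ) := fun h => hu ⟨by linarith [h.2], by linarith [h.1]⟩
      rw [indicator_of_notMem hu, indicator_of_notMem hu']
  have h2 : ∫⁻ w in Ioc 0 (t : ℝ), M.transOp F w.toNNReal z =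
      ∫⁻ w in Ioc 0 (t : ℝ), (ENNReal.ofReal (Real.exp (-w)) * F (M.flow z w.toNNReal) +
      ∫⁻ v in Ioc 0 w, ENNReal.ofReal (Real.exp (-v)) *
        M.jump (M.transOp F (w.toNNReal - v.toNNReal)) (M.flow z v.toNNReal)) := by
    refine setLIntegral_congr_fun measurableSet_Ioc fun w hw => ?_
    rw [M.transOp_first_ring hF, Real.coe_toNNReal _ hw.1.le]
  rw [h1, h2, lintegral_add_left (by fun_prop)]
  congr 1
  have hA : ∀ τ : ℝ × ℝ → ℝ≥0, Measurable τ → ∫⁻ w in Ioc 0 (t : ℝ), ∫⁻ v in Ioc 0 w,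
      ENNReal.ofReal (Real.exp (-v)) * M.jump (M.transOp F (τ (w, v))) (M.flow z v.toNNReal) =
      ∫⁻ v, ∫⁻ w, {q : ℝ × ℝ | 0 < q.2 ∧ q.2 ≤ q.1 ∧ q.1 ≤ t}.indicator (fun q =>
        ENNReal.ofReal (Real.exp (-q.2)) *
          M.jump (M.transOp F (τ q)) (M.flow z q.2.toNNReal)) (w, v) := by
    intro τ hτ
    rw [lintegral_lintegral_swap (f := fun v w => {q : ℝ × ℝ | 0 < q.2 ∧ q.2 ≤ q.1 ∧ q.1 ≤ t}.indicator
      (fun q => ENNReal.ofReal (Real.exp (-q.2)) *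
          M.jump (M.transOp F (τ q)) (M.flow z q.2.toNNReal)) (w, v)),
      ← lintegral_indicator measurableSet_Ioc]
    · refine lintegral_congr fun w => ?_
      by_cases hw : w ∈ Ioc 0 (t : ℝ)
      · rw [indicator_of_mem hw, ← lintegral_indicator measurableSet_Ioc]
        refine lintegral_congr fun v => ?_
        have : v ∈ Ioc 0 w ↔ (w, v) ∈ {q : ℝ × ℝ | 0 < q.2 ∧ q.2 ≤ q.1 ∧ q.1 ≤ t} :=
          ⟨fun h => ⟨h.1, h.2, hw.2⟩, fun h => ⟨h.1, h.2.1⟩⟩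
        by_cases hv : v ∈ Ioc 0 w
        · rw [indicator_of_mem hv, indicator_of_mem (this.1 hv)]
        · rw [indicator_of_notMem hv, indicator_of_notMem (fun h => hv (this.2 h))]
      · rw [indicator_of_notMem hw, eq_comm, lintegral_eq_zero_of_ae_eq_zero]
        refine ae_of_all _ fun v => indicator_of_notMem ?_ _
        exact fun h => hw ⟨h.1.trans_le h.2.1, h.2.2⟩
    · refine Measurable.aemeasurable ?_
      have hset : MeasurableSet {q : ℝ × ℝ | 0 < q.2 ∧ q.2 ≤ q.1 ∧ q.1 ≤ t} :=
        (measurableSet_lt measurable_const measurable_snd).inter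
          ((measurableSet_le measurable_snd measurable_fst).inter
            (measurableSet_le measurable_fst measurable_const))
      refine Measurable.comp (g := {q : ℝ × ℝ | 0 < q.2 ∧ q.2 ≤ q.1 ∧ q.1 ≤ t}.indicator
        (fun q => ENNReal.ofReal (Real.exp (-q.2)) *
          M.jump (M.transOp F (τ q)) (M.flow z q.2.toNNReal))) ?_ measurable_swap
      refine Measurable.indicator (Measurable.mul (by fun_prop) ?_) hset
      exact hJ.comp (f := fun q : ℝ × ℝ => (τ q, M.flow z q.2.toNNReal)) (by fun_prop)
  rw [hA (fun q => q.1.toNNReal - q.2.toNNReal) (by fun_prop),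
    hA (fun q => t - q.1.toNNReal) (by fun_prop)]
  refine lintegral_congr fun v => ?_
  -- For fixed `v` the reflection `w ↦ v + t - w` preserves the triangle and exchanges the elapsed
  -- times `w - v` and `t - w`.
  rw [← lintegral_sub_left_eq_self _ (v + t)]
  refine lintegral_congr fun w => ?_
  by_cases hw : (w, v) ∈ {q : ℝ × ℝ | 0 < q.2 ∧ q.2 ≤ q.1 ∧ q.1 ≤ t}
  · have hw' : (v + t - w, v) ∈ {q : ℝ × ℝ | 0 < q.2 ∧ q.2 ≤ q.1 ∧ q.1 ≤ t} :=
      ⟨hw.1, by linarith [hw.2.2], by linarith [hw.2.1]⟩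
    rw [indicator_of_mem hw, indicator_of_mem hw']
    have h3 : (v + t - w).toNNReal - v.toNNReal = t - w.toNNReal := by
      have h0 : 0 < v := hw.1
      have h1 : v ≤ w := hw.2.1
      rw [← toNNReal_sub_of_nonneg _ h0.le]
      conv_rhs => rw [← Real.toNNReal_coe (r := t), ← toNNReal_sub_of_nonneg _ (h0.le.trans h1)]
      congr 1
      ring
    simp only [h3]
  · have hw' : (v + t - w, v) ∉ {q : ℝ × ℝ | 0 < q.2 ∧ q.2 ≤ q.1 ∧ q.1 ≤ t} :=
      fun h => hw ⟨h.1, by linarith [h.2.2], by linarith [h.2.1]⟩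
    rw [indicator_of_notMem hw, indicator_of_notMem hw']

end

/-- Here `μ` describes the state before a ring and `ν` the state after it. Write `A`, `A'` for the
parts of `ringOp F` from times after and before `t`. Then `∫ T_t F dμ = ∫ (A + Y) dν`. The sum `Y +
X` is the full ring expectation of `jump`, which the two stationarity relations turn into a time
integral of `T_{t-u} F` over `ν`, that is into `A' + X`. Cancelling `X` leaves `∫ (A + A') dν = ∫ F
dμ`. -/
theorem isInvariant_of_ringOp_jump {μ ν : Measure ℝ≥0} [IsFiniteMeasure μ] [IsFiniteMeasure ν]
    (hG : ∀ F, Measurable F → ∫⁻ z, F z ∂μ = ∫⁻ z, M.ringOp F z ∂ν)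
    (hJ : ∀ F, Measurable F → ∫⁻ z, F z ∂ν = ∫⁻ z, M.jump F z ∂μ) :
    IsInvariant M.transition μ := by
  intro t B hB
  set F : ℝ≥0 → ℝ≥0∞ := B.indicator 1 with hFdef
  have hF : Measurable F := measurable_one.indicator hB
  have hF1 : ∀ z, F z ≤ 1 := fun z => indicator_le_self' (by simp) z
  simp only [← M.transOp_indicator_one hB, ← hFdef]
  have hJm : Measurable fun q : ℝ≥0 × ℝ≥0 => M.jump (M.transOp F q.1) q.2 := by
    unfold jump jumpMean
    fun_prop
  set X : ℝ≥0 → ℝ≥0∞ := fun z => ∫⁻ u in Ioc 0 (t : ℝ), ∫⁻ v in Ioc 0 u,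
    ENNReal.ofReal (Real.exp (-v)) *
      M.jump (M.transOp F (t - u.toNNReal)) (M.flow z v.toNNReal) with hX
  set Y : ℝ≥0 → ℝ≥0∞ := fun z => ∫⁻ u in Ioc 0 (t : ℝ), ∫⁻ v in Ioi u,
    ENNReal.ofReal (Real.exp (-v)) *
      M.jump (M.transOp F (t - u.toNNReal)) (M.flow z v.toNNReal) with hY
  set A : ℝ≥0 → ℝ≥0∞ := fun z => ∫⁻ v in Ioi (t : ℝ), ENNReal.ofReal (Real.exp (-v)) *
    F (M.flow z v.toNNReal) with hAdef
  set A' : ℝ≥0 → ℝ≥0∞ := fun z => ∫⁻ v in Ioc 0 (t : ℝ), ENNReal.ofReal (Real.exp (-v)) *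
    F (M.flow z v.toNNReal) with hA'def
  have hAm : Measurable A := Measurable.lintegral_prod_right'
    (f := fun q : ℝ≥0 × ℝ => ENNReal.ofReal (Real.exp (-q.2)) * F (M.flow q.1 q.2.toNNReal))
    (by fun_prop)
  have hA'm : Measurable A' := Measurable.lintegral_prod_right'
    (f := fun q : ℝ≥0 × ℝ => ENNReal.ofReal (Real.exp (-q.2)) * F (M.flow q.1 q.2.toNNReal))
    (by fun_prop)
  have hin : Measurable fun q : ℝ≥0 × ℝ => ∫⁻ v in Ioc 0 q.2, ENNReal.ofReal (Real.exp (-v)) *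
      M.jump (M.transOp F (t - q.2.toNNReal)) (M.flow q.1 v.toNNReal) := by
    simp only [← lintegral_indicator measurableSet_Ioc]
    have hS : MeasurableSet {q : (ℝ≥0 × ℝ) × ℝ | 0 < q.2 ∧ q.2 ≤ q.1.2} :=
      (measurableSet_lt measurable_const measurable_snd).inter
        (measurableSet_le measurable_snd (measurable_snd.comp measurable_fst))
    refine Measurable.lintegral_prod_right' (f := fun q : (ℝ≥0 × ℝ) × ℝ =>
      {q : (ℝ≥0 × ℝ) × ℝ | 0 < q.2 ∧ q.2 ≤ q.1.2}.indicator (fun q =>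
        ENNReal.ofReal (Real.exp (-q.2)) *
          M.jump (M.transOp F (t - q.1.2.toNNReal)) (M.flow q.1.1 q.2.toNNReal)) q) ?_
    refine Measurable.indicator (Measurable.mul (by fun_prop) ?_) hS
    exact hJm.comp (f := fun q : (ℝ≥0 × ℝ) × ℝ => (t - q.1.2.toNNReal, M.flow q.1.1 q.2.toNNReal))
      (by fun_prop)
  have hXm : Measurable X := Measurable.lintegral_prod_right' hin
  have hXle : ∀ z, X z ≤ ENNReal.ofReal t * ENNReal.ofReal t := by
    intro z
    calc X z ≤ ∫⁻ u in Ioc 0 (t : ℝ), ENNReal.ofReal t := by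
          refine setLIntegral_mono measurable_const fun u hu => ?_
          calc _ ≤ ∫⁻ v in Ioc 0 u, 1 := by
                refine setLIntegral_mono measurable_const fun v hv => ?_
                refine (mul_le_mul' ?_ (M.jump_le_one (fun z => M.transOp_le_one hF1 _ z) _)).trans_eq
                  (mul_one 1)
                rw [ENNReal.ofReal_le_one, Real.exp_le_one_iff]
                linarith [hv.1]
            _ = ENNReal.ofReal u := by simp
            _ ≤ _ := ENNReal.ofReal_le_ofReal hu.2
      _ = _ := by simp
  -- The cancellation takes place in `ℝ≥0∞`, so a finite integral is needed; for an indicator `F`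
  -- the bound `t²` on `X` and the finiteness of `ν` provide it.
  have hXfin : ∫⁻ z, X z ∂ν ≠ ∞ := by
    refine ne_top_of_le_ne_top ?_ (lintegral_mono hXle)
    rw [lintegral_const]
    finiteness
  have h1 : ∫⁻ z, M.transOp F t z ∂μ = ∫⁻ z, (A z + Y z) ∂ν := by
    rw [hG _ (by fun_prop)]
    exact lintegral_congr fun z => M.ringOp_transOp t z hF
  have h2 : ∀ z, Y z + X z = ∫⁻ u in Ioc 0 (t : ℝ), M.ringOp (M.jump (M.transOp F (t - u.toNNReal))) z := by
    intro z
    rw [add_comm, hX, hY]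
    simp only
    rw [← lintegral_add_left]
    · refine setLIntegral_congr_fun measurableSet_Ioc fun u hu => ?_
      rw [ringOp, ← Ioc_union_Ioi_eq_Ioi hu.1.le,
        lintegral_union measurableSet_Ioi Ioc_disjoint_Ioi_same]
    · exact hin.comp (f := fun u : ℝ => (z, u)) (by fun_prop)
  have h3 : ∫⁻ z, (Y z + X z) ∂ν = ∫⁻ z, (A' z + X z) ∂ν := by
    simp only [h2]
    calc _ = ∫⁻ u in Ioc 0 (t : ℝ), ∫⁻ z, M.ringOp (M.jump (M.transOp F (t - u.toNNReal))) z ∂ν := by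
          rw [lintegral_lintegral_swap]
          refine Measurable.aemeasurable ?_
          unfold ringOp
          refine Measurable.lintegral_prod_right' (f := fun q : (ℝ≥0 × ℝ) × ℝ =>
            ENNReal.ofReal (Real.exp (-q.2)) *
              M.jump (M.transOp F (t - q.1.2.toNNReal)) (M.flow q.1.1 q.2.toNNReal)) ?_
          refine Measurable.mul (by fun_prop) ?_
          exact hJm.comp (f := fun q : (ℝ≥0 × ℝ) × ℝ =>
            (t - q.1.2.toNNReal, M.flow q.1.1 q.2.toNNReal)) (by fun_prop)
      _ = ∫⁻ u in Ioc 0 (t : ℝ), ∫⁻ z, M.transOp F (t - u.toNNReal) z ∂ν := by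
          refine lintegral_congr fun u => ?_
          rw [← hG _ (by fun_prop), hJ _ (by fun_prop)]
      _ = ∫⁻ z, (∫⁻ u in Ioc 0 (t : ℝ), M.transOp F (t - u.toNNReal) z) ∂ν := by
          rw [lintegral_lintegral_swap]
          exact Measurable.aemeasurable (by fun_prop)
      _ = _ := lintegral_congr fun z => M.lintegral_transOp_time t z hF
  have h4 : ∫⁻ z, M.transOp F t z ∂μ + ∫⁻ z, X z ∂ν = ∫⁻ z, F z ∂μ + ∫⁻ z, X z ∂ν := by
    calc _ = ∫⁻ z, A z ∂ν + ∫⁻ z, (Y z + X z) ∂ν := by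
          rw [h1, lintegral_add_left hAm, add_assoc]
          rw [lintegral_add_right _ hXm]
      _ = ∫⁻ z, (A z + A' z) ∂ν + ∫⁻ z, X z ∂ν := by
          rw [h3, lintegral_add_left hA'm, lintegral_add_left hAm, add_assoc]
      _ = _ := by
          rw [hG F hF]
          congr 1
          refine lintegral_congr fun z => ?_
          rw [ringOp, ← Ioc_union_Ioi_eq_Ioi t.2,
            lintegral_union measurableSet_Ioi Ioc_disjoint_Ioi_same, add_comm]
          rfl
  have h5 := (ENNReal.add_left_inj hXfin).1 h4
  rw [h5, hFdef, lintegral_indicator_one hB]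

end Model
namespace Model

variable (M : Model)

/-! ### The stationary distribution -/

/-- The jump intensity at time `r` along the trajectory of the flow from `z`. -/
noncomputable def rateAt (z : ℝ≥0) (r : ℝ) : ℝ := M.rate (M.flow z r.toNNReal)

theorem continuous_rateAt (z : ℝ≥0) : Continuous (M.rateAt z) :=
  M.continuous_rate.comp ((M.continuous_flow_right z).comp continuous_real_toNNReal)

theorem rateAt_le_one (z : ℝ≥0) (r : ℝ) : M.rateAt z r ≤ 1 := M.rate_le_one _

/-- The probability that there is no jump up to time `u` when the process starts from `z`. -/
noncomputable def surv (z : ℝ≥0) (u : ℝ) : ℝ := Real.exp (-∫ r in (0 : ℝ)..u, M.rateAt z r)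

theorem surv_pos (z : ℝ≥0) (u : ℝ) : 0 < M.surv z u := Real.exp_pos _

theorem surv_zero (z : ℝ≥0) : M.surv z 0 = 1 := by simp [surv]

theorem hasDerivAt_surv (z : ℝ≥0) (u : ℝ) :
    HasDerivAt (M.surv z) (-(M.surv z u * M.rateAt z u)) u := by
  have h := (intervalIntegral.integral_hasDerivAt_right
    ((M.continuous_rateAt z).intervalIntegrable 0 u)
    ((M.continuous_rateAt z).stronglyMeasurableAtFilter _ _)
    (M.continuous_rateAt z).continuousAt).neg.exp
  rw [mul_neg] at h
  exact h

theorem continuous_surv (z : ℝ≥0) : Continuous (M.surv z) :=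
  continuous_iff_continuousAt.2 fun u => (M.hasDerivAt_surv z u).continuousAt

theorem surv_le_one (z : ℝ≥0) {u : ℝ} (hu : 0 ≤ u) : M.surv z u ≤ 1 := by
  rw [surv, Real.exp_le_one_iff, neg_nonpos]
  exact intervalIntegral.integral_nonneg hu fun r _ => M.rate_nonneg _

theorem surv_le_exp (z : ℝ≥0) {T u : ℝ} (hT : 0 ≤ T) (hu : T ≤ u)
    (h : ∀ r, T ≤ r → M.rateAt z r = 1) : M.surv z u ≤ Real.exp (-(u - T)) := by
  rw [surv, Real.exp_le_exp, neg_le_neg_iff, ← intervalIntegral.integral_add_adjacent_intervals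
    ((M.continuous_rateAt z).intervalIntegrable 0 T) ((M.continuous_rateAt z).intervalIntegrable T u)]
  have h1 : ∫ r in T..u, M.rateAt z r = u - T := by
    rw [intervalIntegral.integral_congr (g := fun _ => (1 : ℝ))]
    · simp
    · intro r hr
      rw [uIcc_of_le hu] at hr
      exact h r hr.1
  have h2 : 0 ≤ ∫ r in (0 : ℝ)..T, M.rateAt z r :=
    intervalIntegral.integral_nonneg hT fun r _ => M.rate_nonneg _
  linarith

theorem surv_eq_one {z : ℝ≥0} {u : ℝ} (hu0 : 0 ≤ u) (hu : u ≤ z - 1) : M.surv z u = 1 := by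
  rw [surv, intervalIntegral.integral_congr (g := fun _ => (0 : ℝ))]
  · simp
  · intro r hr
    rw [uIcc_of_le hu0] at hr
    refine M.rate_eq_zero ?_
    rw [← NNReal.coe_le_coe]
    refine le_trans ?_ (M.sub_le_flow _ _)
    rw [Real.coe_toNNReal _ hr.1]
    push_cast
    linarith [hr.2]

/-- The drift has unit speed above 1, so level 1 is reached by time `z`; a further time independent
of `z` brings the flow below `1/2`. -/
theorem exists_rateAt_eq_one :
    ∃ T : ℝ≥0, ∀ (z : ℝ≥0) (r : ℝ), (z : ℝ) + T ≤ r → M.rateAt z r = 1 := by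
  obtain ⟨T, hT⟩ := M.exists_flow_le_half 1
  refine ⟨T, fun z r hr => M.rate_eq_one ?_⟩
  have h1 : M.flow z z ≤ 1 := by
    have := M.flow_le_max z z
    simp only [sub_self] at this
    exact_mod_cast this.trans (max_le zero_le_one le_rfl)
  have hz : z + T ≤ r.toNNReal := NNReal.coe_le_coe.1 (by
    push_cast
    exact hr.trans (Real.le_coe_toNNReal r))
  have h2 := M.flow_antitone z hz
  rw [← flow_flow] at h2
  exact (NNReal.coe_le_coe.2 h2).trans (hT _ h1 T le_rfl)

theorem tendsto_surv (z : ℝ≥0) : Tendsto (M.surv z) atTop (𝓝 0) := by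
  obtain ⟨T, hT⟩ := M.exists_rateAt_eq_one
  have h1 : Tendsto (fun u : ℝ => Real.exp (-(u - (z + T)))) atTop (𝓝 0) :=
    Real.tendsto_exp_neg_atTop_nhds_zero.comp (tendsto_atTop_add_const_right _ _ tendsto_id)
  refine squeeze_zero' (Eventually.of_forall fun u => (M.surv_pos z u).le) ?_ h1
  filter_upwards [eventually_ge_atTop ((z : ℝ) + T)] with u hu
  exact M.surv_le_exp z (by positivity) hu (hT z)

theorem exists_lintegral_surv_le : ∃ T : ℝ≥0, ∀ z : ℝ≥0,
    ∫⁻ u in Ioi 0, ENNReal.ofReal (M.surv z u) ≤ z + T := by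
  obtain ⟨T, hT⟩ := M.exists_rateAt_eq_one
  refine ⟨T + 1, fun z => ?_⟩
  have h0 : (0 : ℝ) ≤ z + T := by positivity
  rw [← Ioc_union_Ioi_eq_Ioi h0, lintegral_union measurableSet_Ioi Ioc_disjoint_Ioi_same]
  have h1 : ∫⁻ u in Ioc 0 ((z : ℝ) + T), ENNReal.ofReal (M.surv z u) ≤ z + T := by
    calc _ ≤ ∫⁻ u in Ioc 0 ((z : ℝ) + T), 1 := by
          refine setLIntegral_mono measurable_const fun u hu => ?_
          rw [ENNReal.ofReal_le_one]
          exact M.surv_le_one z hu.1.le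
      _ = z + T := by
          rw [setLIntegral_one, Real.volume_Ioc, sub_zero, ENNReal.ofReal_add (NNReal.coe_nonneg z) (NNReal.coe_nonneg T)]
          simp
  have h2 : ∫⁻ u in Ioi ((z : ℝ) + T), ENNReal.ofReal (M.surv z u) ≤ 1 := by
    calc _ ≤ ∫⁻ u in Ioi ((z : ℝ) + T), ENNReal.ofReal (Real.exp (z + T)) *
          ENNReal.ofReal (Real.exp (-(1 * u))) := by
          refine setLIntegral_mono (by fun_prop) fun u hu => ?_
          rw [← ENNReal.ofReal_mul (Real.exp_pos _).le, ← Real.exp_add]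
          refine ENNReal.ofReal_le_ofReal ((M.surv_le_exp z h0 (mem_Ioi.1 hu).le (hT z)).trans_eq ?_)
          congr 1
          ring
      _ = 1 := by
          rw [lintegral_const_mul _ (by fun_prop), setLIntegral_exp_neg_mul one_pos,
            ← ENNReal.ofReal_mul (Real.exp_pos _).le, one_mul, div_one, ← Real.exp_add]
          simp
  refine (add_le_add h1 h2).trans (le_of_eq ?_)
  push_cast
  ring

/-- The integrand is the derivative of `-surv`, and `surv` falls from 1 to 0: a jump occurs almost
surely. -/
theorem lintegral_surv_mul_rateAt (z : ℝ≥0) :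
    ∫⁻ u in Ioi 0, ENNReal.ofReal (M.surv z u) * ENNReal.ofReal (M.rateAt z u) = 1 := by
  have hd : ∀ u ∈ Ioi (0 : ℝ), HasDerivAt (fun u => -M.surv z u) (M.surv z u * M.rateAt z u) u := by
    intro u _
    exact (M.hasDerivAt_surv z u).neg.congr_deriv (neg_neg _)
  have hc : ContinuousWithinAt (fun u => -M.surv z u) (Ici 0) 0 :=
    (M.continuous_surv z).neg.continuousWithinAt
  have hpos : ∀ u ∈ Ioi (0 : ℝ), 0 ≤ M.surv z u * M.rateAt z u :=
    fun u _ => mul_nonneg (M.surv_pos z u).le (M.rate_nonneg _)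
  have hlim : Tendsto (fun u => -M.surv z u) atTop (𝓝 0) := by
    simpa using (M.tendsto_surv z).neg
  have h1 := integral_Ioi_of_hasDerivAt_of_nonneg hc hd hpos hlim
  have h2 := integrableOn_Ioi_deriv_of_nonneg hc hd hpos hlim
  calc _ = ∫⁻ u in Ioi 0, ENNReal.ofReal (M.surv z u * M.rateAt z u) := by
        refine lintegral_congr fun u => ?_
        rw [ENNReal.ofReal_mul (M.surv_pos z u).le]
    _ = 1 := by
        rw [← ofReal_integral_eq_lintegral_ofReal h2, h1, surv_zero]
        · simp
        · exact (ae_restrict_iff' measurableSet_Ioi).2 (ae_of_all _ hpos)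

/-- Survival without a jump, decomposed at the last ring before `u`: either there is none, or it
falls at `r`, is rejected, and the clock is silent afterwards. Analytically this is the integrated
derivative of `surv · e^r`. -/
theorem surv_eq_integral (z : ℝ≥0) (u : ℝ) :
    M.surv z u = Real.exp (-u) + ∫ r in (0 : ℝ)..u, M.surv z r * (1 - M.rateAt z r) *
      Real.exp (-(u - r)) := by
  have hd : ∀ r ∈ uIcc 0 u, HasDerivAt (fun r => M.surv z r * Real.exp r)
      (M.surv z r * (1 - M.rateAt z r) * Real.exp r) r := by
    intro r _
    refine ((M.hasDerivAt_surv z r).mul (Real.hasDerivAt_exp r)).congr_deriv ?_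
    ring
  have hint : IntervalIntegrable (fun r => M.surv z r * (1 - M.rateAt z r) * Real.exp r) volume 0 u :=
    (((M.continuous_surv z).mul (continuous_const.sub (M.continuous_rateAt z))).mul
      Real.continuous_exp).intervalIntegrable _ _
  have h := intervalIntegral.integral_eq_sub_of_hasDerivAt hd hint
  have h2 : ∫ r in (0 : ℝ)..u, M.surv z r * (1 - M.rateAt z r) * Real.exp (-(u - r)) =
      Real.exp (-u) * ∫ r in (0 : ℝ)..u, M.surv z r * (1 - M.rateAt z r) * Real.exp r := by
    rw [← intervalIntegral.integral_const_mul]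
    refine intervalIntegral.integral_congr fun r _ => ?_
    rw [show -(u - r) = -u + r by ring, Real.exp_add]
    ring
  rw [h2, h, surv_zero, Real.exp_zero, one_mul, mul_sub, mul_one, ← mul_assoc, mul_comm (Real.exp (-u)),
    mul_assoc, ← Real.exp_add]
  simp

theorem ofReal_surv_eq (z : ℝ≥0) {u : ℝ} (hu : 0 ≤ u) :
    ENNReal.ofReal (M.surv z u) = ENNReal.ofReal (Real.exp (-u)) +
      ∫⁻ r in Ioc 0 u, ENNReal.ofReal (M.surv z r) * ENNReal.ofReal (1 - M.rateAt z r) *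
        ENNReal.ofReal (Real.exp (-(u - r))) := by
  have hpos : ∀ r, 0 ≤ M.surv z r * (1 - M.rateAt z r) * Real.exp (-(u - r)) := fun r =>
    mul_nonneg (mul_nonneg (M.surv_pos z r).le (sub_nonneg.2 (M.rate_le_one _))) (Real.exp_pos _).le
  have hint : IntegrableOn (fun r => M.surv z r * (1 - M.rateAt z r) * Real.exp (-(u - r)))
      (Ioc 0 u) := by
    refine Continuous.integrableOn_Ioc ?_
    exact ((M.continuous_surv z).mul (continuous_const.sub (M.continuous_rateAt z))).mul
      (by fun_prop)
  have h := M.surv_eq_integral z u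
  rw [intervalIntegral.integral_of_le hu] at h
  rw [h, ENNReal.ofReal_add (Real.exp_pos _).le (integral_nonneg hpos),
    ofReal_integral_eq_lintegral_ofReal hint (ae_of_all _ hpos)]
  congr 1
  refine lintegral_congr fun r => ?_
  rw [ENNReal.ofReal_mul (mul_nonneg (M.surv_pos z r).le (sub_nonneg.2 (M.rateAt_le_one z r))),
    ENNReal.ofReal_mul (M.surv_pos z r).le]

/-- The occupation measure before the first jump, split by the last rejected ring: it comes from a
fresh ring time started at `z` or at the place of a rejection. This supplies the relation from after
a ring to before a ring for `occ`. -/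
theorem ringOp_add_lintegral_surv {F : ℝ≥0 → ℝ≥0∞} (hF : Measurable F) (z : ℝ≥0) :
    M.ringOp F z + ∫⁻ r in Ioi 0, ENNReal.ofReal (M.surv z r) *
        (ENNReal.ofReal (1 - M.rateAt z r) * M.ringOp F (M.flow z r.toNNReal)) =
      ∫⁻ u in Ioi 0, ENNReal.ofReal (M.surv z u) * F (M.flow z u.toNNReal) := by
  have hsm : Measurable (M.surv z) := (M.continuous_surv z).measurable
  have hrm : Measurable (M.rateAt z) := (M.continuous_rateAt z).measurable
  set k : ℝ → ℝ → ℝ≥0∞ := fun r u => ENNReal.ofReal (M.surv z r) * ENNReal.ofReal (1 - M.rateAt z r) *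
    ENNReal.ofReal (Real.exp (-(u - r))) * F (M.flow z u.toNNReal) with hk
  have h1 : ∫⁻ r in Ioi 0, ENNReal.ofReal (M.surv z r) *
        (ENNReal.ofReal (1 - M.rateAt z r) * M.ringOp F (M.flow z r.toNNReal)) =
      ∫⁻ r in Ioi 0, ∫⁻ u in Ioi r, k r u := by
    refine setLIntegral_congr_fun measurableSet_Ioi fun r hr => ?_
    simp only [hk]
    rw [← setLIntegral_Ioi_add _ r, ← mul_assoc, ringOp, ← lintegral_const_mul _ (by fun_prop)]
    refine setLIntegral_congr_fun measurableSet_Ioi fun v hv => ?_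
    rw [M.flow_flow_toNNReal z (mem_Ioi.1 hr).le (mem_Ioi.1 hv).le, add_comm r v, add_sub_cancel_right,
      mul_assoc, mul_assoc, mul_assoc]
  have hset : MeasurableSet {q : ℝ × ℝ | 0 < q.1 ∧ q.1 < q.2} :=
    (measurableSet_lt measurable_const measurable_fst).inter
      (measurableSet_lt measurable_fst measurable_snd)
  have h2 : ∫⁻ r in Ioi 0, ∫⁻ u in Ioi r, k r u = ∫⁻ u in Ioi 0, ∫⁻ r in Ioo 0 u, k r u := by
    calc _ = ∫⁻ r, ∫⁻ u, {q : ℝ × ℝ | 0 < q.1 ∧ q.1 < q.2}.indicator (fun q => k q.1 q.2) (r, u) := by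
          rw [← lintegral_indicator measurableSet_Ioi]
          refine lintegral_congr fun r => ?_
          by_cases hr : 0 < r
          · rw [indicator_of_mem (mem_Ioi.2 hr), ← lintegral_indicator measurableSet_Ioi]
            refine lintegral_congr fun u => ?_
            simp [indicator, hr]
          · simp [indicator, hr]
      _ = ∫⁻ u, ∫⁻ r, {q : ℝ × ℝ | 0 < q.1 ∧ q.1 < q.2}.indicator (fun q => k q.1 q.2) (r, u) := by
          refine lintegral_lintegral_swap (Measurable.aemeasurable ?_)
          exact Measurable.indicator (by fun_prop) hset
      _ = _ := by
          rw [← lintegral_indicator measurableSet_Ioi]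
          refine lintegral_congr fun u => ?_
          by_cases hu : 0 < u
          · rw [indicator_of_mem (mem_Ioi.2 hu), ← lintegral_indicator measurableSet_Ioo]
            refine lintegral_congr fun r => ?_
            simp [indicator]
          · rw [indicator_of_notMem (by simpa using hu), lintegral_eq_zero_of_ae_eq_zero]
            refine ae_of_all _ fun r => indicator_of_notMem ?_ _
            exact fun h => hu (h.1.trans h.2)
  rw [h1, h2, ringOp, ← lintegral_add_left (by fun_prop)]
  refine setLIntegral_congr_fun measurableSet_Ioi fun u hu => ?_
  simp only [hk]
  rw [M.ofReal_surv_eq z (mem_Ioi.1 hu).le, add_mul, ← lintegral_mul_const _ (by fun_prop),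
    setLIntegral_congr Ioo_ae_eq_Ioc]

/-- The distribution of the point that the process jumps to. -/
noncomputable def jumpLaw : Measure ℝ≥0 := Measure.sum fun k => M.weight k • Measure.dirac (M.x k)

theorem lintegral_jumpLaw {F : ℝ≥0 → ℝ≥0∞} (hF : Measurable F) :
    ∫⁻ z, F z ∂M.jumpLaw = M.jumpMean F := by
  rw [jumpLaw, lintegral_sum_measure]
  refine tsum_congr fun k => ?_
  rw [lintegral_smul_measure, lintegral_dirac' _ hF, smul_eq_mul]

instance : IsProbabilityMeasure M.jumpLaw := by
  constructor
  rw [← lintegral_one, M.lintegral_jumpLaw measurable_const, jumpMean]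
  simpa using M.tsum_weight

/-- The mean occupation measure of the process between two jumps. -/
noncomputable def occ : Measure ℝ≥0 := Measure.sum fun k => M.weight k •
  ((volume.restrict (Ioi 0)).withDensity fun u => ENNReal.ofReal (M.surv (M.x k) u)).map
    fun u => M.flow (M.x k) u.toNNReal

theorem lintegral_occ {F : ℝ≥0 → ℝ≥0∞} (hF : Measurable F) :
    ∫⁻ z, F z ∂M.occ = ∑' k, M.weight k *
      ∫⁻ u in Ioi 0, ENNReal.ofReal (M.surv (M.x k) u) * F (M.flow (M.x k) u.toNNReal) := by
  rw [occ, lintegral_sum_measure]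
  refine tsum_congr fun k => ?_
  have hsm : Measurable (M.surv (M.x k)) := (M.continuous_surv _).measurable
  rw [lintegral_smul_measure, lintegral_map hF (by fun_prop),
    lintegral_withDensity_eq_lintegral_mul _ (by fun_prop) (by fun_prop), smul_eq_mul]
  rfl

/-- Each excursion ends with exactly one jump. -/
theorem lintegral_rate_occ : ∫⁻ z, ENNReal.ofReal (M.rate z) ∂M.occ = 1 := by
  rw [M.lintegral_occ (by fun_prop), ← M.tsum_weight]
  refine tsum_congr fun k => ?_
  have := M.lintegral_surv_mul_rateAt (M.x k)
  unfold rateAt at this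
  rw [this, mul_one]

/-- Along one excursion from `z` the weight integrates to at most a multiple of `e^{αz}`: the
exponentially decaying part contributes `e^{αz}/α`, and the time spent near the bottom has mean at
most `z + T`, itself dominated by `e^{αz}`. -/
theorem lintegral_expWeight_occ_ne_top {α : ℝ} (hα : 0 < α)
    (h : Summable fun k : ℕ => M.p ^ (k + 1) * Real.exp (α * M.x k)) :
    ∫⁻ z, expWeight α z ∂M.occ ≠ ∞ := by
  obtain ⟨T, hT⟩ := M.exists_lintegral_surv_le
  rw [M.lintegral_occ (by fun_prop)]
  set C : ℝ≥0∞ := ENNReal.ofReal (1 / α) +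
    ENNReal.ofReal (Real.exp α) * (ENNReal.ofReal (1 / α) + T) with hC
  have hCtop : C ≠ ∞ := by finiteness
  have hle : ∀ z : ℝ≥0, ∫⁻ u in Ioi 0, ENNReal.ofReal (M.surv z u) *
      expWeight α (M.flow z u.toNNReal) ≤ C * expWeight α z := by
    intro z
    have hsm : Measurable (M.surv z) := (M.continuous_surv _).measurable
    have hz : (z : ℝ≥0∞) ≤ ENNReal.ofReal (1 / α) * expWeight α z := by
      rw [expWeight, ← ENNReal.ofReal_mul (by positivity), ← ENNReal.ofReal_coe_nnreal]
      refine ENNReal.ofReal_le_ofReal ?_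
      rw [one_div, inv_mul_eq_div, le_div_iff₀ hα]
      have := Real.add_one_le_exp (α * z)
      linarith
    have h1 : (1 : ℝ≥0∞) ≤ expWeight α z := one_le_expWeight hα.le z
    calc _ ≤ ∫⁻ u in Ioi 0, (expWeight α z * ENNReal.ofReal (Real.exp (-(α * u))) +
          ENNReal.ofReal (Real.exp α) * ENNReal.ofReal (M.surv z u)) := by
          refine setLIntegral_mono (by fun_prop) fun u hu => ?_
          have h2 := M.expWeight_flow_le hα.le z u.toNNReal
          rw [Real.coe_toNNReal _ (mem_Ioi.1 hu).le, neg_mul] at h2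
          have h3 : ENNReal.ofReal (M.surv z u) ≤ 1 :=
            ENNReal.ofReal_le_one.2 (M.surv_le_one z (mem_Ioi.1 hu).le)
          refine (mul_le_mul_right h2 _).trans ?_
          rw [mul_add, mul_comm (ENNReal.ofReal (Real.exp α))]
          exact add_le_add (mul_le_of_le_one_left zero_le h3) le_rfl
      _ ≤ expWeight α z * ENNReal.ofReal (1 / α) +
          ENNReal.ofReal (Real.exp α) * (z + T) := by
          rw [lintegral_add_left (by fun_prop), lintegral_const_mul _ (by fun_prop),
            lintegral_const_mul _ (by fun_prop), setLIntegral_exp_neg_mul hα]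
          gcongr
          · simp
          · exact hT z
      _ ≤ expWeight α z * ENNReal.ofReal (1 / α) + ENNReal.ofReal (Real.exp α) *
          (ENNReal.ofReal (1 / α) * expWeight α z + T * expWeight α z) := by
          gcongr
          exact le_mul_of_one_le_right zero_le h1
      _ = _ := by rw [hC]; ring
  refine ne_top_of_le_ne_top (ENNReal.mul_ne_top hCtop (M.jumpMean_expWeight_ne_top h)) ?_
  rw [jumpMean, ← ENNReal.tsum_mul_left]
  refine ENNReal.tsum_le_tsum fun k => ?_
  calc _ ≤ M.weight k * (C * expWeight α (M.x k)) := by gcongr; exact hle _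
    _ = _ := by ring

theorem isFiniteMeasure_occ {α : ℝ} (hα : 0 < α)
    (h : Summable fun k : ℕ => M.p ^ (k + 1) * Real.exp (α * M.x k)) : IsFiniteMeasure M.occ := by
  constructor
  rw [← lintegral_one]
  exact (lintegral_mono (one_le_expWeight hα.le)).trans_lt
    (M.lintegral_expWeight_occ_ne_top hα h).lt_top

theorem isInvariant_occ [IsFiniteMeasure M.occ] : IsInvariant M.transition M.occ := by
  have hd : Measurable fun z => ENNReal.ofReal (1 - M.rate z) := by fun_prop
  have hfin : IsFiniteMeasure (M.occ.withDensity fun z => ENNReal.ofReal (1 - M.rate z)) := by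
    refine isFiniteMeasure_withDensity (ne_top_of_le_ne_top (measure_ne_top M.occ univ) ?_)
    rw [← lintegral_one]
    refine lintegral_mono fun z => ?_
    rw [ENNReal.ofReal_le_one]
    linarith [M.rate_nonneg z]
  -- The measure after a ring consists of accepted jumps, distributed as `jumpLaw` with mass 1, and
  -- of rejected rings, which leave the state in place.
  refine M.isInvariant_of_ringOp_jump
    (ν := M.jumpLaw + M.occ.withDensity fun z => ENNReal.ofReal (1 - M.rate z)) ?_ ?_
  · intro F hF
    rw [lintegral_add_measure, M.lintegral_jumpLaw (by fun_prop),
      lintegral_withDensity_eq_lintegral_mul _ hd (by fun_prop), M.lintegral_occ hF,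
      M.lintegral_occ (F := (fun z => ENNReal.ofReal (1 - M.rate z)) * M.ringOp F)
        (hd.mul (by fun_prop)), jumpMean, ← ENNReal.tsum_add]
    refine tsum_congr fun k => ?_
    rw [← M.ringOp_add_lintegral_surv hF, mul_add]
    rfl
  · intro F hF
    rw [lintegral_add_measure, M.lintegral_jumpLaw hF,
      lintegral_withDensity_eq_lintegral_mul _ hd hF]
    unfold jump
    rw [lintegral_add_left (by fun_prop), lintegral_mul_const _ (by fun_prop), M.lintegral_rate_occ,
      one_mul]
    rfl

/-- The stationary distribution. -/
noncomputable def statLaw : Measure ℝ≥0 := (M.occ univ)⁻¹ • M.occ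

theorem occ_univ_ne_zero : M.occ univ ≠ 0 := by
  intro h
  have h1 := M.lintegral_rate_occ
  rw [Measure.measure_univ_eq_zero.1 h, lintegral_zero_measure] at h1
  exact zero_ne_one h1

theorem isProbabilityMeasure_statLaw [IsFiniteMeasure M.occ] : IsProbabilityMeasure M.statLaw := by
  constructor
  rw [statLaw, Measure.smul_apply, smul_eq_mul]
  exact ENNReal.inv_mul_cancel M.occ_univ_ne_zero (measure_ne_top _ _)

theorem isInvariant_statLaw [IsFiniteMeasure M.occ] : IsInvariant M.transition M.statLaw := by
  intro t B hB
  rw [statLaw, lintegral_smul_measure, M.isInvariant_occ t B hB, Measure.smul_apply]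

theorem lintegral_expWeight_statLaw_ne_top {α : ℝ} (hα : 0 < α)
    (h : Summable fun k : ℕ => M.p ^ (k + 1) * Real.exp (α * M.x k)) :
    ∫⁻ z, expWeight α z ∂M.statLaw ≠ ∞ := by
  rw [statLaw, lintegral_smul_measure, smul_eq_mul]
  exact ENNReal.mul_ne_top (ENNReal.inv_ne_top.2 M.occ_univ_ne_zero)
    (M.lintegral_expWeight_occ_ne_top hα h)

end Model
namespace Model

variable (M : Model)

/-! ### Exponential coupling and uniqueness of the stationary distribution -/

theorem isCadlag_path {ω : ℕ → ℝ × I × ℕ} (hω : NonExplosive ω) (y : ℝ≥0) :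
    IsCadlag (M.path y ω) := by
  have hcont : ∀ n, Continuous fun t : ℝ≥0 => M.flow (M.ringState y ω n) (t - ringTime ω n) :=
    fun n => (M.continuous_flow_right _).comp (continuous_id.sub continuous_const)
  intro t
  constructor
  · set n := ringCount ω t
    refine ((hcont n).continuousWithinAt (s := Ici t) (x := t)).congr_of_eventuallyEq ?_ rfl
    filter_upwards [Ico_mem_nhdsGE (lt_ringTime_ringCount hω t)] with s hs
    exact M.path_eq hω y ((ringTime_ringCount_le ω t).trans hs.1) hs.2
  · rcases eq_or_lt_of_le (show 0 ≤ t from t.2) with h0 | h0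
    · refine ⟨0, ?_⟩
      have : Iio t = ∅ := by
        rw [← h0]
        ext s
        simp
      rw [this, nhdsWithin_empty]
      exact tendsto_bot
    · classical
      -- For the left limit the comparison is not strict, unlike in `ringCount`: if `t` is itself a
      -- ring time, the segment ending at `t` is wanted.
      have hex : ∃ n, t ≤ ringTime ω (n + 1) := (hω t).imp fun n hn => hn.le
      set n := Nat.find hex with hn
      have h1 : t ≤ ringTime ω (n + 1) := Nat.find_spec hex
      have h2 : ringTime ω n < t := by
        rcases Nat.eq_zero_or_pos n with h | h
        · rwa [h, ringTime_zero]
        · obtain ⟨k, hk⟩ := Nat.exists_eq_succ_of_ne_zero h.ne'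
          rw [hk]
          exact not_le.1 (Nat.find_min hex (m := k) (by omega))
      refine ⟨_, (((hcont n).tendsto t).mono_left nhdsWithin_le_nhds).congr' ?_⟩
      filter_upwards [Ioo_mem_nhdsLT h2] with s hs
      exact (M.path_eq hω y hs.1.le (hs.2.trans_le h1)).symm

theorem measurable_path_pi {Ω : Type*} [MeasurableSpace Ω] {f : Ω → ℝ≥0}
    {g : Ω → ℕ → ℝ × I × ℕ} (hf : Measurable f) (hg : Measurable g) :
    Measurable fun ω => M.path (f ω) (g ω) :=
  measurable_pi_lambda _ fun _ => M.measurable_path hf hg measurable_const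

theorem isCoupling_synchronous (x : ℝ≥0) (π : Measure ℝ≥0) [IsProbabilityMeasure π] :
    IsCoupling M.pathLaw (Measure.dirac x) π (π.prod M.seedLaw)
      (fun t ω => M.path x ω.2 t) (fun t ω => M.path ω.1 ω.2 t) where
  isProbabilityMeasure := inferInstance
  measurable_fst _ := by fun_prop
  measurable_snd t := by fun_prop
  cadlag := by
    filter_upwards [Measure.quasiMeasurePreserving_snd.ae M.ae_nonExplosive] with ω hω
    exact ⟨M.isCadlag_path hω _, M.isCadlag_path hω _⟩
  law_fst := by
    have h1 : Measurable (M.path x) := M.measurable_path_pi measurable_const measurable_id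
    have h2 : Measurable fun z : ℝ≥0 × (ℕ → ℝ × I × ℕ) => M.path z.1 z.2 :=
      M.measurable_path_pi measurable_fst measurable_snd
    rw [pathLaw, Measure.dirac_prod, Measure.map_map h2 measurable_prodMk_left]
    change (π.prod M.seedLaw).map (M.path x ∘ Prod.snd) = M.seedLaw.map (M.path x)
    rw [← Measure.map_map h1 measurable_snd, Measure.map_snd_prod]
    simp
  law_snd := rfl

theorem admitsExpCoupling {α : ℝ} (hα : 0 < α)
    (h : Summable fun k : ℕ => M.p ^ (k + 1) * Real.exp (α * M.x k)) :
    AdmitsExpCoupling M.transition M.pathLaw fun y => Real.exp (α * y) := by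
  have := M.isFiniteMeasure_occ hα h
  have := M.isProbabilityMeasure_statLaw
  obtain ⟨C, β, hC, hβ, hcoup⟩ := M.exists_coupling_bound hα h
  set m := (∫⁻ z, expWeight α z ∂M.statLaw).toReal with hm
  have hmm : ∫⁻ z, expWeight α z ∂M.statLaw = ENNReal.ofReal m :=
    (ENNReal.ofReal_toReal (M.lintegral_expWeight_statLaw_ne_top hα h)).symm
  have hm0 : 0 ≤ m := ENNReal.toReal_nonneg
  refine ⟨M.statLaw, inferInstance, M.isInvariant_statLaw, C * (1 + m), β, by positivity, hβ,
    fun x => ⟨ℝ≥0 × (ℕ → ℝ × I × ℕ), inferInstance, M.statLaw.prod M.seedLaw, _, _,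
      M.isCoupling_synchronous x M.statLaw, fun t => ?_⟩⟩
  have hms : MeasurableSet {ω : ℝ≥0 × (ℕ → ℝ × I × ℕ) | M.path x ω.2 t ≠ M.path ω.1 ω.2 t} :=
    (measurableSet_eq_fun (f := fun ω : ℝ≥0 × (ℕ → ℝ × I × ℕ) => M.path x ω.2 t)
      (g := fun ω : ℝ≥0 × (ℕ → ℝ × I × ℕ) => M.path ω.1 ω.2 t) (by fun_prop) (by fun_prop)).compl
  have hle : ∫⁻ ω in {ω : ℝ≥0 × (ℕ → ℝ × I × ℕ) | M.path x ω.2 t ≠ M.path ω.1 ω.2 t},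
      ENNReal.ofReal (Real.exp (α * M.path x ω.2 t) + Real.exp (α * M.path ω.1 ω.2 t))
        ∂(M.statLaw.prod M.seedLaw) ≤
      ∫⁻ y, ENNReal.ofReal (C * Real.exp (-β * t)) * (expWeight α x + expWeight α y)
        ∂M.statLaw := by
    rw [← lintegral_indicator hms, lintegral_prod _ (by
      exact (Measurable.indicator (by fun_prop) hms).aemeasurable)]
    refine lintegral_mono fun y => ?_
    refine le_trans (le_of_eq ?_) (hcoup x y t)
    have hms' : MeasurableSet {ω | M.path x ω t ≠ M.path y ω t} :=
      (measurableSet_eq_fun (f := fun ω => M.path x ω t) (g := fun ω => M.path y ω t)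
        (by fun_prop) (by fun_prop)).compl
    rw [← lintegral_indicator hms']
    refine lintegral_congr fun ω => ?_
    simp only [indicator, mem_ofPred_eq, expWeight]
    rw [ENNReal.ofReal_add (Real.exp_pos _).le (Real.exp_pos _).le]
    split_ifs <;> rfl
  refine hle.trans ?_
  rw [lintegral_const_mul _ (by fun_prop), lintegral_add_left measurable_const, lintegral_const,
    measure_univ, mul_one, hmm, expWeight, ← ENNReal.ofReal_add (Real.exp_pos _).le hm0,
    ← ENNReal.ofReal_mul (by positivity)]
  refine ENNReal.ofReal_le_ofReal ?_
  have h1 : 1 ≤ Real.exp (α * x) := Real.one_le_exp (by positivity)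
  -- Averaging the second starting point over the stationary law leaves the constant `m`, absorbed
  -- because the weight is at least 1.
  have h2 : Real.exp (α * x) + m ≤ (1 + m) * Real.exp (α * x) := by nlinarith
  calc _ ≤ C * Real.exp (-β * t) * ((1 + m) * Real.exp (α * x)) := by gcongr
    _ = _ := by ring

theorem exists_measure_path_ne_le {α : ℝ} (hα : 0 < α)
    (h : Summable fun k : ℕ => M.p ^ (k + 1) * Real.exp (α * M.x k)) :
    ∃ C β : ℝ, 0 < C ∧ 0 < β ∧ ∀ y z t : ℝ≥0,
      M.seedLaw {ω | M.path y ω t ≠ M.path z ω t} ≤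
        ENNReal.ofReal (C * Real.exp (-β * t)) * (expWeight α y + expWeight α z) := by
  obtain ⟨C, β, hC, hβ, hcoup⟩ := M.exists_coupling_bound hα h
  refine ⟨C, β, hC, hβ, fun y z t => le_trans ?_ (hcoup y z t)⟩
  rw [← setLIntegral_one]
  exact lintegral_mono fun ω => (one_le_expWeight hα.le _).trans le_self_add

/-- The coupling bounds `P_t(x, B)` by the stationary mass of `B` plus an error tending to zero for
each `x`. Nothing is known about exponential moments of `π'`, so the error is cut off at 1 and
dominated convergence is used. The result `π' ≤ statLaw` is an equality, both being probability
measures. -/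
theorem eq_of_isInvariant {α : ℝ} (hα : 0 < α)
    (h : Summable fun k : ℕ => M.p ^ (k + 1) * Real.exp (α * M.x k)) {π' : Measure ℝ≥0}
    [IsProbabilityMeasure π'] (hπ' : IsInvariant M.transition π') : π' = M.statLaw := by
  have := M.isFiniteMeasure_occ hα h
  have := M.isProbabilityMeasure_statLaw
  obtain ⟨C, β, hC, hβ, hne⟩ := M.exists_measure_path_ne_le hα h
  set m := ∫⁻ z, expWeight α z ∂M.statLaw with hm
  have hmtop : m ≠ ∞ := M.lintegral_expWeight_statLaw_ne_top hα h
  set e : ℝ≥0 → ℝ≥0 → ℝ≥0∞ := fun t x =>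
    min 1 (ENNReal.ofReal (C * Real.exp (-β * t)) * (expWeight α x + m)) with he
  have hbound : ∀ t x B, MeasurableSet B → M.transition t x B ≤ M.statLaw B + e t x := by
    intro t x B hB
    have h1 : M.transition t x B ≤ M.statLaw B +
        ENNReal.ofReal (C * Real.exp (-β * t)) * (expWeight α x + m) := by
      calc M.transition t x B = ∫⁻ y, M.transition t x B ∂M.statLaw := by simp
        _ ≤ ∫⁻ y, (M.transition t y B +
            ENNReal.ofReal (C * Real.exp (-β * t)) * (expWeight α x + expWeight α y))
              ∂M.statLaw := by
            refine lintegral_mono fun y => ?_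
            refine le_trans ?_ (add_le_add_right (hne x y t) _)
            rw [transition, transition, Measure.map_apply (by fun_prop) hB,
              Measure.map_apply (by fun_prop) hB]
            refine (measure_mono fun ω hω => ?_).trans (measure_union_le _ _)
            by_cases hxy : M.path x ω t = M.path y ω t
            · left
              simpa [← hxy] using hω
            · exact Or.inr hxy
        _ = _ := by
            have hmeas : Measurable fun y => M.transition t y B := (M.transKernel t).measurable_coe hB
            rw [lintegral_add_left hmeas, M.isInvariant_statLaw t B hB,
              lintegral_const_mul _ (by fun_prop), lintegral_add_left measurable_const]
            simp [hm]
    rw [he, ← min_add_add_left]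
    exact le_min (prob_le_one.trans le_add_self) h1
  have hlim : Tendsto (fun n : ℕ => ∫⁻ x, e n x ∂π') atTop (𝓝 0) := by
    have h0 : ∫⁻ _ : ℝ≥0, (0 : ℝ≥0∞) ∂π' = 0 := lintegral_zero
    rw [← h0]
    refine tendsto_lintegral_of_dominated_convergence (fun _ => 1) (fun n => by fun_prop)
      (fun n => ae_of_all _ fun x => min_le_left _ _) (by simp) (ae_of_all _ fun x => ?_)
    have hexp : Tendsto (fun n : ℕ => C * Real.exp (-β * ((n : ℝ≥0) : ℝ))) atTop (𝓝 0) := by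
      rw [← mul_zero C]
      refine Tendsto.const_mul C (Real.tendsto_exp_atBot.comp ?_)
      simp only [NNReal.coe_natCast, neg_mul]
      exact tendsto_neg_atTop_atBot.comp (tendsto_natCast_atTop_atTop.const_mul_atTop hβ)
    have h2 : Tendsto (fun n : ℕ => ENNReal.ofReal (C * Real.exp (-β * ((n : ℝ≥0) : ℝ))) *
        (expWeight α x + m)) atTop (𝓝 0) := by
      have := ENNReal.Tendsto.mul_const (b := expWeight α x + m) (ENNReal.tendsto_ofReal hexp)
        (Or.inr (ENNReal.add_ne_top.2 ⟨expWeight_ne_top _ _, hmtop⟩))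
      simpa using this
    have h3 := (tendsto_const_nhds (x := (1 : ℝ≥0∞))).min h2
    simpa [he] using h3
  have hle : π' ≤ M.statLaw := by
    refine Measure.le_iff.2 fun B hB => ?_
    have h1 : ∀ n : ℕ, π' B ≤ M.statLaw B + ∫⁻ x, e n x ∂π' := by
      intro n
      rw [← hπ' n B hB]
      refine (lintegral_mono fun x => hbound n x B hB).trans ?_
      rw [lintegral_add_left measurable_const]
      simp
    have h2 := hlim.const_add (M.statLaw B)
    rw [add_zero] at h2
    exact ge_of_tendsto' h2 h1
  exact Measure.eq_of_le_of_measure_univ_eq hle (by simp)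

theorem exists_summable_of_boundedGaps (h : M.BoundedGaps) :
    ∃ G : ℝ≥0, 0 < G ∧ (∀ k j, (M.x (k + j) : ℝ) ≤ M.x k + G * j) ∧ ∃ α : ℝ, 0 < α ∧
      Summable fun k : ℕ => M.p ^ (k + 1) * Real.exp (α * M.x k) := by
  obtain ⟨G₀, hG₀⟩ := h
  set G : ℝ≥0 := max 1 G₀.toNNReal with hG
  have hG1 : (1 : ℝ≥0) ≤ G := le_max_left _ _
  have hGpos : 0 < G := zero_lt_one.trans_le hG1
  have hgap : ∀ k, (M.x (k + 1) : ℝ) - M.x k ≤ G := fun k =>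
    (hG₀ ⟨k, rfl⟩).trans ((Real.le_coe_toNNReal _).trans (NNReal.coe_le_coe.2 (le_max_right _ _)))
  have hlin : ∀ k j, (M.x (k + j) : ℝ) ≤ M.x k + G * j := by
    intro k j
    induction j with
    | zero => simp
    | succ j ih =>
      have := hgap (k + j)
      rw [← add_assoc]
      push_cast
      linarith
  refine ⟨G, hGpos, hlin, ?_⟩
  have hlog : Real.log M.p < 0 := Real.log_neg M.p_pos M.p_lt_one
  have hGr : (0 : ℝ) < G := by exact_mod_cast hGpos
  refine ⟨-Real.log M.p / (2 * G), by apply div_pos (by linarith) (by positivity), ?_⟩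
  -- Then `e^{αG} = p^{-1/2}`, so the terms of the series are dominated by a multiple of `p^{k/2}`.
  set α := -Real.log M.p / (2 * G) with hα
  have hαpos : 0 < α := div_pos (by linarith) (by positivity)
  have hαG : α * G = -Real.log M.p / 2 := by rw [hα]; field_simp
  set q := Real.exp (Real.log M.p / 2) with hq
  have hq1 : q < 1 := Real.exp_lt_one_iff.2 (by linarith)
  refine Summable.of_nonneg_of_le (fun k => by have := M.p_pos; positivity) (fun k => ?_)
    ((summable_geometric_of_lt_one (Real.exp_pos _).le hq1).mul_left (Real.exp (α * M.x 0)))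
  have hpk : M.p ^ (k + 1) ≤ Real.exp (Real.log M.p * k) := by
    rw [mul_comm, Real.exp_nat_mul, Real.exp_log M.p_pos]
    exact pow_le_pow_of_le_one M.p_pos.le M.p_lt_one.le (Nat.le_succ k)
  have hxk : Real.exp (α * M.x k) ≤ Real.exp (α * M.x 0 + -Real.log M.p / 2 * k) := by
    rw [Real.exp_le_exp, ← hαG]
    have := hlin 0 k
    rw [zero_add] at this
    nlinarith
  calc _ ≤ Real.exp (Real.log M.p * k) * Real.exp (α * M.x 0 + -Real.log M.p / 2 * k) := by gcongr
    _ = Real.exp (α * M.x 0) * q ^ k := by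
      rw [hq, ← Real.exp_nat_mul, ← Real.exp_add, ← Real.exp_add]
      congr 1
      ring

end Model
-- Hölder's inequality with exponents `r/(r-1)` and `r`, applied to the indicator of `A` and `k`.
-- With `A` the event that two copies differ, it turns a small probability into decay.
theorem setLIntegral_rpow_le {Ω : Type*} [MeasurableSpace Ω] (μ : Measure Ω) {r : ℝ} (hr : 1 < r)
    {k : Ω → ℝ≥0∞} (hk : AEMeasurable k μ) {A : Set Ω} (hA : MeasurableSet A) :
    (∫⁻ ω in A, k ω ∂μ) ^ r ≤ μ A ^ (r - 1) * ∫⁻ ω, k ω ^ r ∂μ := by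
  have hr0 : 0 < r := by linarith
  have hr1 : 0 < r - 1 := by linarith
  have hpq : (r / (r - 1)).HolderConjugate r := (Real.HolderConjugate.conjExponent hr).symm
  have h := ENNReal.lintegral_mul_le_Lp_mul_Lq μ hpq
    (f := A.indicator fun _ => 1) (g := k) (aemeasurable_const.indicator hA) hk
  have h1 : ∫⁻ ω in A, k ω ∂μ = ∫⁻ ω, (A.indicator (fun _ => (1 : ℝ≥0∞)) * k) ω ∂μ := by
    rw [← lintegral_indicator hA]
    refine lintegral_congr fun ω => ?_
    by_cases hω : ω ∈ A <;> simp [hω]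
  have h2 : ∫⁻ ω, (A.indicator (fun _ => (1 : ℝ≥0∞)) ω) ^ (r / (r - 1)) ∂μ = μ A := by
    rw [← lintegral_indicator_one hA]
    refine lintegral_congr fun ω => ?_
    by_cases hω : ω ∈ A
    · simp [hω]
    · simp [hω, div_pos hr0 hr1]
  rw [h1]
  refine (ENNReal.rpow_le_rpow h hr0.le).trans (le_of_eq ?_)
  rw [h2, ENNReal.mul_rpow_of_nonneg _ _ hr0.le, ← ENNReal.rpow_mul, ← ENNReal.rpow_mul]
  congr 2
  · field_simp
  · rw [one_div, inv_mul_cancel₀ hr0.ne', ENNReal.rpow_one]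

namespace Model

variable (M : Model)

/-! ### Growth bounds for the semigroup -/

theorem jump_of_one_le {z : ℝ≥0} (hz : 1 ≤ z) (H : ℝ≥0 → ℝ≥0∞) : M.jump H z = H z := by
  simp [jump, M.rate_eq_zero hz]

theorem transOp_eq_of_one_add_le {F : ℝ≥0 → ℝ≥0∞} (hF : Measurable F) {s t x : ℝ≥0} (hst : s ≤ t)
    (hx : 1 + s ≤ x) :
    M.transOp F t x = (∫⁻ u in Ioc 0 (s : ℝ), ENNReal.ofReal (Real.exp (-u)) *
        M.transOp F (t - u.toNNReal) (M.flow x u.toNNReal)) +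
      ENNReal.ofReal (Real.exp (-s)) * M.transOp F (t - s) (M.flow x s) := by
  have hst' : (s : ℝ) ≤ t := by exact_mod_cast hst
  have hJ : Measurable fun q : ℝ≥0 × ℝ≥0 => M.jump (M.transOp F q.1) q.2 := by
    unfold jump jumpMean
    fun_prop
  rw [M.transOp_first_ring hF t x, ← Ioc_union_Ioc_eq_Ioc (NNReal.coe_nonneg s) hst',
    lintegral_union measurableSet_Ioc (Ioc_disjoint_Ioc_of_le le_rfl), add_left_comm]
  congr 1
  · refine setLIntegral_congr_fun measurableSet_Ioc fun u hu => ?_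
    rw [M.jump_of_one_le]
    rw [← NNReal.coe_le_coe]
    have h1 := M.sub_le_flow x u.toNNReal
    rw [Real.coe_toNNReal _ hu.1.le] at h1
    have h2 : (1 : ℝ) + s ≤ x := by exact_mod_cast hx
    have := hu.2
    push_cast
    linarith
  · rw [M.transOp_first_ring hF (t - s), mul_add, ← mul_assoc,
      ← ENNReal.ofReal_mul (Real.exp_pos _).le, ← Real.exp_add, flow_flow, add_tsub_cancel_of_le hst]
    congr 1
    · rw [NNReal.coe_sub hst]
      congr 3
      ring
    · rw [← lintegral_const_mul _ (by
        refine Measurable.mul (by fun_prop) ?_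
        exact hJ.comp (f := fun u : ℝ => (t - s - u.toNNReal, M.flow (M.flow x s) u.toNNReal))
          (by fun_prop)), ← lintegral_indicator measurableSet_Ioc, ← lintegral_indicator measurableSet_Ioc,
        ← lintegral_add_right_eq_self _ (s : ℝ)]
      refine lintegral_congr fun u => ?_
      have hmem : u + s ∈ Ioc (s : ℝ) t ↔ u ∈ Ioc (0 : ℝ) (t - s : ℝ≥0) := by
        rw [NNReal.coe_sub hst]
        constructor
        · exact fun h => ⟨by linarith [h.1], by linarith [h.2]⟩
        · exact fun h => ⟨by linarith [h.1], by linarith [h.2]⟩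
      by_cases hu : u ∈ Ioc (0 : ℝ) (t - s : ℝ≥0)
      · rw [indicator_of_mem hu, indicator_of_mem (hmem.2 hu), ← mul_assoc,
          ← ENNReal.ofReal_mul (Real.exp_pos _).le, ← Real.exp_add, flow_flow,
          Real.toNNReal_add hu.1.le (NNReal.coe_nonneg s), Real.toNNReal_coe, tsub_tsub,
          add_comm s u.toNNReal, neg_add_rev]
      · rw [indicator_of_notMem hu, indicator_of_notMem (fun h => hu (hmem.1 h))]

theorem setLIntegral_exp_neg_Ioc (s : ℝ≥0) :
    ∫⁻ u in Ioc 0 (s : ℝ), ENNReal.ofReal (Real.exp (-u)) = ENNReal.ofReal (1 - Real.exp (-s)) := by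
  rw [← ofReal_integral_eq_lintegral_ofReal, ← intervalIntegral.integral_of_le (NNReal.coe_nonneg s)]
  · congr 1
    rw [intervalIntegral.integral_comp_neg (fun u => Real.exp u), integral_exp]
    simp
  · exact Continuous.integrableOn_Ioc (by fun_prop)
  · exact ae_of_all _ fun u => (Real.exp_pos _).le

/-- Above level 1 every ring is void, so the process only moves down. In the renewal equation a ring
at `u ≤ s` reproduces the same comparison with `s - u`, with total weight `1 - e^{-s}`; each
iteration multiplies the error by at most `1 - e^{-S}`. A fixed `S` keeps this factor constant while
`s` decreases. -/
theorem transOp_le_of_one_add_le_aux {F : ℝ≥0 → ℝ≥0∞} (hF : Measurable F) (hF1 : ∀ z, F z ≤ 1)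
    (S : ℝ≥0) (n : ℕ) : ∀ s t x : ℝ≥0, s ≤ S → s ≤ t → 1 + s ≤ x →
    M.transOp F t x ≤ M.transOp F (t - s) (M.flow x s) +
      ENNReal.ofReal (1 - Real.exp (-S)) ^ n := by
  induction n with
  | zero =>
    intro s t x _ _ _
    rw [pow_zero]
    exact (M.transOp_le_one hF1 t x).trans le_add_self
  | succ n ih =>
    intro s t x hsS hst hx
    set c := M.transOp F (t - s) (M.flow x s) with hc
    set ε := ENNReal.ofReal (1 - Real.exp (-S)) ^ n with hε
    have h1 : ∀ u ∈ Ioc (0 : ℝ) s, ENNReal.ofReal (Real.exp (-u)) *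
        M.transOp F (t - u.toNNReal) (M.flow x u.toNNReal) ≤
        ENNReal.ofReal (Real.exp (-u)) * (c + ε) := by
      intro u hu
      gcongr
      set w := u.toNNReal with hw
      have hws : w ≤ s := Real.toNNReal_le_iff_le_coe.2 hu.2
      have h2 := ih (s - w) (t - w) (M.flow x w) (tsub_le_self.trans hsS) (tsub_le_tsub_right hst _) (by
        rw [M.flow_eq_sub ((add_le_add_right hws 1).trans hx)]
        refine le_tsub_of_add_le_right ?_
        rw [add_assoc, tsub_add_cancel_of_le hws]
        exact hx)
      rwa [flow_flow, add_tsub_cancel_of_le hws, tsub_tsub, add_tsub_cancel_of_le hws] at h2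
    rw [M.transOp_eq_of_one_add_le hF hst hx]
    have hsum : ENNReal.ofReal (1 - Real.exp (-s)) + ENNReal.ofReal (Real.exp (-s)) = 1 := by
      rw [← ENNReal.ofReal_add (by simp) (Real.exp_pos _).le]
      simp
    calc _ ≤ ENNReal.ofReal (1 - Real.exp (-s)) * (c + ε) + ENNReal.ofReal (Real.exp (-s)) * c := by
          gcongr
          refine (setLIntegral_mono (by fun_prop) h1).trans_eq ?_
          rw [lintegral_mul_const _ (by fun_prop), setLIntegral_exp_neg_Ioc]
      _ = (ENNReal.ofReal (1 - Real.exp (-s)) + ENNReal.ofReal (Real.exp (-s))) * c +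
          ENNReal.ofReal (1 - Real.exp (-s)) * ε := by ring
      _ ≤ c + ENNReal.ofReal (1 - Real.exp (-S)) ^ (n + 1) := by
          rw [hsum, one_mul, pow_succ']
          gcongr

theorem transOp_le_of_one_add_le {F : ℝ≥0 → ℝ≥0∞} {s t x : ℝ≥0}
    (hst : s ≤ t) (hx : 1 + s ≤ x) :
    M.transOp F t x ≤ M.transOp F (t - s) (M.flow x s) := by
  -- The iteration requires `F ≤ 1`, so it is applied to indicators; comparing the transition
  -- measures then covers every `F`.
  refine lintegral_mono' (Measure.le_iff.2 fun B hB => ?_) le_rfl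
  rw [← M.transOp_indicator_one hB, ← M.transOp_indicator_one hB]
  have hF : Measurable (B.indicator (1 : ℝ≥0 → ℝ≥0∞)) := measurable_one.indicator hB
  have h := fun n => M.transOp_le_of_one_add_le_aux hF
    (fun z => indicator_le_self' (by simp) z) s n s t x le_rfl hst hx
  have hlt : ENNReal.ofReal (1 - Real.exp (-s)) < 1 := by
    rw [ENNReal.ofReal_lt_one]
    linarith [Real.exp_pos (-(s : ℝ))]
  have hlim := (ENNReal.tendsto_pow_atTop_nhds_zero_of_lt_one hlt).const_add
    (M.transOp (B.indicator 1) (t - s) (M.flow x s))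
  rw [add_zero] at hlim
  exact ge_of_tendsto' hlim h

theorem weight_add (j n : ℕ) : M.weight (j + n) = ENNReal.ofReal (M.p ^ n) * M.weight j := by
  rw [weight, weight, ← ENNReal.ofReal_mul (pow_nonneg M.p_pos.le n), pow_add]
  congr 1
  ring

/-- Above `1 + s` the excursion from `x (j + n)`, lowered by `s`, runs along the excursion from `x
j` with the time delayed by `d = x j + s - x (j + n) ≥ 0`. In that region survival is certain, so
its occupation measure is dominated by that of the lower excursion, and the weights differ by the
factor `p ^ n`. -/
theorem setLIntegral_flow_occ_le {G : ℝ≥0} (hG : ∀ k j, (M.x (k + j) : ℝ) ≤ M.x k + G * j)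
    {h : ℝ≥0 → ℝ≥0∞} (hh : Measurable h) {s : ℝ≥0} {n : ℕ} (hs : M.x 0 + G * n ≤ s) :
    ∫⁻ z in Ici (1 + s), h (M.flow z s) ∂M.occ ≤ ENNReal.ofReal (M.p ^ n) * ∫⁻ z, h z ∂M.occ := by
  have hs' : (M.x 0 : ℝ) + G * n ≤ s := by exact_mod_cast hs
  rw [← lintegral_indicator measurableSet_Ici,
    M.lintegral_occ (Measurable.indicator (by fun_prop) measurableSet_Ici), M.lintegral_occ hh]
  set a : ℕ → ℝ≥0∞ := fun k => M.weight k * ∫⁻ u in Ioi 0, ENNReal.ofReal (M.surv (M.x k) u) *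
    (Ici (1 + s)).indicator (fun z => h (M.flow z s)) (M.flow (M.x k) u.toNNReal) with ha
  have hmem : ∀ k (u : ℝ), 0 < u → M.flow (M.x k) u.toNNReal ∈ Ici (1 + s) →
      u ≤ (M.x k : ℝ) - 1 - s := by
    intro k u hu hk
    have h1 : (1 : ℝ) + s ≤ M.flow (M.x k) u.toNNReal := by exact_mod_cast mem_Ici.1 hk
    have h2 := M.flow_eq_sub_of_one_le_flow (le_self_add.trans (mem_Ici.1 hk))
    rw [h2, Real.coe_toNNReal _ hu.le] at h1
    linarith
  -- The first `n` excursions start at most at `x 0 + G n ≤ s`, so they never reach `1 + s`.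
  have hzero : ∀ k < n, a k = 0 := by
    intro k hk
    simp only [ha]
    rw [setLIntegral_congr_fun (g := fun _ => 0) measurableSet_Ioi, lintegral_zero, mul_zero]
    intro u hu
    have hu0 : 0 < u := hu
    simp only
    rw [indicator_of_notMem, mul_zero]
    intro hk'
    have h1 := hmem k u hu0 hk'
    have h2 := hG 0 k
    rw [zero_add] at h2
    have h3 : (G : ℝ) * k ≤ G * n := by gcongr
    linarith
  have hshift : ∑' k, a k = ∑' j, a (j + n) := by
    rw [← Summable.sum_add_tsum_nat_add' (f := a) (k := n) ENNReal.summable,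
      Finset.sum_eq_zero fun k hk => hzero k (Finset.mem_range.1 hk), zero_add]
  rw [hshift, ← ENNReal.tsum_mul_left]
  refine ENNReal.tsum_le_tsum fun j => ?_
  simp only [ha]
  rw [M.weight_add, mul_assoc]
  refine mul_le_mul_right (mul_le_mul_right ?_ _) _
  set d : ℝ := M.x j + s - M.x (j + n) with hd
  have hd0 : 0 ≤ d := by
    have := hG j n
    have h2 : (0 : ℝ) ≤ M.x 0 := (M.x 0).2
    linarith
  calc _ ≤ ∫⁻ u in Ioi 0, (Iic ((M.x j : ℝ) - 1)).indicator
          (fun v => h (M.flow (M.x j) v.toNNReal)) (u + d) := by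
        refine setLIntegral_mono' measurableSet_Ioi fun u hu => ?_
        have hu0 : 0 < u := hu
        by_cases hk : M.flow (M.x (j + n)) u.toNNReal ∈ Ici (1 + s)
        · have h1 := hmem _ u hu0 hk
          have h2 : u + d ∈ Iic ((M.x j : ℝ) - 1) := mem_Iic.2 (by linarith)
          rw [indicator_of_mem hk, indicator_of_mem h2, flow_flow]
          have h3 : M.flow (M.x (j + n)) (u.toNNReal + s) = M.flow (M.x j) (u + d).toNNReal := by
            have e1 : ((u.toNNReal + s : ℝ≥0) : ℝ) = u + s := by
              push_cast
              rw [Real.coe_toNNReal _ hu0.le]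
            have e2 : (((u + d).toNNReal : ℝ≥0) : ℝ) = u + d :=
              Real.coe_toNNReal _ (by linarith)
            apply NNReal.coe_injective
            rw [M.flow_eq_sub_of_one_le_flow, M.flow_eq_sub_of_one_le_flow, e1, e2, hd]
            · ring
            · rw [← NNReal.coe_le_coe]
              refine le_trans ?_ (M.sub_le_flow _ _)
              rw [e2]
              push_cast
              linarith
            · rw [← NNReal.coe_le_coe]
              refine le_trans ?_ (M.sub_le_flow _ _)
              rw [e1]
              push_cast
              linarith
          rw [h3]
          exact mul_le_of_le_one_left zero_le (ENNReal.ofReal_le_one.2 (M.surv_le_one _ hu0.le))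
        · rw [indicator_of_notMem hk, mul_zero]
          exact zero_le
    _ = ∫⁻ v in Ioi d, (Iic ((M.x j : ℝ) - 1)).indicator
          (fun v => h (M.flow (M.x j) v.toNNReal)) v := setLIntegral_Ioi_add _ d
    _ ≤ ∫⁻ v in Ioi 0, (Iic ((M.x j : ℝ) - 1)).indicator
          (fun v => h (M.flow (M.x j) v.toNNReal)) v := lintegral_mono_set (Ioi_subset_Ioi hd0)
    _ ≤ _ := by
        refine setLIntegral_mono' measurableSet_Ioi fun v hv => ?_
        by_cases hv1 : v ∈ Iic ((M.x j : ℝ) - 1)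
        · rw [indicator_of_mem hv1, M.surv_eq_one (mem_Ioi.1 hv).le hv1]
          simp
        · rw [indicator_of_notMem hv1]
          exact zero_le

theorem lintegral_transOp {π : Measure ℝ≥0} (hπ : IsInvariant M.transition π) {h : ℝ≥0 → ℝ≥0∞}
    (hh : Measurable h) (t : ℝ≥0) : ∫⁻ x, M.transOp h t x ∂π = ∫⁻ x, h x ∂π := by
  have hb : π.bind (M.transKernel t) = π := by
    ext B hB
    rw [Measure.bind_apply hB (M.transKernel t).aemeasurable]
    exact hπ t B hB
  conv_rhs => rw [← hb]
  rw [Measure.lintegral_bind (M.transKernel t).aemeasurable hh.aemeasurable]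
  rfl

theorem exists_setLIntegral_transOp_le (hb : M.BoundedGaps) [IsFiniteMeasure M.occ] :
    ∃ C c : ℝ, 0 < C ∧ 0 < c ∧ ∀ (h : ℝ≥0 → ℝ≥0∞), Measurable h → ∀ s t : ℝ≥0, s ≤ t →
      ∫⁻ z in Ici (1 + s), M.transOp h t z ∂M.statLaw ≤
        ENNReal.ofReal (C * Real.exp (-c * s)) * ∫⁻ z, h z ∂M.statLaw := by
  obtain ⟨G, hG0, hG, -⟩ := M.exists_summable_of_boundedGaps hb
  have hGr : (0 : ℝ) < G := by exact_mod_cast hG0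
  have hlog : Real.log M.p < 0 := Real.log_neg M.p_pos M.p_lt_one
  -- This makes `p ^ n = e^{-cGn}`. The number of shifts is `n = ⌊(s - x 0)/G⌋`, so `Gn > s - x 0 -
  -- G`; the constant `e^{c(x 0 + G)}` pays for the rounding and for `s < x 0`.
  set c : ℝ := -Real.log M.p / G with hc
  have hc0 : 0 < c := div_pos (by linarith) hGr
  have hcG : c * G = -Real.log M.p := by rw [hc]; field_simp
  refine ⟨Real.exp (c * (M.x 0 + G)), c, Real.exp_pos _, hc0, fun h hh s t hst => ?_⟩
  rw [← Real.exp_add]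
  rcases le_or_gt (M.x 0) s with hs | hs
  · set n := ⌊((s : ℝ) - M.x 0) / G⌋₊ with hn
    have hs' : (M.x 0 : ℝ) ≤ s := by exact_mod_cast hs
    have h1 : (n : ℝ) ≤ ((s : ℝ) - M.x 0) / G := Nat.floor_le (div_nonneg (by linarith) hGr.le)
    have h2 : ((s : ℝ) - M.x 0) / G < n + 1 := Nat.lt_floor_add_one _
    rw [le_div_iff₀ hGr] at h1
    rw [div_lt_iff₀ hGr] at h2
    have hsn : M.x 0 + G * n ≤ s := by
      rw [← NNReal.coe_le_coe]
      push_cast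
      linarith
    have hpn : M.p ^ n ≤ Real.exp (c * (M.x 0 + G) + -c * s) := by
      have : M.p ^ n = Real.exp (-(c * G) * n) := by
        rw [hcG, neg_neg, mul_comm, Real.exp_nat_mul, Real.exp_log M.p_pos]
      rw [this, Real.exp_le_exp]
      nlinarith
    calc _ ≤ ∫⁻ z in Ici (1 + s), M.transOp h (t - s) (M.flow z s) ∂M.statLaw :=
          setLIntegral_mono' measurableSet_Ici fun z hz => M.transOp_le_of_one_add_le hst hz
      _ ≤ ENNReal.ofReal (M.p ^ n) * ∫⁻ z, M.transOp h (t - s) z ∂M.statLaw := by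
          rw [statLaw, Measure.restrict_smul, lintegral_smul_measure, lintegral_smul_measure,
            smul_eq_mul, smul_eq_mul, mul_left_comm]
          gcongr
          exact M.setLIntegral_flow_occ_le hG (M.measurable_transOp hh measurable_const measurable_id) hsn
      _ ≤ _ := by
          rw [M.lintegral_transOp M.isInvariant_statLaw hh]
          gcongr
  · have hs' : (s : ℝ) < M.x 0 := by exact_mod_cast hs
    calc _ ≤ ∫⁻ z, M.transOp h t z ∂M.statLaw := setLIntegral_le_lintegral _ _
      _ = 1 * ∫⁻ z, h z ∂M.statLaw := by rw [M.lintegral_transOp M.isInvariant_statLaw hh, one_mul]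
      _ ≤ _ := by
          gcongr
          rw [ENNReal.one_le_ofReal]
          refine Real.one_le_exp ?_
          nlinarith

end Model
-- Decay of the transition operators on zero-mean functions, in the `r`-th power of the norm.
namespace Model

variable (M : Model)

theorem enorm_markovOp_rpow_le {f : ℝ≥0 → ℂ} (hf : Measurable f) {r : ℝ} (hr : 1 < r) (t x : ℝ≥0) :
    ‖markovOp M.transition t f x‖ₑ ^ r ≤ M.transOp (fun z => ‖f z‖ₑ ^ r) t x := by
  have h := setLIntegral_rpow_le (M.transition t x) hr (k := fun z => ‖f z‖ₑ) (by fun_prop)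
    MeasurableSet.univ
  rw [Measure.restrict_univ, measure_univ, ENNReal.one_rpow, one_mul] at h
  refine le_trans ?_ h
  gcongr
  exact enorm_integral_le_lintegral_enorm _

theorem map_path_prod {π : Measure ℝ≥0} [SFinite π] (hπ : IsInvariant M.transition π) (t : ℝ≥0) :
    (π.prod M.seedLaw).map (fun q => M.path q.1 q.2 t) = π := by
  ext B hB
  rw [Measure.map_apply (by fun_prop) hB, Measure.prod_apply ((by fun_prop :
    Measurable fun q : ℝ≥0 × (ℕ → ℝ × I × ℕ) => M.path q.1 q.2 t) hB), ← hπ t B hB]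
  refine lintegral_congr fun z => ?_
  rw [transition, Measure.map_apply (by fun_prop) hB]
  rfl

/-- As `f` has zero mean, `T_t f(x)` is the expectation of `f` at the copy from `x` minus `f` at the
stationary copy on the same seed; only the event that the copies differ contributes. -/
theorem enorm_markovOp_le_setLIntegral {π : Measure ℝ≥0} [IsProbabilityMeasure π]
    (hπ : IsInvariant M.transition π) {f : ℝ≥0 → ℂ} (hf : Measurable f) (hfi : Integrable f π)
    (hf0 : ∫ z, f z ∂π = 0) (t x : ℝ≥0) :
    ‖markovOp M.transition t f x‖ₑ ≤
      ∫⁻ q in {q : ℝ≥0 × (ℕ → ℝ × I × ℕ) | M.path x q.2 t ≠ M.path q.1 q.2 t},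
        (‖f (M.path x q.2 t)‖ₑ + ‖f (M.path q.1 q.2 t)‖ₑ) ∂(π.prod M.seedLaw) := by
  have hms : MeasurableSet {q : ℝ≥0 × (ℕ → ℝ × I × ℕ) | M.path x q.2 t ≠ M.path q.1 q.2 t} :=
    measurableSet_ne.preimage (f := fun q : ℝ≥0 × (ℕ → ℝ × I × ℕ) =>
      (M.path x q.2 t, M.path q.1 q.2 t)) (by fun_prop)
  by_cases hx : Integrable f (M.transition t x)
  swap
  -- Where `f` is not integrable the Bochner integral has the default value zero.
  · rw [markovOp, integral_undef hx]
    simp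
  have hx' : Integrable (fun ω => f (M.path x ω t)) M.seedLaw := by
    rw [transition] at hx
    exact (integrable_map_measure hf.aestronglyMeasurable (by fun_prop)).1 hx
  have hmq : Measurable fun q : ℝ≥0 × (ℕ → ℝ × I × ℕ) => M.path q.1 q.2 t := by fun_prop
  have h1 : Integrable (fun q : ℝ≥0 × (ℕ → ℝ × I × ℕ) => f (M.path x q.2 t))
      (π.prod M.seedLaw) := hx'.comp_snd π
  have h2 : Integrable (fun q : ℝ≥0 × (ℕ → ℝ × I × ℕ) => f (M.path q.1 q.2 t))
      (π.prod M.seedLaw) := by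
    have := M.map_path_prod hπ t
    rw [← this] at hfi
    exact (integrable_map_measure hf.aestronglyMeasurable hmq.aemeasurable).1 hfi
  have e1 : ∫ q : ℝ≥0 × (ℕ → ℝ × I × ℕ), f (M.path x q.2 t) ∂(π.prod M.seedLaw) =
      markovOp M.transition t f x := by
    rw [integral_fun_snd (fun ω => f (M.path x ω t)), markovOp, transition,
      integral_map (by fun_prop) hf.aestronglyMeasurable]
    simp
  have e2 : ∫ q : ℝ≥0 × (ℕ → ℝ × I × ℕ), f (M.path q.1 q.2 t) ∂(π.prod M.seedLaw) = 0 := by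
    rw [← hf0]
    conv_rhs => rw [← M.map_path_prod hπ t]
    rw [integral_map hmq.aemeasurable hf.aestronglyMeasurable]
  have e3 : markovOp M.transition t f x = ∫ q : ℝ≥0 × (ℕ → ℝ × I × ℕ),
      (f (M.path x q.2 t) - f (M.path q.1 q.2 t)) ∂(π.prod M.seedLaw) := by
    rw [integral_sub h1 h2, e1, e2, sub_zero]
  rw [e3]
  refine (enorm_integral_le_lintegral_enorm _).trans ?_
  rw [← lintegral_indicator hms]
  refine lintegral_mono fun q => ?_
  by_cases hq : M.path x q.2 t = M.path q.1 q.2 t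
  · simp only [hq]
    simp
  · rw [indicator_of_mem (show q ∈ {q : ℝ≥0 × (ℕ → ℝ × I × ℕ) |
      M.path x q.2 t ≠ M.path q.1 q.2 t} from hq)]
    exact enorm_sub_le

theorem enorm_markovOp_rpow_le_measure_ne {π : Measure ℝ≥0} [IsProbabilityMeasure π]
    (hπ : IsInvariant M.transition π) {f : ℝ≥0 → ℂ} (hf : Measurable f) (hfi : Integrable f π)
    (hf0 : ∫ z, f z ∂π = 0) {r : ℝ} (hr : 1 < r) (t x : ℝ≥0) :
    ‖markovOp M.transition t f x‖ₑ ^ r ≤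
      (∫⁻ z, M.seedLaw {ω | M.path x ω t ≠ M.path z ω t} ∂π) ^ (r - 1) *
        (2 ^ (r - 1) * (M.transOp (fun z => ‖f z‖ₑ ^ r) t x + ∫⁻ z, ‖f z‖ₑ ^ r ∂π)) := by
  have hms : MeasurableSet {q : ℝ≥0 × (ℕ → ℝ × I × ℕ) | M.path x q.2 t ≠ M.path q.1 q.2 t} :=
    measurableSet_ne.preimage (f := fun q : ℝ≥0 × (ℕ → ℝ × I × ℕ) =>
      (M.path x q.2 t, M.path q.1 q.2 t)) (by fun_prop)
  have hm : Measurable fun z => ‖f z‖ₑ ^ r := by fun_prop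
  have h := setLIntegral_rpow_le (π.prod M.seedLaw) hr
    (k := fun q => ‖f (M.path x q.2 t)‖ₑ + ‖f (M.path q.1 q.2 t)‖ₑ)
    (Measurable.aemeasurable (by fun_prop)) hms
  refine (ENNReal.rpow_le_rpow (M.enorm_markovOp_le_setLIntegral hπ hf hfi hf0 t x)
    (by linarith)).trans (h.trans ?_)
  rw [Measure.prod_apply hms]
  refine mul_le_mul_right ?_ _
  calc _ ≤ ∫⁻ q, 2 ^ (r - 1) * (‖f (M.path x q.2 t)‖ₑ ^ r + ‖f (M.path q.1 q.2 t)‖ₑ ^ r)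
        ∂(π.prod M.seedLaw) :=
        lintegral_mono fun q => ENNReal.rpow_add_le_mul_rpow_add_rpow _ _ hr.le
    _ = 2 ^ (r - 1) * (∫⁻ q, ‖f (M.path x q.2 t)‖ₑ ^ r ∂(π.prod M.seedLaw) +
        ∫⁻ q, ‖f (M.path q.1 q.2 t)‖ₑ ^ r ∂(π.prod M.seedLaw)) := by
        rw [lintegral_const_mul _ (by fun_prop), lintegral_add_left (by fun_prop)]
    _ ≤ _ := by
        refine mul_le_mul_right (add_le_add (le_of_eq ?_) (le_of_eq ?_)) _
        · rw [lintegral_prod (fun q : ℝ≥0 × (ℕ → ℝ × I × ℕ) => ‖f (M.path x q.2 t)‖ₑ ^ r)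
            (Measurable.aemeasurable (by fun_prop)), M.transOp_eq hm]
          simp
        · conv_rhs => rw [← M.map_path_prod hπ t]
          rw [lintegral_map hm (by fun_prop)]

/-- The weight `e^{αx}` in the coupling bound is not controlled uniformly in `x`, so the coupling
serves only up to `x < 1 + δt`; higher starting points are handled by the geometric decay of the
stationary mass under the shift. -/
theorem exists_lintegral_markovOp_le (hb : M.BoundedGaps) [IsFiniteMeasure M.occ] {r : ℝ}
    (hr : 1 < r) : ∃ C γ : ℝ, 0 < C ∧ 0 < γ ∧ ∀ (t : ℝ≥0) (f : ℝ≥0 → ℂ), Measurable f →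
      Integrable f M.statLaw → ∫ z, f z ∂M.statLaw = 0 →
      ∫⁻ x, ‖markovOp M.transition t f x‖ₑ ^ r ∂M.statLaw ≤
        ENNReal.ofReal (C * Real.exp (-γ * t)) * ∫⁻ x, ‖f x‖ₑ ^ r ∂M.statLaw := by
  obtain ⟨G, hG0, hG, α, hα, h⟩ := M.exists_summable_of_boundedGaps hb
  obtain ⟨C, β, hC, hβ, hne⟩ := M.exists_measure_path_ne_le hα h
  obtain ⟨C₂, c, hC₂, hc, hfar⟩ := M.exists_setLIntegral_transOp_le hb
  set m := (∫⁻ z, expWeight α z ∂M.statLaw).toReal with hm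
  have hmm : ∫⁻ z, expWeight α z ∂M.statLaw = ENNReal.ofReal m :=
    (ENNReal.ofReal_toReal (M.lintegral_expWeight_statLaw_ne_top hα h)).symm
  have hm0 : 0 ≤ m := ENNReal.toReal_nonneg
  -- With `αδ ≤ β/2` the weight at height `1 + δt` costs at most half of the coupling rate; `δ ≤ 1`
  -- ensures that the shift `s = δt` does not exceed `t`.
  set δ : ℝ≥0 := min (β / (2 * α)).toNNReal 1 with hδ
  have hδ0 : 0 < δ := lt_min (Real.toNNReal_pos.2 (by positivity)) one_pos
  have hδr : (0 : ℝ) < δ := hδ0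
  have hδ1 : δ ≤ 1 := min_le_right _ _
  have hδβ : α * δ ≤ β / 2 := by
    have : (δ : ℝ) ≤ β / (2 * α) :=
      (NNReal.coe_le_coe.2 (min_le_left _ _)).trans_eq (Real.coe_toNNReal _ (by positivity))
    calc α * δ ≤ α * (β / (2 * α)) := by gcongr
      _ = β / 2 := by field_simp
  set D : ℝ := (C * (Real.exp α + m)) ^ (r - 1) with hD
  have hD0 : 0 < D := by positivity
  set γ := min (β / 2 * (r - 1)) (c * δ) with hγ
  have hr1 : 0 < r - 1 := by linarith
  refine ⟨D * 2 ^ r + C₂, γ, by positivity, lt_min (by positivity) (by positivity),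
    fun t f hf hfi hf0 => ?_⟩
  set s : ℝ≥0 := δ * t with hs
  have hst : s ≤ t := mul_le_of_le_one_left zero_le hδ1
  set H := ∫⁻ x, ‖f x‖ₑ ^ r ∂M.statLaw with hH
  have hhm : Measurable fun z => ‖f z‖ₑ ^ r := by fun_prop
  have hT : Measurable fun x => M.transOp (fun z => ‖f z‖ₑ ^ r) t x :=
    M.measurable_transOp hhm measurable_const measurable_id
  have hinv := M.isInvariant_statLaw
  have : IsProbabilityMeasure M.statLaw := M.isProbabilityMeasure_statLaw
  have hnear : ∀ x ∈ Iio (1 + s), ‖markovOp M.transition t f x‖ₑ ^ r ≤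
      ENNReal.ofReal (D * Real.exp (-(β / 2 * (r - 1)) * t)) *
        (2 ^ (r - 1) * (M.transOp (fun z => ‖f z‖ₑ ^ r) t x + H)) := by
    intro x hx
    have hxr : (x : ℝ) < 1 + s := by exact_mod_cast mem_Iio.1 hx
    refine (M.enorm_markovOp_rpow_le_measure_ne hinv hf hfi hf0 hr t x).trans ?_
    refine mul_le_mul_left ?_ _
    have h1 : ∫⁻ z, M.seedLaw {ω | M.path x ω t ≠ M.path z ω t} ∂M.statLaw ≤
        ENNReal.ofReal (C * (Real.exp α + m) * Real.exp (-(β / 2) * t)) := by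
      calc _ ≤ ∫⁻ z, ENNReal.ofReal (C * Real.exp (-β * t)) * (expWeight α x + expWeight α z)
            ∂M.statLaw := lintegral_mono fun z => hne x z t
        _ = ENNReal.ofReal (C * Real.exp (-β * t) * (Real.exp (α * x) + m)) := by
            rw [lintegral_const_mul _ (by fun_prop), lintegral_add_left (by fun_prop), hmm,
              ENNReal.ofReal_mul (p := C * Real.exp (-β * t)) (by positivity),
              ENNReal.ofReal_add (by positivity) hm0]
            simp [expWeight]
        _ ≤ _ := by
            refine ENNReal.ofReal_le_ofReal ?_
            have e1 : Real.exp (-β * t) * Real.exp (α * x) ≤ Real.exp α * Real.exp (-(β / 2) * t) := by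
              rw [← Real.exp_add, ← Real.exp_add, Real.exp_le_exp]
              have : (s : ℝ) = δ * t := by rw [hs]; push_cast; rfl
              have h3 : α * x ≤ α * (1 + δ * t) := by rw [← this]; gcongr
              have h4 : α * δ * t ≤ β / 2 * t := by gcongr
              nlinarith
            have e2 : Real.exp (-β * t) * m ≤ m * Real.exp (-(β / 2) * t) := by
              rw [mul_comm]
              gcongr
              linarith
            calc C * Real.exp (-β * t) * (Real.exp (α * x) + m)
                = C * (Real.exp (-β * t) * Real.exp (α * x) + Real.exp (-β * t) * m) := by ring
              _ ≤ C * (Real.exp α * Real.exp (-(β / 2) * t) + m * Real.exp (-(β / 2) * t)) := by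
                  gcongr
              _ = _ := by ring
    refine (ENNReal.rpow_le_rpow h1 hr1.le).trans (le_of_eq ?_)
    rw [ENNReal.ofReal_rpow_of_nonneg (by positivity) hr1.le,
      Real.mul_rpow (by positivity) (Real.exp_pos _).le, ← Real.exp_mul]
    congr 3
    ring
  have hnear' : ∫⁻ x in Iio (1 + s), ‖markovOp M.transition t f x‖ₑ ^ r ∂M.statLaw ≤
      ENNReal.ofReal (D * 2 ^ r * Real.exp (-γ * t)) * H := by
    calc _ ≤ ∫⁻ x in Iio (1 + s), ENNReal.ofReal (D * Real.exp (-(β / 2 * (r - 1)) * t)) *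
        (2 ^ (r - 1) * (M.transOp (fun z => ‖f z‖ₑ ^ r) t x + H)) ∂M.statLaw :=
          setLIntegral_mono' measurableSet_Iio hnear
      _ ≤ ∫⁻ x, ENNReal.ofReal (D * Real.exp (-(β / 2 * (r - 1)) * t)) *
        (2 ^ (r - 1) * (M.transOp (fun z => ‖f z‖ₑ ^ r) t x + H)) ∂M.statLaw :=
          setLIntegral_le_lintegral _ _
      _ = ENNReal.ofReal (D * Real.exp (-(β / 2 * (r - 1)) * t)) * (2 ^ (r - 1) * (H + H)) := by
          rw [lintegral_const_mul _ (by fun_prop), lintegral_const_mul _ (by fun_prop),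
            lintegral_add_left hT, M.lintegral_transOp hinv hhm, lintegral_const, measure_univ,
            mul_one]
      _ = ENNReal.ofReal (D * 2 ^ r * Real.exp (-(β / 2 * (r - 1)) * t)) * H := by
          have : (2 : ℝ≥0∞) ^ (r - 1) * (H + H) = ENNReal.ofReal (2 ^ r) * H := by
            rw [← two_mul, ← mul_assoc, ← ENNReal.ofReal_rpow_of_pos two_pos, ENNReal.ofReal_ofNat]
            congr 1
            nth_rw 2 [← ENNReal.rpow_one 2]
            rw [← ENNReal.rpow_add _ _ two_ne_zero ENNReal.ofNat_ne_top, sub_add_cancel]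
          rw [this, ← mul_assoc, ← ENNReal.ofReal_mul (by positivity)]
          congr 2
          ring
      _ ≤ _ := by
          gcongr
          exact min_le_left _ _
  have hfar' : ∫⁻ x in Ici (1 + s), ‖markovOp M.transition t f x‖ₑ ^ r ∂M.statLaw ≤
      ENNReal.ofReal (C₂ * Real.exp (-γ * t)) * H := by
    calc _ ≤ ∫⁻ x in Ici (1 + s), M.transOp (fun z => ‖f z‖ₑ ^ r) t x ∂M.statLaw :=
          lintegral_mono fun x => M.enorm_markovOp_rpow_le hf hr t x
      _ ≤ _ := hfar _ hhm s t hst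
      _ ≤ _ := by
          refine mul_le_mul_left (ENNReal.ofReal_le_ofReal
            (mul_le_mul_of_nonneg_left (Real.exp_le_exp.2 ?_) hC₂.le)) _
          have : (s : ℝ) = δ * t := by rw [hs]; push_cast; rfl
          rw [this]
          have : γ * t ≤ c * δ * t := by gcongr; exact min_le_right _ _
          linarith
  rw [← lintegral_add_compl _ (measurableSet_Iio (a := 1 + s)), compl_Iio, add_mul,
    ENNReal.ofReal_add (by positivity) (by positivity), add_mul]
  exact add_le_add hnear' hfar'

end Model
-- The semigroup acting on classes of functions in `L_r(π)`.
theorem lpSemigroup_ae_eq {S : Type*} [MeasurableSpace S] {P : ℝ≥0 → S → Measure S} {π : Measure S}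
    {r : ℝ≥0∞} [Fact (1 ≤ r)] {V : Submodule ℂ (Lp ℂ r π)} {t : ℝ≥0} {f : V}
    (h : ∃ g : V, ((g : Lp ℂ r π) : S → ℂ) =ᵐ[π] markovOp P t ((f : Lp ℂ r π) : S → ℂ)) :
    ((lpSemigroup P V t f : Lp ℂ r π) : S → ℂ) =ᵐ[π] markovOp P t ((f : Lp ℂ r π) : S → ℂ) :=
  Classical.epsilon_spec h

theorem one_lt_toReal {r : ℝ≥0∞} (hr : 1 < r) (hr' : r ≠ ∞) : 1 < r.toReal := by
  simpa using ENNReal.toReal_strict_mono hr' hr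

theorem mem_lpZero_iff {S : Type*} [MeasurableSpace S] {π : Measure S} [IsFiniteMeasure π]
    {r : ℝ≥0∞} [Fact (1 ≤ r)] {f : Lp ℂ r π} : f ∈ LpZero π r ↔ ∫ x, f x ∂π = 0 := Iff.rfl

namespace Model

variable (M : Model)

section Invariant

variable {π : Measure ℝ≥0}

theorem bind_transKernel (hπ : IsInvariant M.transition π) (t : ℝ≥0) : π.bind (M.transKernel t) = π := by
  ext B hB
  rw [Measure.bind_apply hB (M.transKernel t).aemeasurable]
  exact hπ t B hB

/-- By invariance a `π`-null set is null for `P_t(x, ·)` for `π`-almost every `x`. -/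
theorem markovOp_congr_ae (hπ : IsInvariant M.transition π) {f g : ℝ≥0 → ℂ} (h : f =ᵐ[π] g) (t : ℝ≥0) :
    markovOp M.transition t f =ᵐ[π] markovOp M.transition t g := by
  have h' : ∀ᵐ z ∂(π.bind (M.transKernel t)), f z = g z := by rwa [M.bind_transKernel hπ t]
  filter_upwards [Measure.ae_ae_of_ae_comp h'] with x hx
  exact integral_congr_ae hx

theorem memLp_markovOp (hπ : IsInvariant M.transition π) {r : ℝ≥0∞} (hr : 1 < r) (hr' : r ≠ ∞)
    {f : ℝ≥0 → ℂ} (hf : MemLp f r π) (t : ℝ≥0) : MemLp (markovOp M.transition t f) r π := by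
  obtain ⟨g, hg, hfg⟩ := hf.1
  refine MemLp.ae_eq (M.markovOp_congr_ae hπ hfg.symm t) ?_
  have hg' : MemLp g r π := hf.ae_eq hfg
  have hr1 := one_lt_toReal hr hr'
  have hr0 : r ≠ 0 := (zero_lt_one.trans hr).ne'
  refine ⟨(hg.integral_kernel (κ := M.transKernel t)).aestronglyMeasurable, ?_⟩
  rw [eLpNorm_lt_top_iff_lintegral_rpow_enorm_lt_top hr0 hr']
  refine lt_of_le_of_lt (lintegral_mono fun x => M.enorm_markovOp_rpow_le hg.measurable hr1 t x) ?_
  rw [M.lintegral_transOp hπ (hg.measurable.enorm.pow_const _)]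
  exact (eLpNorm_lt_top_iff_lintegral_rpow_enorm_lt_top hr0 hr').1 hg'.2

theorem integral_markovOp [IsProbabilityMeasure π] (hπ : IsInvariant M.transition π) {f : ℝ≥0 → ℂ}
    (hf : Integrable f π) (t : ℝ≥0) :
    ∫ x, markovOp M.transition t f x ∂π = ∫ x, f x ∂π := by
  obtain ⟨g, hg, hfg⟩ := hf.1
  rw [integral_congr_ae (M.markovOp_congr_ae hπ hfg t), integral_congr_ae hfg]
  have hmq : Measurable fun q : ℝ≥0 × (ℕ → ℝ × I × ℕ) => M.path q.1 q.2 t := by fun_prop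
  have hgi : Integrable g π := hf.congr hfg
  have hgm : AEStronglyMeasurable g ((π.prod M.seedLaw).map fun q => M.path q.1 q.2 t) :=
    hg.aestronglyMeasurable
  have h2 : Integrable (fun q : ℝ≥0 × (ℕ → ℝ × I × ℕ) => g (M.path q.1 q.2 t))
      (π.prod M.seedLaw) := by
    rw [← M.map_path_prod hπ t] at hgi
    exact (integrable_map_measure hgm hmq.aemeasurable).1 hgi
  conv_rhs => rw [← M.map_path_prod hπ t, integral_map hmq.aemeasurable hgm, integral_prod _ h2]
  refine integral_congr_ae (ae_of_all _ fun x => ?_)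
  simp only [markovOp]
  rw [transition, integral_map (by fun_prop) hg.aestronglyMeasurable]

variable {r : ℝ≥0∞} [Fact (1 ≤ r)]

theorem lpSemigroup_top_ae_eq (hπ : IsInvariant M.transition π) (hr : 1 < r)
    (hr' : r ≠ ∞) (t : ℝ≥0) (f : (⊤ : Submodule ℂ (Lp ℂ r π))) :
    ((lpSemigroup M.transition ⊤ t f : Lp ℂ r π) : ℝ≥0 → ℂ) =ᵐ[π]
      markovOp M.transition t ((f : Lp ℂ r π) : ℝ≥0 → ℂ) :=
  have h := M.memLp_markovOp hπ hr hr' (Lp.memLp f.1) t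
  lpSemigroup_ae_eq ⟨⟨h.toLp _, trivial⟩, h.coeFn_toLp⟩

theorem lpSemigroup_lpZero_ae_eq [IsProbabilityMeasure π] (hπ : IsInvariant M.transition π) 
    (hr : 1 < r) (hr' : r ≠ ∞) (t : ℝ≥0) (f : LpZero π r) :
    ((lpSemigroup M.transition (LpZero π r) t f : Lp ℂ r π) : ℝ≥0 → ℂ) =ᵐ[π]
      markovOp M.transition t ((f : Lp ℂ r π) : ℝ≥0 → ℂ) := by
  have h := M.memLp_markovOp hπ hr hr' (Lp.memLp f.1) t
  refine lpSemigroup_ae_eq ⟨⟨h.toLp _, ?_⟩, h.coeFn_toLp⟩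
  rw [mem_lpZero_iff, integral_congr_ae h.coeFn_toLp,
    M.integral_markovOp hπ ((Lp.memLp f.1).integrable Fact.out)]
  exact f.2

end Invariant

theorem exists_growthBound (hb : M.BoundedGaps) [IsFiniteMeasure M.occ]
    [IsProbabilityMeasure M.statLaw] (r : ℝ≥0∞) [Fact (1 ≤ r)] (hr : 1 < r) (hr' : r ≠ ∞) :
    ∃ γ : ℝ, 0 < γ ∧ GB M.transition M.statLaw r γ := by
  have hr1 := one_lt_toReal hr hr'
  have hr0 : r ≠ 0 := (zero_lt_one.trans hr).ne'
  set q := r.toReal with hq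
  have hq0 : 0 < q := by linarith
  obtain ⟨C, γ, hC, hγ, h⟩ := M.exists_lintegral_markovOp_le hb hr1
  -- The decay was proved for the `q`-th power of the norm.
  refine ⟨γ / q, by positivity, C ^ (1 / q), by positivity, fun t f => ?_⟩
  have hfi : Integrable (f : Lp ℂ r M.statLaw) M.statLaw := (Lp.memLp f.1).integrable Fact.out
  have h1 := h t _ (Lp.stronglyMeasurable f.1).measurable hfi f.2
  have h2 : ‖lpSemigroup M.transition (LpZero M.statLaw r) t f‖ₑ ≤
      ENNReal.ofReal (C ^ (1 / q) * Real.exp (-(γ / q) * t)) * ‖f‖ₑ := by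
    calc _ = eLpNorm (markovOp M.transition t (f : Lp ℂ r M.statLaw)) r M.statLaw := by
          rw [← eLpNorm_congr_ae (M.lpSemigroup_lpZero_ae_eq M.isInvariant_statLaw hr hr' t f),
            ← Lp.enorm_def]
          rfl
      _ = (∫⁻ x, ‖markovOp M.transition t (f : Lp ℂ r M.statLaw) x‖ₑ ^ q ∂M.statLaw) ^ (1 / q) :=
          eLpNorm_eq_lintegral_rpow_enorm_toReal hr0 hr'
      _ ≤ _ := ENNReal.rpow_le_rpow h1 (by positivity)
      _ = _ := by
          rw [ENNReal.mul_rpow_of_nonneg _ _ (by positivity),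
            ← eLpNorm_eq_lintegral_rpow_enorm_toReal hr0 hr', ← Lp.enorm_def,
            ENNReal.ofReal_rpow_of_nonneg (by positivity) (by positivity),
            Real.mul_rpow hC.le (Real.exp_pos _).le, ← Real.exp_mul]
          congr 4
          ring
  rw [← ofReal_norm, ← ofReal_norm, ← ENNReal.ofReal_mul (by positivity)] at h2
  exact (ENNReal.ofReal_le_ofReal_iff (by positivity)).1 h2

end Model
namespace Model

variable (M : Model)

/-! ### Translation inside the gaps of the sequence -/

/-- The interval `[A, B]` lies above `1`, and no point `x_k` reaches it within time `t` under the
unit-speed drift. -/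
def Avoids (A B t : ℝ) : Prop := 1 < A ∧ ∀ j, (M.x j : ℝ) < A ∨ B + t < M.x j

theorem Avoids.mono {A B t A' B' t' : ℝ} {M : Model} (h : M.Avoids A B t) (hA : A ≤ A')
    (hBt : B' + t' ≤ B + t) : M.Avoids A' B' t' :=
  ⟨h.1.trans_le hA, fun j => (h.2 j).imp (fun h => h.trans_le hA) fun h => hBt.trans_lt h⟩

theorem avoids_gap {k : ℕ} {A B t : ℝ} (hA : (M.x k : ℝ) < A) (hB : B + t < M.x (k + 1)) :
    M.Avoids A B t := by
  refine ⟨lt_of_le_of_lt ?_ hA, fun j => ?_⟩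
  · exact_mod_cast M.one_le_x k
  · rcases Nat.lt_or_ge k j with h | h
    · exact Or.inr (hB.trans_le (by exact_mod_cast M.strictMono_x.monotone h))
    · exact Or.inl (lt_of_le_of_lt (by exact_mod_cast M.strictMono_x.monotone h) hA)

/-- Jumps happen only below level 1. So either the state still lies on the flow from `y`, or that
flow is already below 1 and the state is on the flow from some `x j`, for a time not exceeding the
elapsed one. -/
theorem ringState_eq_or (y : ℝ≥0) (ω : ℕ → ℝ × I × ℕ) (n : ℕ) :
    M.ringState y ω n = M.flow y (ringTime ω n) ∨ (M.flow y (ringTime ω n) < 1 ∧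
      ∃ j, ∃ s ≤ ringTime ω n, M.ringState y ω n = M.flow (M.x j) s) := by
  induction n with
  | zero => exact Or.inl (by rw [ringTime_zero, flow_zero]; rfl)
  | succ n ih =>
    rw [ringState_succ, ringTime_succ, ringStep]
    set e := (ω n).1.toNNReal with he
    have hstep : ∀ z, ((ω n).2.1 : ℝ) < M.rate z → z < 1 := by
      intro z hz
      by_contra! h
      rw [M.rate_eq_zero h] at hz
      exact absurd (ω n).2.1.2.1 (not_le.2 hz)
    rcases ih with h | ⟨h1, j, s, hs, h2⟩
    · rw [h, flow_flow]
      split_ifs with hv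
      · exact Or.inr ⟨hstep _ hv, (ω n).2.2, 0, zero_le, (M.flow_zero _).symm⟩
      · exact Or.inl rfl
    · have hlt : M.flow y (ringTime ω n + e) < 1 := (M.flow_antitone y le_self_add).trans_lt h1
      rw [h2, flow_flow]
      split_ifs with hv
      · exact Or.inr ⟨hlt, (ω n).2.2, 0, zero_le, (M.flow_zero _).symm⟩
      · exact Or.inr ⟨hlt, j, s + e, add_le_add_left hs e, rfl⟩

theorem path_eq_or (y : ℝ≥0) (ω : ℕ → ℝ × I × ℕ) (t : ℝ≥0) :
    M.path y ω t = M.flow y t ∨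
      (M.flow y t < 1 ∧ ∃ j, ∃ s ≤ t, M.path y ω t = M.flow (M.x j) s) := by
  have hn := ringTime_ringCount_le ω t
  rw [path]
  rcases M.ringState_eq_or y ω (ringCount ω t) with h | ⟨h1, j, s, hs, h2⟩
  · rw [h, flow_flow, add_tsub_cancel_of_le hn]
    exact Or.inl rfl
  · refine Or.inr ⟨(M.flow_antitone y hn).trans_lt h1, j, s + (t - ringTime ω (ringCount ω t)), ?_,
      by rw [h2, flow_flow]⟩
    exact (add_le_add_left hs _).trans_eq (add_tsub_cancel_of_le hn)

/-- A path that has jumped cannot be in `[A, B]` at time `t`: from `x j < A` it stays below, and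
from `x j > B + t` it has not come down far enough. Then `y - t` is below `A` too, so both sides
vanish. A path without jumps above 1 is a translation. -/
theorem apply_path_eq {E : Type*} [Zero E] {φ : ℝ → E} {A B : ℝ} {t : ℝ≥0} (h : M.Avoids A B t)
    (hφ : ∀ z ∉ Icc A B, φ z = 0) (y : ℝ≥0) (ω : ℕ → ℝ × I × ℕ) :
    φ (M.path y ω t) = φ (y - t) := by
  have hflow : φ (M.flow y t) = φ (y - t) := by
    rcases le_or_gt 1 (M.flow y t) with h1 | h1
    · rw [M.flow_eq_sub_of_one_le_flow h1]
    · have h2 : (M.flow y t : ℝ) < 1 := by exact_mod_cast h1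
      have h3 := M.sub_le_flow y t
      rw [hφ _ fun hz => absurd hz.1 (by linarith [h.1]),
        hφ _ fun hz => absurd hz.1 (by linarith [h.1])]
  rcases M.path_eq_or y ω t with h1 | ⟨h1, j, s, hs, h2⟩
  · rw [h1, hflow]
  · have h1r : (M.flow y t : ℝ) < 1 := by exact_mod_cast h1
    have h3 : φ (M.flow y t) = 0 := hφ _ fun hz => absurd hz.1 (by linarith [h.1])
    rw [← hflow, h3, h2]
    refine hφ _ fun hz => ?_
    have hs' : (s : ℝ) ≤ t := by exact_mod_cast hs
    have h4 := M.sub_le_flow (M.x j) s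
    have h5 : (M.flow (M.x j) s : ℝ) ≤ M.x j := by exact_mod_cast M.flow_le (M.x j) s
    rcases h.2 j with hj | hj
    · linarith [hz.1]
    · linarith [hz.2]

theorem markovOp_eq_of_avoids {φ : ℝ → ℂ} {A B : ℝ} {t : ℝ≥0} (h : M.Avoids A B t)
    (hφ : ∀ z ∉ Icc A B, φ z = 0) (hm : Measurable φ) (y : ℝ≥0) :
    markovOp M.transition t (fun z => φ z) y = φ (y - t) := by
  rw [markovOp, transition, integral_map (by fun_prop)
    (Measurable.aestronglyMeasurable (by fun_prop))]
  simp [M.apply_path_eq h hφ]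

theorem lintegral_sub_eq_of_avoids {π : Measure ℝ≥0} (hπ : IsInvariant M.transition π)
    {φ : ℝ → ℝ≥0∞} {A B : ℝ} {t : ℝ≥0} (h : M.Avoids A B t)
    (hφ : ∀ z ∉ Icc A B, φ z = 0) (hm : Measurable φ) :
    ∫⁻ y : ℝ≥0, φ (y - t) ∂π = ∫⁻ y : ℝ≥0, φ y ∂π := by
  rw [← M.lintegral_transOp hπ (h := fun y : ℝ≥0 => φ y) (by fun_prop) t]
  refine lintegral_congr fun y => ?_
  rw [M.transOp_eq (by fun_prop)]
  simp [M.apply_path_eq h hφ]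

theorem integral_sub_eq_of_avoids {π : Measure ℝ≥0} [IsProbabilityMeasure π]
    (hπ : IsInvariant M.transition π) {φ : ℝ → ℂ} {A B : ℝ} {t : ℝ≥0} (h : M.Avoids A B t)
    (hφ : ∀ z ∉ Icc A B, φ z = 0) (hm : Measurable φ) (hi : Integrable (fun y : ℝ≥0 => φ y) π) :
    ∫ y : ℝ≥0, φ (y - t) ∂π = ∫ y : ℝ≥0, φ y ∂π := by
  rw [← M.integral_markovOp hπ hi t]
  exact integral_congr_ae (ae_of_all _ fun y => (M.markovOp_eq_of_avoids h hφ hm y).symm)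

theorem measure_Icc_add_eq_of_avoids {π : Measure ℝ≥0} (hπ : IsInvariant M.transition π)
    {A B : ℝ} {t : ℝ≥0} (h : M.Avoids A B t) :
    π {y | (y : ℝ) ∈ Icc (A + t) (B + t)} = π {y | (y : ℝ) ∈ Icc A B} := by
  have h1 := M.lintegral_sub_eq_of_avoids hπ h (φ := (Icc A B).indicator 1)
    (fun z hz => indicator_of_notMem hz _) (measurable_one.indicator measurableSet_Icc)
  have hms : ∀ a b : ℝ, MeasurableSet {y : ℝ≥0 | (y : ℝ) ∈ Icc a b} := fun a b =>
    measurableSet_Icc.preimage (by fun_prop)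
  rw [← lintegral_indicator_one (hms _ _), ← lintegral_indicator_one (hms _ _)]
  refine Eq.trans (lintegral_congr fun y => ?_) h1
  have : (y : ℝ) ∈ Icc (A + t) (B + t) ↔ (y : ℝ) - t ∈ Icc A B := by
    simp only [mem_Icc, le_sub_iff_add_le, sub_le_iff_le_add]
  by_cases hy : (y : ℝ) - t ∈ Icc A B
  · rw [indicator_of_mem hy, indicator_of_mem (by exact this.2 hy)]
    rfl
  · rw [indicator_of_notMem hy, indicator_of_notMem (by exact fun h => hy (this.1 h))]

/-! ### Charge of the gaps -/

/-- One scenario is enough: the first ring falls in `(T, b]`, where a jump is certain, it leads to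
`x k`, and the clock is then silent until `t`. The density `e^{-u} e^{-(t-u)} = e^{-t}` does not
depend on `u`. -/
theorem le_transOp_of_ring_between {F : ℝ≥0 → ℝ≥0∞} (hF : Measurable F) {T t y : ℝ≥0} (k : ℕ)
    {b : ℝ} (hb : b ≤ t) (hy : ∀ s, T ≤ s → (M.flow y s : ℝ) ≤ 1 / 2)
    (hk : ∀ s : ℝ≥0, (t : ℝ) - b ≤ s → s ≤ t - T → F (M.flow (M.x k) s) = 1) :
    ENNReal.ofReal (Real.exp (-t)) * M.weight k * ENNReal.ofReal (b - T) ≤ M.transOp F t y := by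
  rw [M.transOp_first_ring hF]
  refine le_trans ?_ le_add_self
  calc _ = ∫⁻ u in Ioc (T : ℝ) b, ENNReal.ofReal (Real.exp (-t)) * M.weight k := by
        rw [setLIntegral_const, Real.volume_Ioc]
    _ ≤ ∫⁻ u in Ioc (T : ℝ) b, ENNReal.ofReal (Real.exp (-u)) *
        M.jump (M.transOp F (t - u.toNNReal)) (M.flow y u.toNNReal) := by
        refine setLIntegral_mono' measurableSet_Ioc fun u hu => ?_
        have hu0 : 0 < u := (NNReal.coe_nonneg T).trans_lt hu.1
        have hut : u.toNNReal ≤ t := Real.toNNReal_le_iff_le_coe.2 (hu.2.trans hb)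
        have hTu : T ≤ u.toNNReal := (Real.le_toNNReal_iff_coe_le hu0.le).2 hu.1.le
        rw [jump, M.rate_eq_one (hy _ hTu), ENNReal.ofReal_one, one_mul]
        have h1 : ENNReal.ofReal (Real.exp (-(t - u.toNNReal : ℝ≥0))) ≤
            M.transOp F (t - u.toNNReal) (M.x k) := by
          rw [M.transOp_first_ring hF, hk _ _ (tsub_le_tsub_left hTu t), mul_one]
          · exact le_self_add
          · rw [NNReal.coe_sub hut, Real.coe_toNNReal _ hu0.le]
            linarith [hu.2]
        calc _ = ENNReal.ofReal (Real.exp (-u)) *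
              (M.weight k * ENNReal.ofReal (Real.exp (-(t - u.toNNReal : ℝ≥0)))) := by
              rw [mul_left_comm, ← ENNReal.ofReal_mul (Real.exp_pos _).le, ← Real.exp_add,
                NNReal.coe_sub hut, Real.coe_toNNReal _ hu0.le, mul_comm]
              congr 3
              ring
          _ ≤ _ := by
              refine mul_le_mul_right ?_ _
              refine le_trans ?_ le_self_add
              exact (mul_le_mul_right h1 _).trans (ENNReal.le_tsum k)
    _ ≤ _ := lintegral_mono_set (Ioc_subset_Ioc (NNReal.coe_nonneg T) hb)

theorem measure_Icc_pos {π : Measure ℝ≥0} [IsProbabilityMeasure π]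
    (hπ : IsInvariant M.transition π) {k : ℕ} {c d : ℝ} (hc : 1 ≤ c) (hcd : c < d)
    (hd : d ≤ M.x k) : 0 < π {y | (y : ℝ) ∈ Icc c d} := by
  have hms : MeasurableSet {y : ℝ≥0 | (y : ℝ) ∈ Icc c d} := measurableSet_Icc.preimage (by fun_prop)
  obtain ⟨N, hN⟩ : ∃ N : ℕ, 0 < π (Iic (N : ℝ≥0)) := by
    by_contra! h
    have h1 : π (⋃ N : ℕ, Iic (N : ℝ≥0)) = 0 := measure_iUnion_null fun N => le_zero_iff.1 (h N)
    have h2 : (⋃ N : ℕ, Iic (N : ℝ≥0)) = univ := 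
      eq_univ_of_forall fun y => mem_iUnion.2 (exists_nat_ge y)
    rw [h2, measure_univ] at h1
    exact one_ne_zero h1
  obtain ⟨T, hT⟩ := M.exists_flow_le_half N
  have hd2 : 0 ≤ (M.x k : ℝ) - c := by linarith
  -- A jump to `x k` at a time between `T` and `T + (d - c)` leaves a travel time between `x k - d`
  -- and `x k - c`, hence a position in `[c, d]` at time `t`.
  set t : ℝ≥0 := T + ((M.x k : ℝ) - c).toNNReal with ht
  have htr : (t : ℝ) = T + (M.x k - c) := by
    rw [ht, NNReal.coe_add, Real.coe_toNNReal _ hd2]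
  set F : ℝ≥0 → ℝ≥0∞ := {y : ℝ≥0 | (y : ℝ) ∈ Icc c d}.indicator 1 with hF
  have hFm : Measurable F := measurable_one.indicator hms
  have hlow : ∀ y ∈ Iic (N : ℝ≥0), ENNReal.ofReal (Real.exp (-t)) * M.weight k *
      ENNReal.ofReal (T + (d - c) - T) ≤ M.transOp F t y := by
    intro y hy
    refine M.le_transOp_of_ring_between hFm k (by linarith) (hT y hy) fun s hs1 hs2 => ?_
    have hs2' : (s : ℝ) ≤ M.x k - c := by
      rw [ht, add_tsub_cancel_left] at hs2
      exact (Real.le_toNNReal_iff_coe_le hd2).1 hs2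
    have h1 := M.sub_le_flow (M.x k) s
    have h2 : (M.flow (M.x k) s : ℝ) = M.x k - s :=
      M.flow_eq_sub_of_one_le_flow (by rw [← NNReal.coe_le_coe]; push_cast; linarith)
    have h3 : M.flow (M.x k) s ∈ {y : ℝ≥0 | (y : ℝ) ∈ Icc c d} := ⟨by linarith, by linarith⟩
    rw [hF, indicator_of_mem h3, Pi.one_apply]
  rw [← lintegral_indicator_one hms, ← M.lintegral_transOp hπ hFm t]
  refine lt_of_lt_of_le ?_ (setLIntegral_le_lintegral (Iic (N : ℝ≥0)) _)
  refine lt_of_lt_of_le ?_ (setLIntegral_mono' measurableSet_Iic hlow)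
  rw [setLIntegral_const]
  refine ENNReal.mul_pos (mul_ne_zero (mul_ne_zero ?_ (M.weight_pos k).ne') ?_) hN.ne'
  · exact (ENNReal.ofReal_pos.2 (Real.exp_pos _)).ne'
  · exact (ENNReal.ofReal_pos.2 (by linarith)).ne'

end Model
/-! ### Test functions supported in a gap -/

theorem exists_bump : ∃ (ψ ψ' : ℝ → ℝ) (D : ℝ), 0 < D ∧ (∀ z, HasDerivAt ψ (ψ' z) z) ∧
    (∀ y z, |ψ' y - ψ' z| ≤ D * |y - z|) ∧ (∀ z, |ψ' z| ≤ D) ∧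
    (∀ z ∉ Icc (0 : ℝ) 1, ψ z = 0 ∧ ψ' z = 0) ∧ ∀ z ∈ Icc (1 / 3 : ℝ) (2 / 3), ψ z = 1 := by
  set b : ContDiffBump (1 / 2 : ℝ) := ⟨1 / 6, 1 / 2, by norm_num, by norm_num⟩ with hb
  have hc : ContDiff ℝ 2 b := b.contDiff
  have hd : ContDiff ℝ 1 (deriv b) := hc.deriv' (n := 1)
  have hcs : HasCompactSupport (deriv b) := b.hasCompactSupport.deriv
  obtain ⟨K, hK⟩ := hd.lipschitzWith_of_hasCompactSupport hcs one_ne_zero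
  obtain ⟨D, hD⟩ := hcs.exists_bound_of_continuous hd.continuous
  have hsupp : tsupport b ⊆ Icc 0 1 := by
    rw [b.tsupport_eq, Real.closedBall_eq_Icc]
    norm_num [hb]
  refine ⟨b, deriv b, max (max D K) 1, by positivity,
    fun z => (hc.differentiable two_ne_zero z).hasDerivAt, fun y z => ?_, fun z => ?_,
    fun z hz => ⟨?_, ?_⟩, fun z hz => ?_⟩
  · have := hK.dist_le_mul y z
    rw [Real.dist_eq, Real.dist_eq] at this
    exact this.trans (mul_le_mul_of_nonneg_right
      ((le_max_right _ _).trans (le_max_left _ _)) (abs_nonneg _))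
  · exact (hD z).trans ((le_max_left _ _).trans (le_max_left _ _))
  · exact image_eq_zero_of_notMem_tsupport fun h => hz (hsupp h)
  · exact image_eq_zero_of_notMem_tsupport fun h => hz (hsupp (tsupport_deriv_subset h))
  · refine b.one_of_mem_closedBall ?_
    rw [Real.closedBall_eq_Icc]
    norm_num [hb]
    constructor <;> linarith [hz.1, hz.2]

theorem exists_bump_family : ∃ D : ℝ, 0 < D ∧ ∀ u ℓ : ℝ, 0 < ℓ → ∃ χ χ' : ℝ → ℂ,
    (∀ z, HasDerivAt χ (χ' z) z) ∧ (∃ K : ℝ, 0 ≤ K ∧ ∀ y z, ‖χ' y - χ' z‖ ≤ K * |y - z|) ∧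
    (∀ z, ‖χ' z‖ ≤ D / ℓ) ∧ (∀ z ∉ Icc u (u + ℓ), χ z = 0 ∧ χ' z = 0) ∧
    ∀ z ∈ Icc (u + ℓ / 3) (u + 2 * ℓ / 3), χ z = 1 := by
  obtain ⟨ψ, ψ', D, hD, h1, h2, h3, h4, h5⟩ := exists_bump
  refine ⟨D, hD, fun u ℓ hℓ => ⟨fun z => (ψ ((z - u) / ℓ) : ℂ),
    fun z => ((ψ' ((z - u) / ℓ) * (1 / ℓ) : ℝ) : ℂ), fun z => ?_,
    ⟨D / ℓ ^ 2, by positivity, fun y z => ?_⟩, fun z => ?_, fun z hz => ?_, fun z hz => ?_⟩⟩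
  · have h : HasDerivAt (fun z => (z - u) / ℓ) (1 / ℓ) z :=
      ((hasDerivAt_id z).sub_const u).div_const ℓ
    exact ((h1 _).comp z h).ofReal_comp
  · rw [← Complex.ofReal_sub, Complex.norm_real, Real.norm_eq_abs, ← sub_mul, abs_mul,
      abs_of_pos (one_div_pos.2 hℓ)]
    calc _ ≤ D * |(y - u) / ℓ - (z - u) / ℓ| * (1 / ℓ) := by gcongr; exact h2 _ _
      _ = _ := by
        rw [← sub_div, sub_sub_sub_cancel_right, abs_div, abs_of_pos hℓ]
        field_simp
  · rw [Complex.norm_real, Real.norm_eq_abs, abs_mul, abs_of_pos (one_div_pos.2 hℓ), mul_one_div]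
    gcongr
    exact h3 _
  · have : (z - u) / ℓ ∉ Icc (0 : ℝ) 1 := by
      rintro ⟨ha, hb⟩
      rw [le_div_iff₀ hℓ] at ha
      rw [div_le_iff₀ hℓ] at hb
      exact hz ⟨by linarith, by linarith⟩
    simp [h4 _ this]
  · have : (z - u) / ℓ ∈ Icc (1 / 3 : ℝ) (2 / 3) := by
      rw [mem_Icc, le_div_iff₀ hℓ, div_le_iff₀ hℓ]
      exact ⟨by linarith [hz.1], by linarith [hz.2]⟩
    simp [h5 _ this]

namespace Model

variable (M : Model)

/-- Seven consecutive intervals of length `h` cover the left-hand set, and by translation invariance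
in the gap they have equal mass. -/
theorem measure_Icc_le_of_avoids {π : Measure ℝ≥0} (hπ : IsInvariant M.transition π) {u h : ℝ}
    (hh : 0 < h) (hav : M.Avoids u (u + h) (6 * h)) :
    π {y | (y : ℝ) ∈ Icc u (u + 6 * h)} ≤ 7 * π {y | (y : ℝ) ∈ Icc (u + h) (u + 2 * h)} := by
  have hshift : ∀ j : ℕ, j ≤ 6 → π {y | (y : ℝ) ∈ Icc (u + j * h) (u + h + j * h)} =
      π {y | (y : ℝ) ∈ Icc u (u + h)} := by
    intro j hj
    have hj' : (j : ℝ) * h ≤ 6 * h := by gcongr; exact_mod_cast hj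
    have e : (((j * h).toNNReal : ℝ≥0) : ℝ) = j * h := Real.coe_toNNReal _ (by positivity)
    have := M.measure_Icc_add_eq_of_avoids hπ (A := u) (B := u + h) (t := (j * h).toNNReal)
      (hav.mono le_rfl (by rw [e]; linarith))
    rwa [e] at this
  have hcover : {y : ℝ≥0 | (y : ℝ) ∈ Icc u (u + 6 * h)} ⊆
      ⋃ j ∈ Finset.range 7, {y : ℝ≥0 | (y : ℝ) ∈ Icc (u + j * h) (u + h + j * h)} := by
    intro y hy
    have hy1 : u ≤ (y : ℝ) := hy.1
    have hy2 : (y : ℝ) ≤ u + 6 * h := hy.2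
    have h0 : 0 ≤ ((y : ℝ) - u) / h := div_nonneg (by linarith) hh.le
    have h1 := Nat.floor_le h0
    have h2 := Nat.lt_floor_add_one (((y : ℝ) - u) / h)
    set j := ⌊((y : ℝ) - u) / h⌋₊ with hj
    have h3 : ((y : ℝ) - u) / h ≤ 6 := by rw [div_le_iff₀ hh]; linarith
    have h4 : j < 7 := by
      have : (j : ℝ) < 7 := by linarith
      exact_mod_cast this
    rw [le_div_iff₀ hh] at h1
    rw [div_lt_iff₀ hh] at h2
    exact mem_biUnion (Finset.mem_coe.2 (Finset.mem_range.2 h4)) ⟨by linarith, by linarith⟩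
  have hq := hshift 1 (by norm_num)
  calc _ ≤ ∑ j ∈ Finset.range 7, π {y | (y : ℝ) ∈ Icc (u + j * h) (u + h + j * h)} :=
        (measure_mono hcover).trans (measure_biUnion_finset_le _ _)
    _ = ∑ j ∈ Finset.range 7, π {y | (y : ℝ) ∈ Icc u (u + h)} :=
        Finset.sum_congr rfl fun j hj => hshift j (by have := Finset.mem_range.1 hj; omega)
    _ = 7 * π {y | (y : ℝ) ∈ Icc u (u + h)} := by simp
    _ = _ := by
        rw [← hq]
        congr 5 with y
        push_cast
        ring_nf

/-- A function supported in a gap, with zero mean, and its derivative. -/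
structure IsTest (π : Measure ℝ≥0) (τ : ℝ≥0) (φ φ' : ℝ → ℂ) : Prop where
  exists_avoids : ∃ A B, M.Avoids A B τ ∧ ∀ z ∉ Icc A B, φ z = 0
  pos : 0 < τ
  hasDerivAt : ∀ z, HasDerivAt φ (φ' z) z
  exists_lipschitz : ∃ K : ℝ, 0 ≤ K ∧ ∀ y z, ‖φ' y - φ' z‖ ≤ K * |y - z|
  exists_bound : ∃ K : ℝ, ∀ z, ‖φ z‖ ≤ K ∧ ‖φ' z‖ ≤ K
  integral_eq : ∫ y : ℝ≥0, φ y ∂π = 0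
  integral_deriv_eq : ∫ y : ℝ≥0, φ' y ∂π = 0

end Model
namespace Model

variable {M : Model}

/-- The function is the difference of a bump and its translate; translation invariance of `π` in the
gap makes the means of `φ` and `φ'` vanish. The norm of `φ` is bounded below by the mass of the
plateau of one bump, that of `φ'` above by the mass of the whole support, and these masses are
comparable. The constant is uniform in the model, `π`, `k` and `r`. -/
theorem exists_isTest : ∃ D : ℝ, 0 < D ∧ ∀ (M : Model) (π : Measure ℝ≥0) [IsProbabilityMeasure π],
    IsInvariant M.transition π → ∀ k, ∃ τ φ φ', M.IsTest π τ φ φ' ∧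
      ∀ r : ℝ≥0∞, 1 ≤ r → r ≠ ∞ → eLpNorm (fun y : ℝ≥0 => φ y) r π ≠ 0 ∧
        eLpNorm (fun y : ℝ≥0 => φ' y) r π ≤
          ENNReal.ofReal (D / ((M.x (k + 1) : ℝ) - M.x k)) * eLpNorm (fun y : ℝ≥0 => φ y) r π := by
  obtain ⟨D, hD, hfam⟩ := exists_bump_family
  -- The gap has length `9h`, `|φ'| ≤ 2D/(3h)` on its support, and the masses compare with factor 7:
  -- `7 · 2D/(3h) = 42D/(9h)`.
  refine ⟨42 * D, by positivity, fun M π _ hπ k => ?_⟩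
  have hL : (0 : ℝ) < (M.x (k + 1) : ℝ) - M.x k :=
    sub_pos.2 (by exact_mod_cast M.strictMono_x (Nat.lt_succ_self k))
  set h : ℝ := ((M.x (k + 1) : ℝ) - M.x k) / 9 with hh
  have hL9 : (M.x (k + 1) : ℝ) - M.x k = 9 * h := by rw [hh]; ring
  have hh0 : 0 < h := by positivity
  -- The two bumps occupy `[u, u + 6h]`. A margin `h` is kept below; above there are `2h`, of which
  -- one `h` is the time for which translation is valid.
  set u : ℝ := M.x k + h with hu
  have hav : ∀ {A B t : ℝ}, u ≤ A → B + t ≤ u + 7 * h → M.Avoids A B t := fun {A B t} h1 h2 =>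
    M.avoids_gap (k := k) (by linarith) (by linarith)
  obtain ⟨χ, χ', hχ1, ⟨K, hK, hχ2⟩, hχ3, hχ4, hχ5⟩ := hfam u (3 * h) (by positivity)
  have hχd : Differentiable ℝ χ := fun z => (hχ1 z).differentiableAt
  have hχm : Measurable χ := hχd.continuous.measurable
  have hχ'c : Continuous χ' := by
    refine continuous_iff_continuousAt.2 fun z => tendsto_iff_norm_sub_tendsto_zero.2 ?_
    refine squeeze_zero (fun _ => norm_nonneg _) (fun y => hχ2 y z) ?_
    have : Tendsto (fun y : ℝ => K * |y - z|) (𝓝 z) (𝓝 (K * |z - z|)) :=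
      Continuous.tendsto (by fun_prop) z
    simpa using this
  obtain ⟨C, hC⟩ := (HasCompactSupport.of_support_subset_isCompact isCompact_Icc
    (fun z hz => by_contra fun hn => hz (hχ4 z hn).1)).exists_bound_of_continuous hχd.continuous
  have hmean : ∀ η : ℝ → ℂ, Continuous η → (∃ C, ∀ z, ‖η z‖ ≤ C) →
      (∀ z ∉ Icc u (u + 3 * h), η z = 0) → ∫ y : ℝ≥0, (η y - η (y - 3 * h)) ∂π = 0 := by
    rintro η hη ⟨C, hηC⟩ hη0
    have e : (((3 * h).toNNReal : ℝ≥0) : ℝ) = 3 * h := Real.coe_toNNReal _ (by positivity)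
    have hi : ∀ c : ℝ, Integrable (fun y : ℝ≥0 => η (y - c)) π := fun c =>
      Integrable.of_bound (C := C) (Continuous.aestronglyMeasurable (by fun_prop))
        (ae_of_all _ fun y => hηC _)
    have hi0 := hi 0
    simp only [sub_zero] at hi0
    have := M.integral_sub_eq_of_avoids hπ (t := (3 * h).toNNReal) (hav le_rfl (by rw [e]; linarith))
      hη0 hη.measurable hi0
    rw [e] at this
    rw [integral_sub hi0 (hi _), this, sub_self]
  have hzero : ∀ z ∉ Icc u (u + 6 * h), χ z - χ (z - 3 * h) = 0 ∧ χ' z - χ' (z - 3 * h) = 0 := by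
    intro z hz
    have h1 : z ∉ Icc u (u + 3 * h) := fun h => hz ⟨h.1, by linarith [h.2]⟩
    have h2 : z - 3 * h ∉ Icc u (u + 3 * h) := fun h => hz ⟨by linarith [h.1], by linarith [h.2]⟩
    simp [hχ4 _ h1, hχ4 _ h2]
  have hbd : ∀ z, ‖χ' z - χ' (z - 3 * h)‖ ≤ 2 * D / (3 * h) := fun z => by
    refine (norm_sub_le _ _).trans ((add_le_add (hχ3 _) (hχ3 _)).trans_eq ?_)
    ring
  refine ⟨h.toNNReal, fun z => χ z - χ (z - 3 * h), fun z => χ' z - χ' (z - 3 * h),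
    ⟨⟨u, u + 6 * h, hav le_rfl (by rw [Real.coe_toNNReal _ hh0.le]; linarith),
      fun z hz => (hzero z hz).1⟩, Real.toNNReal_pos.2 hh0, fun z => ?_, ⟨2 * K, by positivity,
      fun y z => ?_⟩, ⟨max (2 * C) (2 * D / (3 * h)), fun z => ⟨?_, ?_⟩⟩, ?_, ?_⟩, ?_⟩
  · exact (hχ1 z).sub ((hχ1 _).comp_sub_const z (3 * h))
  · calc ‖χ' y - χ' (y - 3 * h) - (χ' z - χ' (z - 3 * h))‖
        = ‖(χ' y - χ' z) - (χ' (y - 3 * h) - χ' (z - 3 * h))‖ := by congr 1; ring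
      _ ≤ K * |y - z| + K * |y - 3 * h - (z - 3 * h)| :=
        (norm_sub_le _ _).trans (add_le_add (hχ2 _ _) (hχ2 _ _))
      _ = _ := by rw [sub_sub_sub_cancel_right]; ring
  · refine le_trans ((norm_sub_le _ _).trans ((add_le_add (hC _) (hC _)).trans_eq ?_))
      (le_max_left _ _)
    ring
  · exact (hbd z).trans (le_max_right _ _)
  · exact hmean χ hχd.continuous ⟨C, hC⟩ fun z hz => (hχ4 z hz).1
  · exact hmean χ' hχ'c ⟨_, hχ3⟩ fun z hz => (hχ4 z hz).2
  · intro r hr hr'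
    set q := π {y | (y : ℝ) ∈ Icc (u + h) (u + 2 * h)} with hq
    have hms : ∀ a b : ℝ, MeasurableSet {y : ℝ≥0 | (y : ℝ) ∈ Icc a b} := fun a b =>
      measurableSet_Icc.preimage (by fun_prop)
    have hr0 : r ≠ 0 := (zero_lt_one.trans_le hr).ne'
    have hr1 : 1 ≤ r.toReal := by simpa using ENNReal.toReal_mono hr' hr
    have hq0 : 0 < q := M.measure_Icc_pos hπ (k := k + 1)
      (by have : (1 : ℝ) ≤ M.x k := by exact_mod_cast M.one_le_x k
          linarith) (by linarith) (by linarith)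
    have hlow : q ^ (1 / r.toReal) ≤ eLpNorm (fun y : ℝ≥0 => χ y - χ (y - 3 * h)) r π := by
      have h1 := eLpNorm_indicator_const (c := (1 : ℂ)) (μ := π)
        (hms (u + h) (u + 2 * h)) hr0 hr'
      rw [enorm_one, one_mul] at h1
      rw [← h1]
      refine eLpNorm_mono_enorm fun y => ?_
      by_cases hy : y ∈ {y : ℝ≥0 | (y : ℝ) ∈ Icc (u + h) (u + 2 * h)}
      · have hy' : (y : ℝ) ∈ Icc (u + h) (u + 2 * h) := hy
        rw [indicator_of_mem hy, hχ5 y ⟨by linarith [hy'.1], by linarith [hy'.2]⟩,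
          (hχ4 (y - 3 * h) fun h => by linarith [h.1, hy'.2]).1, sub_zero]
      · rw [indicator_of_notMem hy]
        simp
    have hqr : 0 < q ^ (1 / r.toReal) := ENNReal.rpow_pos hq0 (measure_ne_top _ _)
    refine ⟨(hqr.trans_le hlow).ne', ?_⟩
    calc eLpNorm (fun y : ℝ≥0 => χ' y - χ' (y - 3 * h)) r π
        ≤ eLpNorm ({y : ℝ≥0 | (y : ℝ) ∈ Icc u (u + 6 * h)}.indicator
            fun _ => (2 * D / (3 * h) : ℝ)) r π := by
          refine eLpNorm_mono_real fun y => ?_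
          by_cases hy : y ∈ {y : ℝ≥0 | (y : ℝ) ∈ Icc u (u + 6 * h)}
          · rw [indicator_of_mem hy]
            exact hbd y
          · rw [indicator_of_notMem hy, (hzero y hy).2, norm_zero]
      _ = ENNReal.ofReal (2 * D / (3 * h)) *
          π {y | (y : ℝ) ∈ Icc u (u + 6 * h)} ^ (1 / r.toReal) := by
          rw [eLpNorm_indicator_const (hms _ _) hr0 hr', Real.enorm_of_nonneg (by positivity)]
      _ ≤ ENNReal.ofReal (2 * D / (3 * h)) * (7 * q) ^ (1 / r.toReal) := by
          gcongr
          exact M.measure_Icc_le_of_avoids hπ hh0 (hav le_rfl (by linarith))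
      _ ≤ ENNReal.ofReal (2 * D / (3 * h)) * (7 * q ^ (1 / r.toReal)) := by
          rw [ENNReal.mul_rpow_of_nonneg _ _ (by positivity)]
          gcongr
          conv_rhs => rw [← ENNReal.rpow_one 7]
          refine ENNReal.rpow_le_rpow_of_exponent_le (by norm_num) ?_
          rw [div_le_one (by linarith)]
          exact hr1
      _ = ENNReal.ofReal (42 * D / ((M.x (k + 1) : ℝ) - M.x k)) * q ^ (1 / r.toReal) := by
          rw [← mul_assoc, ← ENNReal.ofReal_ofNat 7, ← ENNReal.ofReal_mul (by positivity), hL9]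
          congr 2
          field_simp
          ring
      _ ≤ _ := by gcongr

/-! ### The semigroup on test functions: translation, isometry, generator. -/

namespace IsTest

variable {π : Measure ℝ≥0} {τ : ℝ≥0} {φ φ' : ℝ → ℂ}

theorem continuous (h : M.IsTest π τ φ φ') : Continuous φ :=
  continuous_iff_continuousAt.2 fun z => (h.hasDerivAt z).continuousAt

theorem continuous_deriv (h : M.IsTest π τ φ φ') : Continuous φ' := by
  obtain ⟨K, hK, hL⟩ := h.exists_lipschitz
  refine continuous_iff_continuousAt.2 fun z => tendsto_iff_norm_sub_tendsto_zero.2 ?_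
  refine squeeze_zero (fun _ => norm_nonneg _) (fun y => hL y z) ?_
  have : Tendsto (fun y : ℝ => K * |y - z|) (𝓝 z) (𝓝 (K * |z - z|)) :=
    Continuous.tendsto (by fun_prop) z
  simpa using this

theorem memLp [IsProbabilityMeasure π] (h : M.IsTest π τ φ φ') (r : ℝ≥0∞) :
    MemLp (fun y : ℝ≥0 => φ y) r π := by
  obtain ⟨K, hK⟩ := h.exists_bound
  have := h.continuous
  exact MemLp.of_bound (Continuous.aestronglyMeasurable (by fun_prop)) K
    (ae_of_all _ fun y => (hK y).1)

theorem memLp_deriv [IsProbabilityMeasure π] (h : M.IsTest π τ φ φ') (r : ℝ≥0∞) :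
    MemLp (fun y : ℝ≥0 => -φ' y) r π := by
  obtain ⟨K, hK⟩ := h.exists_bound
  have := h.continuous_deriv
  exact MemLp.of_bound (Continuous.aestronglyMeasurable (by fun_prop)) K
    (ae_of_all _ fun y => by rw [norm_neg]; exact (hK y).2)

/-- The mean value inequality for `s ↦ φ(y - s) + s φ'(y)`, whose derivative is at most `Kt` on `[0,
t]`. The bound is uniform in `y`, so it yields convergence in every `L_r` of a probability measure.
-/
theorem norm_diffQuotient_le {K : ℝ} (hd : ∀ z, HasDerivAt φ (φ' z) z)
    (hL : ∀ y z, ‖φ' y - φ' z‖ ≤ K * |y - z|) (hK : 0 ≤ K) {t : ℝ} (ht : 0 < t) (y : ℝ) :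
    ‖(t : ℂ)⁻¹ * (φ (y - t) - φ y) - -φ' y‖ ≤ K * t := by
  have h1 : ∀ s ∈ Icc (0 : ℝ) t, HasDerivWithinAt (fun s : ℝ => φ (y - s) + (s : ℂ) * φ' y)
      (-φ' (y - s) + φ' y) (Icc 0 t) s := by
    intro s _
    have e1 : HasDerivAt (fun s : ℝ => φ (y - s)) (-φ' (y - s)) s :=
      (hd (y - s)).comp_const_sub y s
    have e2 : HasDerivAt (fun s : ℝ => (s : ℂ) * φ' y) (φ' y) s := by
      simpa using (Complex.ofRealCLM.hasDerivAt (x := s)).mul_const (φ' y)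
    exact (e1.add e2).hasDerivWithinAt
  have h2 : ∀ s ∈ Ico (0 : ℝ) t, ‖-φ' (y - s) + φ' y‖ ≤ K * t := by
    intro s hs
    rw [neg_add_eq_sub]
    refine (hL _ _).trans ?_
    rw [sub_sub_cancel, abs_of_nonneg hs.1]
    gcongr
    exact hs.2.le
  have h3 := norm_image_sub_le_of_norm_deriv_le_segment' h1 h2 t ⟨ht.le, le_rfl⟩
  have ht' : (t : ℂ) ≠ 0 := by exact_mod_cast ht.ne'
  have e : (t : ℂ)⁻¹ * (φ (y - t) - φ y) - -φ' y =
      (t : ℂ)⁻¹ * (φ (y - t) + (t : ℂ) * φ' y - (φ (y - 0) + ((0 : ℝ) : ℂ) * φ' y)) := by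
    rw [sub_zero, Complex.ofReal_zero]
    field_simp
    ring
  rw [e, norm_mul, norm_inv, Complex.norm_real, Real.norm_eq_abs, abs_of_pos ht,
    inv_mul_le_iff₀ ht]
  linarith

variable {r : ℝ≥0∞} [Fact (1 ≤ r)] {V : Submodule ℂ (Lp ℂ r π)}

theorem lpSemigroup_ae_eq (h : M.IsTest π τ φ φ') (hπ : IsInvariant M.transition π)
    (hV : ∀ t (f : V), ((lpSemigroup M.transition V t f : Lp ℂ r π) : ℝ≥0 → ℂ) =ᵐ[π]
      markovOp M.transition t ((f : Lp ℂ r π) : ℝ≥0 → ℂ))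
    {f : V} (hf : ((f : Lp ℂ r π) : ℝ≥0 → ℂ) =ᵐ[π] fun y => φ y) {t : ℝ≥0} (ht : t ≤ τ) :
    ((lpSemigroup M.transition V t f : Lp ℂ r π) : ℝ≥0 → ℂ) =ᵐ[π] fun y => φ (y - t) := by
  obtain ⟨A, B, hav, h0⟩ := h.exists_avoids
  have ht' : (t : ℝ) ≤ τ := by exact_mod_cast ht
  refine (hV t f).trans ((M.markovOp_congr_ae hπ hf t).trans (ae_of_all _ fun y => ?_))
  exact M.markovOp_eq_of_avoids (hav.mono le_rfl (by linarith)) h0 h.continuous.measurable y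

theorem norm_lpSemigroup (h : M.IsTest π τ φ φ') (hπ : IsInvariant M.transition π) (hr : r ≠ ∞)
    (hV : ∀ t (f : V), ((lpSemigroup M.transition V t f : Lp ℂ r π) : ℝ≥0 → ℂ) =ᵐ[π]
      markovOp M.transition t ((f : Lp ℂ r π) : ℝ≥0 → ℂ))
    {f : V} (hf : ((f : Lp ℂ r π) : ℝ≥0 → ℂ) =ᵐ[π] fun y => φ y) {t : ℝ≥0} (ht : t ≤ τ) :
    ‖lpSemigroup M.transition V t f‖ = ‖f‖ := by
  obtain ⟨A, B, hav, h0⟩ := h.exists_avoids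
  have ht' : (t : ℝ) ≤ τ := by exact_mod_cast ht
  have hr1 : (1 : ℝ≥0∞) ≤ r := Fact.out
  have hr0 : r ≠ 0 := (zero_lt_one.trans_le hr1).ne'
  have hφ := h.continuous.measurable
  rw [← Submodule.norm_coe, ← Submodule.norm_coe, Lp.norm_def, Lp.norm_def,
    eLpNorm_congr_ae (h.lpSemigroup_ae_eq hπ hV hf ht), eLpNorm_congr_ae hf,
    eLpNorm_eq_lintegral_rpow_enorm_toReal hr0 hr, eLpNorm_eq_lintegral_rpow_enorm_toReal hr0 hr]
  congr 2
  refine M.lintegral_sub_eq_of_avoids hπ (φ := fun z => ‖φ z‖ₑ ^ r.toReal)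
    (hav.mono le_rfl (by linarith)) (fun z hz => ?_) (by fun_prop)
  simp [h0 z hz, ENNReal.toReal_pos hr0 hr]

theorem hasGenerator [IsProbabilityMeasure π] (h : M.IsTest π τ φ φ')
    (hπ : IsInvariant M.transition π)
    (hV : ∀ t (f : V), ((lpSemigroup M.transition V t f : Lp ℂ r π) : ℝ≥0 → ℂ) =ᵐ[π]
      markovOp M.transition t ((f : Lp ℂ r π) : ℝ≥0 → ℂ))
    {f g : V} (hf : ((f : Lp ℂ r π) : ℝ≥0 → ℂ) =ᵐ[π] fun y => φ y)
    (hg : ((g : Lp ℂ r π) : ℝ≥0 → ℂ) =ᵐ[π] fun y => -φ' y) :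
    HasGenerator (lpSemigroup M.transition V) f g := by
  obtain ⟨K, hK, hL⟩ := h.exists_lipschitz
  refine tendsto_iff_norm_sub_tendsto_zero.2 ?_
  have hlim : Tendsto (fun t : ℝ≥0 => K * (t : ℝ)) (𝓝[>] 0) (𝓝 0) := by
    have : Tendsto (fun t : ℝ≥0 => K * (t : ℝ)) (𝓝 0) (𝓝 (K * (0 : ℝ≥0))) :=
      Continuous.tendsto (by fun_prop) 0
    rw [NNReal.coe_zero, mul_zero] at this
    exact this.mono_left nhdsWithin_le_nhds
  refine squeeze_zero' (Eventually.of_forall fun _ => norm_nonneg _) ?_ hlim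
  filter_upwards [Ioc_mem_nhdsGT h.pos] with t ht
  have ht0 : (0 : ℝ) < t := by exact_mod_cast ht.1
  rw [← Submodule.norm_coe]
  refine (Lp.norm_le_of_ae_bound (C := K * t) (by positivity) ?_).trans_eq (by simp [measureUnivNNReal])
  have e1 := Lp.coeFn_sub (((t : ℝ) : ℂ)⁻¹ • ((lpSemigroup M.transition V t f : Lp ℂ r π) - (f : Lp ℂ r π))) (g : Lp ℂ r π)
  have e2 := Lp.coeFn_smul (((t : ℝ) : ℂ)⁻¹) ((lpSemigroup M.transition V t f : Lp ℂ r π) - (f : Lp ℂ r π))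
  have e3 := Lp.coeFn_sub (lpSemigroup M.transition V t f : Lp ℂ r π) (f : Lp ℂ r π)
  filter_upwards [e1, e2, e3, h.lpSemigroup_ae_eq hπ hV hf ht.2, hf, hg] with y h1 h2 h3 h4 h5 h6
  have h7 : (((((t : ℝ) : ℂ)⁻¹ • (lpSemigroup M.transition V t f - f) - g : V) : Lp ℂ r π) :
      ℝ≥0 → ℂ) y = ((t : ℝ) : ℂ)⁻¹ * (φ (y - t) - φ y) - -φ' y := by
    refine Eq.trans h1 ?_
    rw [Pi.sub_apply, h2, Pi.smul_apply, h3, Pi.sub_apply, h4, h5, h6, smul_eq_mul]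
  rw [h7]
  exact norm_diffQuotient_le h.hasDerivAt hL hK ht0 y

end IsTest

end Model
-- With `d_t` the difference quotient, expanding `‖f + t d_t‖² = ‖f‖²` gives `2 Re ⟨d_t, f⟩ = -t
-- ‖d_t‖²`, which tends to zero.
theorem HasGenerator.re_inner_eq_zero {E : Type*} [NormedAddCommGroup E] [InnerProductSpace ℂ E]
    {T : ℝ≥0 → E → E} {f g : E} (h : HasGenerator T f g)
    (hT : ∀ᶠ t in 𝓝[>] (0 : ℝ≥0), ‖T t f‖ = ‖f‖) : (inner ℂ g f).re = 0 := by
  set d : ℝ≥0 → E := fun t => ((t : ℝ) : ℂ)⁻¹ • (T t f - f) with hd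
  have h' : Tendsto d (𝓝[>] 0) (𝓝 g) := h
  have h1 : Tendsto (fun t => 2 * (inner ℂ (d t) f).re) (𝓝[>] 0) (𝓝 (2 * (inner ℂ g f).re)) :=
    ((Complex.continuous_re.tendsto _).comp (h'.inner tendsto_const_nhds)).const_mul 2
  have ht : Tendsto (fun t : ℝ≥0 => (t : ℝ)) (𝓝[>] 0) (𝓝 0) :=
    (NNReal.continuous_coe.tendsto 0).mono_left nhdsWithin_le_nhds
  have h2 : Tendsto (fun t : ℝ≥0 => -((t : ℝ) * ‖d t‖ ^ 2)) (𝓝[>] 0) (𝓝 0) := by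
    have := (ht.mul (h'.norm.pow 2)).neg
    simpa using this
  have h3 : (fun t : ℝ≥0 => -((t : ℝ) * ‖d t‖ ^ 2)) =ᶠ[𝓝[>] 0]
      fun t => 2 * (inner ℂ (d t) f).re := by
    filter_upwards [hT, self_mem_nhdsWithin] with t h4 h5
    have h5' : (0 : ℝ) < t := by exact_mod_cast h5
    have h6 : T t f = ((t : ℝ) : ℂ) • d t + f := by
      rw [hd]
      simp only
      rw [smul_inv_smul₀ (by exact_mod_cast h5'.ne'), sub_add_cancel]
    have h7 := norm_add_sq (𝕜 := ℂ) (((t : ℝ) : ℂ) • d t) f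
    rw [← h6, h4, norm_smul, inner_smul_left, Complex.conj_ofReal, Complex.norm_real,
      Real.norm_eq_abs, abs_of_pos h5'] at h7
    simp only [RCLike.re_to_complex, Complex.re_ofReal_mul] at h7
    have h8 : (t : ℝ) * (2 * (inner ℂ (d t) f).re + t * ‖d t‖ ^ 2) = 0 := by linarith
    rcases mul_eq_zero.1 h8 with h9 | h9
    · exact absurd h9 h5'.ne'
    · linarith
  have := tendsto_nhds_unique h1 (h2.congr' h3)
  linarith

/-! ### Necessity of bounded gaps, failure of the Poincaré inequality, and an example. -/

namespace Model

variable (M : Model)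

theorem boundedGaps_of_SG {π : Measure ℝ≥0} [IsProbabilityMeasure π]
    (hπ : IsInvariant M.transition π) {r : ℝ≥0∞} [Fact (1 ≤ r)] (hr : 1 < r) (hr' : r ≠ ∞)
    {γ : ℝ} (hγ : 0 < γ) (hSG : SG M.transition π r γ) : M.BoundedGaps := by
  obtain ⟨D, hD, htest⟩ := exists_isTest
  -- Only the resolvent at `0` is used: `f = R(-g)` gives `‖f‖ ≤ ‖R‖ ‖g‖ ≤ ‖R‖ (D/L) ‖f‖`, hence `L
  -- ≤ ‖R‖ D` for each gap.
  obtain ⟨R, -, hR⟩ := hSG 0 (by simpa using hγ)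
  refine ⟨‖R‖ * D, ?_⟩
  rintro _ ⟨k, rfl⟩
  simp only
  obtain ⟨τ, φ, φ', h, hφ⟩ := htest M π hπ k
  obtain ⟨hpos, hle⟩ := hφ r hr.le hr'
  have hL : (0 : ℝ) < (M.x (k + 1) : ℝ) - M.x k :=
    sub_pos.2 (by exact_mod_cast M.strictMono_x (Nat.lt_succ_self k))
  set L := (M.x (k + 1) : ℝ) - M.x k with hLd
  set f : LpZero π r := ⟨(h.memLp r).toLp _, by
    rw [mem_lpZero_iff, integral_congr_ae (h.memLp r).coeFn_toLp, h.integral_eq]⟩ with hf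
  set g : LpZero π r := ⟨(h.memLp_deriv r).toLp _, by
    rw [mem_lpZero_iff, integral_congr_ae (h.memLp_deriv r).coeFn_toLp, integral_neg,
      h.integral_deriv_eq, neg_zero]⟩ with hg
  have hfg := h.hasGenerator hπ (fun t f => M.lpSemigroup_lpZero_ae_eq hπ hr hr' t f)
    (f := f) (g := g) (h.memLp r).coeFn_toLp (h.memLp_deriv r).coeFn_toLp
  have h1 := hR f g hfg
  rw [zero_smul, zero_sub] at h1
  have h2 : ‖f‖ ≤ ‖R‖ * ‖g‖ := by
    calc ‖f‖ = ‖R (-g)‖ := by rw [h1]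
      _ ≤ ‖R‖ * ‖g‖ := (R.le_opNorm _).trans_eq (by rw [norm_neg])
  have hfn : ‖f‖ = (eLpNorm (fun y : ℝ≥0 => φ y) r π).toReal := Lp.norm_toLp _ (h.memLp r)
  have hgn : ‖g‖ = (eLpNorm (fun y : ℝ≥0 => φ' y) r π).toReal := by
    have : ‖g‖ = (eLpNorm (-fun y : ℝ≥0 => φ' y) r π).toReal := Lp.norm_toLp _ (h.memLp_deriv r)
    rw [this, eLpNorm_neg]
  have hf0 : 0 < ‖f‖ := by
    rw [hfn]
    exact ENNReal.toReal_pos hpos (h.memLp r).2.ne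
  have h3 : ‖g‖ ≤ D / L * ‖f‖ := by
    have := ENNReal.toReal_mono (ENNReal.mul_ne_top ENNReal.ofReal_ne_top (h.memLp r).2.ne) hle
    rwa [ENNReal.toReal_mul, ENNReal.toReal_ofReal (by positivity), ← hfn, ← hgn] at this
  have h4 : 1 * ‖f‖ ≤ ‖R‖ * (D / L) * ‖f‖ := by
    rw [one_mul, mul_assoc]
    exact h2.trans (by gcongr)
  have h5 := le_of_mul_le_mul_right h4 hf0
  rwa [← mul_div_assoc, le_div_iff₀ hL, one_mul] at h5

theorem not_PI {π : Measure ℝ≥0} [IsProbabilityMeasure π] (hπ : IsInvariant M.transition π)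
    {γ : ℝ} (hγ : 0 < γ) : ¬ PI M.transition π γ := by
  intro hPI
  obtain ⟨D, hD, htest⟩ := exists_isTest
  obtain ⟨τ, φ, φ', h, hφ⟩ := htest M π hπ 0
  obtain ⟨hpos, -⟩ := hφ 2 (by norm_num) (by norm_num)
  set f : LpZero π 2 := ⟨(h.memLp 2).toLp _, by
    rw [mem_lpZero_iff, integral_congr_ae (h.memLp 2).coeFn_toLp, h.integral_eq]⟩ with hf
  have hf0 : 0 < ‖f‖ := by
    have : ‖f‖ = (eLpNorm (fun y : ℝ≥0 => φ y) 2 π).toReal := Lp.norm_toLp _ (h.memLp 2)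
    rw [this]
    exact ENNReal.toReal_pos hpos (h.memLp 2).2.ne
  -- The norm is unchanged at the positive time `τ`, while the inequality demands a factor below 1.
  have h1 := hPI τ f
  rw [h.norm_lpSemigroup hπ (by norm_num)
    (fun t f => M.lpSemigroup_lpZero_ae_eq hπ (by norm_num) (by norm_num) t f)
    (h.memLp 2).coeFn_toLp le_rfl] at h1
  have h2 : Real.exp (-γ * τ) < 1 := by
    rw [Real.exp_lt_one_iff]
    have : (0 : ℝ) < τ := by exact_mod_cast h.pos
    nlinarith
  nlinarith

theorem not_poincareDirichlet {π : Measure ℝ≥0} [IsProbabilityMeasure π]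
    (hπ : IsInvariant M.transition π) (c : ℝ) : ¬ PoincareDirichlet M.transition π c := by
  intro hP
  obtain ⟨D, hD, htest⟩ := exists_isTest
  obtain ⟨τ, φ, φ', h, hφ⟩ := htest M π hπ 0
  obtain ⟨hpos, -⟩ := hφ 2 (by norm_num) (by norm_num)
  have hV := fun t f => M.lpSemigroup_top_ae_eq hπ (r := 2) (by norm_num) (by norm_num) t f
  set f : (⊤ : Submodule ℂ (Lp ℂ 2 π)) := ⟨(h.memLp 2).toLp _, trivial⟩ with hf
  set g : (⊤ : Submodule ℂ (Lp ℂ 2 π)) := ⟨(h.memLp_deriv 2).toLp _, trivial⟩ with hg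
  have hf0 : 0 < ‖f‖ := by
    have : ‖f‖ = (eLpNorm (fun y : ℝ≥0 => φ y) 2 π).toReal := Lp.norm_toLp _ (h.memLp 2)
    rw [this]
    exact ENNReal.toReal_pos hpos (h.memLp 2).2.ne
  have hfg := h.hasGenerator hπ hV (f := f) (g := g) (h.memLp 2).coeFn_toLp
    (h.memLp_deriv 2).coeFn_toLp
  have h1 := hP f g hfg
  have h2 : (inner ℂ g f).re = 0 := hfg.re_inner_eq_zero (by
    filter_upwards [Ioc_mem_nhdsGT h.pos] with t ht
    exact h.norm_lpSemigroup hπ (by norm_num) hV (h.memLp 2).coeFn_toLp ht.2)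
  rw [Submodule.coe_inner] at h2
  have h3 : ∫ x, (f : Lp ℂ 2 π) x ∂π = 0 := by
    rw [integral_congr_ae (h.memLp 2).coeFn_toLp, h.integral_eq]
  rw [h2, h3, norm_zero] at h1
  nlinarith

/-- A model with the points `x_k = k`. -/
noncomputable def unitGaps : Model where
  a := Real.smoothTransition
  θ y := Real.smoothTransition (2 - 2 * y)
  p := 1 / 2
  x k := k + 1
  contDiffOn_a := Real.smoothTransition.contDiff.contDiffOn
  contDiffOn_θ := (Real.smoothTransition.contDiff.comp (by fun_prop)).contDiffOn
  a_mem y _ := ⟨Real.smoothTransition.nonneg y, Real.smoothTransition.le_one y⟩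
  θ_mem y _ := ⟨Real.smoothTransition.nonneg _, Real.smoothTransition.le_one _⟩
  a_zero := Real.smoothTransition.zero
  a_pos _ hy := Real.smoothTransition.pos_of_pos hy
  a_eq_one _ hy := Real.smoothTransition.one_of_one_le hy
  θ_eq_zero y hy := Real.smoothTransition.zero_of_nonpos (by linarith)
  θ_eq_one y _ hy := Real.smoothTransition.one_of_one_le (by linarith)
  p_pos := by norm_num
  p_lt_one := by norm_num
  one_le_x k := le_add_self
  strictMono_x j k hjk := by
    have : (j : ℝ≥0) + 1 < k + 1 := by exact_mod_cast Nat.succ_lt_succ hjk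
    exact this

theorem boundedGaps_unitGaps : unitGaps.BoundedGaps := by
  refine ⟨1, ?_⟩
  rintro _ ⟨k, rfl⟩
  simp [unitGaps]

theorem exists_invariant_of_boundedGaps (hb : M.BoundedGaps) :
    ∃ (π : Measure ℝ≥0) (_ : IsProbabilityMeasure π), IsInvariant M.transition π ∧
      (∀ π' : Measure ℝ≥0, IsProbabilityMeasure π' → IsInvariant M.transition π' → π' = π) ∧
      ∀ (r : ℝ≥0∞) [Fact (1 ≤ r)], 1 < r → r ≠ ∞ → ∃ γ : ℝ, 0 < γ ∧ GB M.transition π r γ := by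
  obtain ⟨G, hG0, hG, α, hα, h⟩ := M.exists_summable_of_boundedGaps hb
  have := M.isFiniteMeasure_occ hα h
  have := M.isProbabilityMeasure_statLaw
  exact ⟨M.statLaw, inferInstance, M.isInvariant_statLaw,
    fun π' _ hπ' => M.eq_of_isInvariant hα h hπ', fun r _ hr hr' => M.exists_growthBound hb r hr hr'⟩

end Model
end DriftJump

theorem mainTheorem11 :
    (∀ M : DriftJump.Model,
      -- (1) exponential coupling
      (∀ α : ℝ, 0 < α → Summable (fun k : ℕ => M.p ^ (k + 1) * Real.exp (α * M.x k)) →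
        DriftJump.AdmitsExpCoupling M.transition M.pathLaw (fun y => Real.exp (α * y))) ∧
      -- (2) necessity of bounded gaps for a spectral gap
      (∀ π : Measure ℝ≥0, ∀ [IsProbabilityMeasure π], DriftJump.IsInvariant M.transition π →
        ∀ (r : ℝ≥0∞) [Fact (1 ≤ r)], 1 < r → r ≠ ∞ →
          ∀ γ : ℝ, 0 < γ → DriftJump.SG M.transition π r γ → M.BoundedGaps) ∧
      -- (2) sufficiency of bounded gaps for a growth bound
      (M.BoundedGaps →
        ∃ (π : Measure ℝ≥0) (_ : IsProbabilityMeasure π),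
          DriftJump.IsInvariant M.transition π ∧
          (∀ π' : Measure ℝ≥0, IsProbabilityMeasure π' →
            DriftJump.IsInvariant M.transition π' → π' = π) ∧
          ∀ (r : ℝ≥0∞) [Fact (1 ≤ r)], 1 < r → r ≠ ∞ →
            ∃ γ' : ℝ, 0 < γ' ∧ DriftJump.GB M.transition π r γ') ∧
      -- (3) failure of the Poincaré inequality
      (∀ π : Measure ℝ≥0, ∀ [IsProbabilityMeasure π], DriftJump.IsInvariant M.transition π →
        (∀ γ : ℝ, 0 < γ → ¬ DriftJump.PI M.transition π γ) ∧
        (∀ c : ℝ, ¬ DriftJump.PoincareDirichlet M.transition π c))) ∧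
    -- an exponential growth bound in `L_2` does not imply the Poincaré inequality
    (∃ (M : DriftJump.Model) (π : Measure ℝ≥0) (_ : IsProbabilityMeasure π),
      DriftJump.IsInvariant M.transition π ∧
      (∃ γ : ℝ, 0 < γ ∧ DriftJump.GB M.transition π 2 γ) ∧
      ∀ γ : ℝ, 0 < γ → ¬ DriftJump.PI M.transition π γ) := by
  refine ⟨fun M => ⟨fun α hα h => M.admitsExpCoupling hα h,
    fun π _ hπ r _ hr hr' γ hγ hSG => M.boundedGaps_of_SG hπ hr hr' hγ hSG,
    M.exists_invariant_of_boundedGaps, fun π _ hπ => ⟨fun γ hγ => M.not_PI hπ hγ,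
    fun c => M.not_poincareDirichlet hπ c⟩⟩, ?_⟩
  obtain ⟨π, hπ1, hπ, -, hGB⟩ :=
    DriftJump.Model.unitGaps.exists_invariant_of_boundedGaps DriftJump.Model.boundedGaps_unitGaps
  exact ⟨DriftJump.Model.unitGaps, π, hπ1, hπ, hGB 2 (by norm_num) (by norm_num),
    fun γ hγ => DriftJump.Model.unitGaps.not_PI hπ hγ⟩
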